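/- Let $d\ge 1$. For an absolutely summable $\phi:\mathbb{Z}^d\to\mathbb{C}$ put $\widehat\phi(\xi)=\sum_{x\in\mathbb{Z}^d}\phi(x)e^{ix\cdot\xi}$ for $\xi\in\mathbb{R}^d$, and define the convolution powers by $\phi^{(1)}=\phi$ and $\phi^{(n)}(x)=\sum_{y\in\mathbb{Z}^d}\phi^{(n-1)}(x-y)\phi(y)$ for $n\ge 2$. Let $\mathbb{T}^d=(-\pi,\pi]^d$, let $|\cdot|$ be the Euclidean norm, and let $\operatorname{Log}$ be the principal branch of the logarithm. A polynomial $P$ in $d$ variables with complex coefficients is called positive-homogeneous if (i) there is a real $d\times d$ matrix $E$ with $tP(\xi)=P(t^E\xi)$ for all $t>0$ and $\xi\in\mathbb{R}^d$, where $t^E=\exp((\ln t)E)$, and (ii) its real part $R=\operatorname{Re}P$ satisfies $R(\xi)\ge 0$ for all $\xi\in\mathbb{R}^d$, with $R(\xi)=0$ only for $\xi=0$. In this case all real matrices $E$ such that $tR(\xi)=R(t^E\xi)$ for all $t>0$, $\xi\in\mathbb{R}^d$ have the same trace; this number is the homogeneous order $\mu_P=\operatorname{tr}E$. The Legendre–Fenchel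 transform of $R$ is $R^{\#}(x)=\sup_{\xi\in\mathbb{R}^d}\{x\cdot\xi-R(\xi)\}$ for $x\in\mathbb{R}^d$. Theorem. Let $\phi:\mathbb{Z}^d\to\mathbb{C}$ be absolutely summable, such that $\widehat\phi$ is holomorphic on a neighborhood of $\mathbb{T}^d$ in $\mathbb{C}^d$ (that is, there are an open set $U\subseteq\mathbb{C}^d$ containing $\mathbb{T}^d$ and a holomorphic function on $U$ that agrees with $\widehat\phi$ on $U\cap\mathbb{R}^d$) and $\sup_{\xi\in\mathbb{T}^d}|\widehat\phi(\xi)|=1$. Let $\Omega(\phi)=\{\xi\in\mathbb{T}^d:|\widehat\phi(\xi)|=1\}$. Suppose that every $\xi_0\in\Omega(\phi)$ is a point of positive-homogeneous type for $\widehat\phi$: there are $\alpha_{\xi_0}\in\mathbb{R}^d$ and a positive-homogeneous polynomial $P_{\xi_0}$, with real part $R_{\xi_0}$, such that $$\operatorname{Log}\left(\frac{\widehat\phi(\xi+\xi_0)}{\widehat\phi(\xi_0)}\right)=i\alpha_{\xi_0}\cdot\xi-P_{\xi_0}(\xi)+\Upsilon_{\xi_0}(\xi),\qquad \Upsilon_{\xi_0}(\xi)=o(R_{\xi_0}(\xi))\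 \text{ as }\xi\to 0\text{ in }\mathbb{R}^d.$$ Fix any such choice of $\alpha_{\xi_0}$ and $P_{\xi_0}$ for each $\xi_0\in\Omega(\phi)$. Then $\Omega(\phi)$ is a finite set $\{\xi_1,\dots,\xi_K\}$ and, writing $\alpha_k=\alpha_{\xi_k}$, $R_k=R_{\xi_k}$ and $\mu_k=\mu_{P_{\xi_k}}$, each $R_k^{\#}$ is finite everywhere on $\mathbb{R}^d$, and there are positive constants $L$, $M_0,M_1,\dots,M_K$, $C_1,\dots,C_K$ such that, for all integers $n\ge 1$ and all $x\in\mathbb{Z}^d$, $$|\phi^{(n)}(x)|\le e^{-M_0(n+|x|)}\quad\text{if }|x|>Ln,$$ $$|\phi^{(n)}(x)|\le\sum_{k=1}^K\frac{C_k}{n^{\mu_k}}\exp\left(-nM_kR_k^{\#}\left(\frac{x-n\alpha_k}{n}\right)\right)\quad\text{if }|x|\le Ln.$$ -/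

import Mathlib

open scoped Topology

noncomputable section

namespace ConvPow

/-- The Fourier transform `ξ ↦ ∑ₓ φ(x) exp(i x · ξ)` of a function `φ` on `ℤ^d`
(used for absolutely summable `φ`). -/
def fourier {d : ℕ} (φ : (Fin d → ℤ) → ℂ) (ξ : Fin d → ℝ) : ℂ :=
  ∑' x : Fin d → ℤ, φ x * Complex.exp (Complex.I * ((∑ i, (x i : ℝ) * ξ i : ℝ) : ℂ))

/-- The convolution product `(φ ∗ ψ)(x) = ∑_y φ(x - y) ψ(y)` on `ℤ^d`. -/
def conv {d : ℕ} (φ ψ : (Fin d → ℤ) → ℂ) (x : Fin d → ℤ) : ℂ :=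
  ∑' y : Fin d → ℤ, φ (x - y) * ψ y

/-- Convolution powers: `φ^(1) = φ` and `φ^(n) = φ^(n-1) ∗ φ` for `n ≥ 2`
(by the usual convention `φ^(0)` is the unit mass at the origin). -/
def convPow {d : ℕ} (φ : (Fin d → ℤ) → ℂ) : ℕ → (Fin d → ℤ) → ℂ
  | 0 => Pi.single 0 1
  | 1 => φ
  | n + 2 => conv (convPow φ (n + 1)) φ

/-- The cube `(-π, π]^d`, representing the torus. -/
def torus (d : ℕ) : Set (Fin d → ℝ) :=
  Set.univ.pi fun _ => Set.Ioc (-Real.pi) Real.pi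

/-- The inclusion of `ℝ^d` into `ℂ^d`. -/
def toComplex {d : ℕ} (ξ : Fin d → ℝ) : Fin d → ℂ := fun i => (ξ i : ℂ)

/-- `φ` is absolutely summable and its Fourier transform is holomorphic on a neighborhood of the
torus in `ℂ^d`: some function that is holomorphic on an open set `U` of `ℂ^d` containing
`(-π, π]^d` agrees with the Fourier transform at every real point of `U`. -/
def MemH {d : ℕ} (φ : (Fin d → ℤ) → ℂ) : Prop :=
  (Summable fun x => ‖φ x‖) ∧
    ∃ (U : Set (Fin d → ℂ)) (F : (Fin d → ℂ) → ℂ),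
      IsOpen U ∧ (∀ ξ ∈ torus d, toComplex ξ ∈ U) ∧ DifferentiableOn ℂ F U ∧
        ∀ ξ : Fin d → ℝ, toComplex ξ ∈ U → F (toComplex ξ) = fourier φ ξ

/-- `φ` belongs to the previous class and the supremum over the torus of the modulus of its
Fourier transform is `1`. -/
def MemHStar {d : ℕ} (φ : (Fin d → ℤ) → ℂ) : Prop :=
  MemH φ ∧ IsLUB ((fun ξ => ‖fourier φ ξ‖) '' torus d) 1

/-- The points of the torus at which the Fourier transform has modulus `1`. -/
def Omega {d : ℕ} (φ : (Fin d → ℤ) → ℂ) : Set (Fin d → ℝ) :=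
  {ξ | ξ ∈ torus d ∧ ‖fourier φ ξ‖ = 1}

/-- `Γ_{ξ₀}(ξ) = Log (φ̂(ξ + ξ₀) / φ̂(ξ₀))`, with the principal branch of the logarithm. -/
def Gam {d : ℕ} (φ : (Fin d → ℤ) → ℂ) (ξ₀ ξ : Fin d → ℝ) : ℂ :=
  Complex.log (fourier φ (ξ + ξ₀) / fourier φ ξ₀)

/-- The matrix `t^E = exp((ln t) E)`, for `t > 0`. -/
def matPow {d : ℕ} (t : ℝ) (E : Matrix (Fin d) (Fin d) ℝ) : Matrix (Fin d) (Fin d) ℝ :=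
  NormedSpace.exp (Real.log t • E)

/-- The exponent set of a (real- or complex-valued) function on `ℝ^d`: all real matrices `E` with
`t f(ξ) = f(t^E ξ)` for all `t > 0` and all `ξ`. -/
def expSet {d : ℕ} {Y : Type*} [SMul ℝ Y] (f : (Fin d → ℝ) → Y) :
    Set (Matrix (Fin d) (Fin d) ℝ) :=
  {E | ∀ t : ℝ, 0 < t → ∀ ξ : Fin d → ℝ, t • f ξ = f ((matPow t E).mulVec ξ)}

/-- The function on `ℝ^d` given by a polynomial with complex coefficients. -/
def polyFun {d : ℕ} (P : MvPolynomial (Fin d) ℂ) (ξ : Fin d → ℝ) : ℂ :=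
  MvPolynomial.eval (toComplex ξ) P

/-- The real part `R = Re P` of a polynomial, as a function on `ℝ^d`. -/
def rePoly {d : ℕ} (P : MvPolynomial (Fin d) ℂ) (ξ : Fin d → ℝ) : ℝ :=
  (polyFun P ξ).re

/-- Positive-homogeneous polynomials: the exponent set is nonempty and the real part is
positive definite. -/
def IsPosHomPoly {d : ℕ} (P : MvPolynomial (Fin d) ℂ) : Prop :=
  (expSet (polyFun P)).Nonempty ∧ ∀ ξ, 0 ≤ rePoly P ξ ∧ (rePoly P ξ = 0 → ξ = 0)

open Classical in
/-- The homogeneous order of `R`: the trace of an element of the exponent set of `R`. (For the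
functions `R` considered, all elements of the exponent set have the same trace.) -/
def homOrder {d : ℕ} (R : (Fin d → ℝ) → ℝ) : ℝ :=
  if h : (expSet R).Nonempty then h.choose.trace else 0

/-- The Legendre-Fenchel transform `R^#(x) = sup_ξ (x · ξ - R(ξ))`. -/
def legendre {d : ℕ} (R : (Fin d → ℝ) → ℝ) (x : Fin d → ℝ) : ℝ :=
  ⨆ ξ : Fin d → ℝ, ((∑ i, x i * ξ i) - R ξ)

/-- `ξ₀` is a point of positive-homogeneous type for the Fourier transform of `φ`, with drift `α`
and positive-homogeneous polynomial `P`: the remainder `Υ` in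
`Γ_{ξ₀}(ξ) = i α · ξ - P(ξ) + Υ(ξ)` is `o(Re P(ξ))` as `ξ → 0` in `ℝ^d`. -/
def IsPosHomTypeWith {d : ℕ} (φ : (Fin d → ℤ) → ℂ) (ξ₀ α : Fin d → ℝ)
    (P : MvPolynomial (Fin d) ℂ) : Prop :=
  IsPosHomPoly P ∧
    (fun ξ : Fin d → ℝ =>
      Gam φ ξ₀ ξ - (Complex.I * ((∑ i, α i * ξ i : ℝ) : ℂ) - polyFun P ξ))
        =o[𝓝 0] rePoly P

/-- The Euclidean norm of a point of `ℤ^d`. -/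
def latticeNorm {d : ℕ} (x : Fin d → ℤ) : ℝ := Real.sqrt (∑ i, (x i : ℝ) ^ 2)

end ConvPow

end

/-! The value of the n-th convolution power at x is a Fourier coefficient of the n-th power of the
Fourier transform. In the integral for it the torus may be moved from ξ to ξ - iν, at the price of
the factor exp(-x·ν). The theorem is a matter of choosing ν well near each point of `Omega φ`.

Holomorphy near the torus forces φ to decay exponentially (`MemH.exists_summable`), so the Fourier
transform extends to a function F on a strip, given by an absolutely convergent series. The shifted
coefficient bound `StripSeries.norm_coeff_le` then follows by integrating termwise, without Cauchy's
theorem.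

Near ξ₀ the key estimate is |F(ξ + ξ₀ - iν)| ≤ exp(α·ν - εR(ξ) + MR(ν)) (`exists_local_bound`). For
the polynomial part, Re P(ξ - iν) ≥ εR(ξ) - MR(ν) by homogeneity and compactness. The remainder is
known to be small only at real points; it is extrapolated along s ↦ ξ + sν from s = 0, …, N to s =
-i. The Lagrange error is O(|ν|^(N+1)), which is O(R(ν)) because R dominates a power of the norm
near 0.

Different points of `Omega φ` need different shifts, and smooth cutoffs would destroy analyticity.
Instead 1 is split into trigonometric polynomials depending on n, built from binomial tails
(`exists_partition`), each exponentially small in n at the other points.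

For one piece, put y = (x - nα)/n, let η maximize y·η - R(η), and shift by ν = θη. Since R(θη) ≤
Cθ²R(η), a small θ gives -y·ν + MR(ν) ≤ -θR^#(y) (`exists_shift`). The integral of exp(-nεR)
supplies n^(-μ), by the substitution n^E. The part away from ξ₀ is exponentially small in n and is
absorbed, as R^#(y) stays bounded when |x| ≤ Ln. For |x| > Ln the shift by ρ·sign(x) and a bound for
F on the strip suffice. -/

namespace ConvPow

/-! ### The one-parameter groups t ↦ t^E and their determinants -/

section MatrixPower

open scoped Matrix.Norms.Operator

variable {d : ℕ}

theorem matPow_one (E : Matrix (Fin d) (Fin d) ℝ) : matPow 1 E = 1 := by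
  simp [matPow]

theorem matPow_mul {s t : ℝ} (hs : 0 < s) (ht : 0 < t) (E : Matrix (Fin d) (Fin d) ℝ) :
    matPow (s * t) E = matPow s E * matPow t E := by
  unfold matPow
  rw [Real.log_mul hs.ne' ht.ne', add_smul]
  exact Matrix.exp_add_of_commute _ _ (((Commute.refl E).smul_left _).smul_right _)

theorem matPow_mulVec_mulVec {s t : ℝ} (hs : 0 < s) (ht : 0 < t) (E : Matrix (Fin d) (Fin d) ℝ)
    (ξ : Fin d → ℝ) :
    (matPow s E).mulVec ((matPow t E).mulVec ξ) = (matPow (s * t) E).mulVec ξ := by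
  rw [matPow_mul hs ht, Matrix.mulVec_mulVec]

theorem matPow_inv_mulVec {t : ℝ} (ht : 0 < t) (E : Matrix (Fin d) (Fin d) ℝ) (ξ : Fin d → ℝ) :
    (matPow t E).mulVec ((matPow t⁻¹ E).mulVec ξ) = ξ := by
  rw [matPow_mulVec_mulVec ht (inv_pos.2 ht), mul_inv_cancel₀ ht.ne', matPow_one,
    Matrix.one_mulVec]

theorem continuousOn_matPow_mulVec (E : Matrix (Fin d) (Fin d) ℝ) (ξ : Fin d → ℝ) :
    ContinuousOn (fun t : ℝ => (matPow t E).mulVec ξ) (Set.Ioi 0) := by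
  have h : ContinuousOn (fun t : ℝ => matPow t E) (Set.Ioi 0) := by
    refine NormedSpace.exp_continuous.comp_continuousOn ?_
    exact (Real.continuousOn_log.mono fun t ht => ne_of_gt ht).smul continuousOn_const
  exact (Continuous.matrix_mulVec continuous_id continuous_const).comp_continuousOn h

theorem differentiable_det : Differentiable ℝ fun A : Matrix (Fin d) (Fin d) ℝ => A.det := by
  have h : ∀ i j : Fin d, Differentiable ℝ fun A : Matrix (Fin d) (Fin d) ℝ => A i j := fun i j =>
    (LinearMap.toContinuousLinearMap (Matrix.entryLinearMap ℝ ℝ i j)).differentiable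
  simp only [Matrix.det_apply']
  fun_prop

theorem hasDerivAt_det_one_add_smul (E : Matrix (Fin d) (Fin d) ℝ) :
    HasDerivAt (fun s : ℝ => (1 + s • E).det) E.trace 0 := by
  have h := (Polynomial.hasDerivAt (𝕜 := ℝ) (Matrix.det
    (1 + (Polynomial.X : Polynomial ℝ) • E.map (Polynomial.C : ℝ →+* Polynomial ℝ))) (0 : ℝ))
  rw [Matrix.derivative_det_one_add_X_smul] at h
  refine h.congr_of_eventuallyEq (Filter.Eventually.of_forall fun s => ?_)
  simp only
  rw [← Polynomial.coe_evalRingHom, RingHom.map_det]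
  congr 1
  ext i j
  by_cases hij : i = j <;> simp [RingHom.mapMatrix_apply, hij] <;> exact mul_comm _ _

/-- The function s ↦ det exp(sE) turns sums into products and has derivative tr E at 0, so it solves
f' = (tr E) f. -/
theorem det_exp_smul (E : Matrix (Fin d) (Fin d) ℝ) (s : ℝ) :
    (NormedSpace.exp (s • E)).det = Real.exp (s * E.trace) := by
  have hD := (differentiable_det (d := d)) 1
  have h1 : HasDerivAt (fun s : ℝ => (NormedSpace.exp (s • E)).det) E.trace 0 := by
    have hlin : HasDerivAt (fun s : ℝ => (1 : Matrix (Fin d) (Fin d) ℝ) + s • E) E 0 := by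
      have := ((hasDerivAt_id (0 : ℝ)).smul_const E).const_add (1 : Matrix (Fin d) (Fin d) ℝ)
      rw [one_smul] at this
      exact this
    have hexp : HasDerivAt (fun s : ℝ => NormedSpace.exp (s • E)) E 0 := by
      have := hasDerivAt_exp_smul_const (𝕂 := ℝ) E 0
      rw [zero_smul, NormedSpace.exp_zero, one_mul] at this
      exact this
    have e1 := HasFDerivAt.comp_hasDerivAt_of_eq (0 : ℝ) hD.hasFDerivAt hlin (by simp)
    have e2 := HasFDerivAt.comp_hasDerivAt_of_eq (0 : ℝ) hD.hasFDerivAt hexp (by simp)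
    -- The derivative of det at 1 is never computed in general: the curves 1 + sE and exp(sE) have
    -- the same velocity E at s = 0, so the first determines the value for the second.
    have := e1.unique (hasDerivAt_det_one_add_smul E)
    rw [this] at e2
    exact e2
  set f : ℝ → ℝ := fun s => (NormedSpace.exp (s • E)).det with hf
  have hadd : ∀ s t, f (s + t) = f s * f t := by
    intro s t
    simp only [hf, add_smul]
    rw [Matrix.exp_add_of_commute _ _ (((Commute.refl E).smul_left _).smul_right _),
      Matrix.det_mul]
  have h2 : ∀ s, HasDerivAt f (f s * E.trace) s := by
    intro s
    have : HasDerivAt (fun u => f s * f (u - s)) (f s * E.trace) s := by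
      refine HasDerivAt.const_mul _ ?_
      exact HasDerivAt.comp_sub_const s s (by simpa using h1)
    refine this.congr_of_eventuallyEq (Filter.Eventually.of_forall fun u => ?_)
    simp only
    rw [← hadd, add_sub_cancel]
  have h3 : ∀ s, HasDerivAt (fun s => f s * Real.exp (-(s * E.trace))) 0 s := by
    intro s
    have e := (h2 s).mul (((hasDerivAt_id s).mul_const E.trace).neg.exp)
    convert! e using 1
    simp
    ring
  have h4 := is_const_of_deriv_eq_zero (fun s => (h3 s).differentiableAt)
    (fun s => (h3 s).deriv) s 0
  have h0 : f 0 = 1 := by simp [hf]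
  simp only [h0, zero_mul, neg_zero, Real.exp_zero, mul_one] at h4
  rw [Real.exp_neg] at h4
  have := Real.exp_pos (s * E.trace)
  field_simp at h4
  exact h4

theorem det_matPow {t : ℝ} (ht : 0 < t) (E : Matrix (Fin d) (Fin d) ℝ) :
    (matPow t E).det = t ^ E.trace := by
  rw [matPow, det_exp_smul, Real.rpow_def_of_pos ht]

theorem exists_eq_matPow_mulVec {t : ℝ} (ht : 0 < t) (E : Matrix (Fin d) (Fin d) ℝ)
    (ξ : Fin d → ℝ) : ∃ η, ξ = (matPow t E).mulVec η :=
  ⟨_, (matPow_inv_mulVec ht E ξ).symm⟩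

end MatrixPower

end ConvPow

/-! ### Growth and scaling of positive-homogeneous functions -/

namespace ConvPow

/-- Continuous positive definite functions on `ℝ^d` that vanish to second order at the origin and
are homogeneous with respect to the one-parameter group `t ↦ t^E`. -/
structure PosHomFun {d : ℕ} (R : (Fin d → ℝ) → ℝ) (E : Matrix (Fin d) (Fin d) ℝ) : Prop where
  continuous : Continuous R
  map_zero : R 0 = 0
  pos : ∀ ξ, ξ ≠ 0 → 0 < R ξ
  mem_expSet : E ∈ expSet R
  le_sq : ∃ C, ∀ ξ, ‖ξ‖ ≤ 1 → R ξ ≤ C * ‖ξ‖ ^ 2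

namespace PosHomFun

variable {d : ℕ} {R : (Fin d → ℝ) → ℝ} {E : Matrix (Fin d) (Fin d) ℝ}

theorem map_matPow (h : PosHomFun R E) {t : ℝ} (ht : 0 < t) (ξ : Fin d → ℝ) :
    R ((matPow t E).mulVec ξ) = t * R ξ := by
  rw [← h.mem_expSet t ht ξ, smul_eq_mul]

theorem nonneg (h : PosHomFun R E) (ξ : Fin d → ℝ) : 0 ≤ R ξ := by
  by_cases hξ : ξ = 0
  · rw [hξ, h.map_zero]
  · exact (h.pos ξ hξ).le

theorem exists_pos_le (h : PosHomFun R E) {s : Set (Fin d → ℝ)} (hs : IsCompact s)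
    (h0 : (0 : Fin d → ℝ) ∉ s) : ∃ m, 0 < m ∧ ∀ ξ ∈ s, m ≤ R ξ :=
  hs.exists_forall_le' h.continuous.continuousOn fun ξ hξ => h.pos ξ (ne_of_mem_of_not_mem hξ h0)

theorem exists_le (h : PosHomFun R E) (r : ℝ) : ∃ K, 0 < K ∧ ∀ ξ, ‖ξ‖ ≤ r → R ξ ≤ K := by
  obtain ⟨K, hK⟩ := (isCompact_closedBall (0 : Fin d → ℝ) r).bddAbove_image
    h.continuous.continuousOn
  refine ⟨max K 1, by positivity, fun ξ hξ => le_max_of_le_left (hK ⟨ξ, by simpa using hξ, rfl⟩)⟩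

theorem exists_sphere (h : PosHomFun R E) : ∃ m, 0 < m ∧ ∀ ξ, ‖ξ‖ = 1 → m ≤ R ξ := by
  obtain ⟨m, hm, hm'⟩ := h.exists_pos_le (isCompact_sphere (0 : Fin d → ℝ) 1) (by simp)
  exact ⟨m, hm, fun ξ hξ => hm' ξ (by simpa using hξ)⟩

/-- An orbit starting near 0 cannot leave the unit ball as t decreases from 1: on the unit sphere R
≥ m, while R = tR(ξ) < m along the orbit. Linearity then gives the bound for every ξ. -/
theorem exists_norm_matPow_le_mul (h : PosHomFun R E) :
    ∃ C, 0 < C ∧ ∀ t, 0 < t → t ≤ 1 → ∀ ξ, ‖(matPow t E).mulVec ξ‖ ≤ C * ‖ξ‖ := by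
  obtain ⟨m, hm, hm'⟩ := h.exists_sphere
  have hev : ∀ᶠ ξ in 𝓝 (0 : Fin d → ℝ), R ξ < m := by
    refine h.continuous.continuousAt.eventually_lt continuousAt_const ?_
    rwa [h.map_zero]
  obtain ⟨δ, hδ, hδ'⟩ := Metric.eventually_nhds_iff.1 hev
  have key : ∀ t, 0 < t → t ≤ 1 → ∀ ξ, ‖ξ‖ < min δ 1 → ‖(matPow t E).mulVec ξ‖ < 1 := by
    intro t ht ht1 ξ hξ
    by_contra! hcon
    have hcont : ContinuousOn (fun s : ℝ => ‖(matPow s E).mulVec ξ‖) (Set.Icc t 1) :=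
      ((continuousOn_matPow_mulVec E ξ).mono fun s hs => lt_of_lt_of_le ht hs.1).norm
    obtain ⟨s, hs, hs1⟩ := intermediate_value_Icc' ht1 hcont
      ⟨by simpa [matPow_one] using (hξ.trans_le (min_le_right _ _)).le, hcon⟩
    have hs0 : 0 < s := ht.trans_le hs.1
    have h1 := hm' _ hs1
    rw [h.map_matPow hs0] at h1
    have h2 : R ξ < m := hδ' (by simpa using hξ.trans_le (min_le_left _ _))
    nlinarith [h.nonneg ξ, hs.2]
  have hδ1 : 0 < min δ 1 := by positivity
  refine ⟨2 / min δ 1, by positivity, fun t ht ht1 ξ => ?_⟩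
  by_cases hξ : ξ = 0
  · simp [hξ]
  have hξ' : 0 < ‖ξ‖ := norm_pos_iff.2 hξ
  have := key t ht ht1 ((min δ 1 / 2 / ‖ξ‖) • ξ) (by
    rw [norm_smul, Real.norm_of_nonneg (by positivity), div_mul_cancel₀ _ hξ'.ne']
    linarith)
  rw [Matrix.mulVec_smul, norm_smul, Real.norm_of_nonneg (by positivity)] at this
  rw [div_mul_eq_mul_div, le_div_iff₀ hδ1]
  rw [div_mul_eq_mul_div, div_lt_iff₀ hξ'] at this
  linarith

/-- The image of a unit vector stays in a fixed ball, and outside the ball of radius r there R is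
bounded below; but R of the image is at most tK, so for small t the image has norm at most r. -/
theorem exists_norm_matPow_le (h : PosHomFun R E) {r : ℝ} (hr : 0 < r) :
    ∃ t₀, 0 < t₀ ∧ t₀ < 1 ∧ ∀ t, 0 < t → t ≤ t₀ → ∀ ξ, ‖(matPow t E).mulVec ξ‖ ≤ r * ‖ξ‖ := by
  obtain ⟨C, hC, hC'⟩ := h.exists_norm_matPow_le_mul
  obtain ⟨K, hK, hK'⟩ := h.exists_le 1
  obtain ⟨m, hm, hm'⟩ := h.exists_pos_le
    (s := Metric.closedBall 0 C ∩ {ξ | r ≤ ‖ξ‖})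
    ((isCompact_closedBall _ _).inter_right (isClosed_le continuous_const continuous_norm))
    (by simp [hr])
  refine ⟨min (1 / 2) (m / (2 * K)), by positivity, lt_of_le_of_lt (min_le_left _ _) (by norm_num),
    fun t ht ht0 ξ => ?_⟩
  have ht1 : t ≤ 1 := ht0.trans ((min_le_left _ _).trans (by norm_num))
  have ht2 : t * (2 * K) ≤ m := (le_div_iff₀ (by positivity)).1 (ht0.trans (min_le_right _ _))
  have key : ∀ η, ‖η‖ = 1 → ‖(matPow t E).mulVec η‖ ≤ r := by
    intro η hη
    by_contra! hcon
    have h1 := hm' ((matPow t E).mulVec η) ⟨by simpa [hη] using hC' t ht ht1 η, hcon.le⟩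
    rw [h.map_matPow ht] at h1
    nlinarith [hK' η hη.le, mul_pos ht hK]
  by_cases hξ : ξ = 0
  · simp [hξ]
  have hξ' : 0 < ‖ξ‖ := norm_pos_iff.2 hξ
  have := key (‖ξ‖⁻¹ • ξ) (by
    rw [norm_smul, norm_inv, norm_norm, inv_mul_cancel₀ hξ'.ne'])
  rw [Matrix.mulVec_smul, norm_smul, norm_inv, norm_norm, inv_mul_le_iff₀ hξ'] at this
  linarith

/-- Second-order vanishing at 0 turns into quadratic growth at infinity. If t^E brings ξ to the unit
sphere, then tR(ξ) ≥ m; the same t^E sends ξ/‖ξ‖ to a vector of norm 1/‖ξ‖, so tm ≤ C/‖ξ‖².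
Eliminating t bounds ‖ξ‖² by a multiple of R(ξ). -/
theorem sq_norm_le (h : PosHomFun R E) : ∃ C, 0 < C ∧ ∀ ξ, ‖ξ‖ ^ 2 ≤ C * (1 + R ξ) := by
  obtain ⟨m, hm, hm'⟩ := h.exists_sphere
  obtain ⟨C, hC⟩ := h.le_sq
  refine ⟨max 1 (C / m ^ 2), by positivity, fun ξ => ?_⟩
  have hR := h.nonneg ξ
  rcases le_or_gt ‖ξ‖ 1 with hξ | hξ
  · calc ‖ξ‖ ^ 2 ≤ 1 := pow_le_one₀ (norm_nonneg _) hξ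
      _ ≤ 1 * (1 + R ξ) := by linarith
      _ ≤ _ := by gcongr; exact le_max_left _ _
  have hξ0 : 0 < ‖ξ‖ := by linarith
  obtain ⟨t₀, ht₀, ht₁, ht⟩ := h.exists_norm_matPow_le (r := 1 / ‖ξ‖) (by positivity)
  have hcont : ContinuousOn (fun s : ℝ => ‖(matPow s E).mulVec ξ‖) (Set.Icc t₀ 1) :=
    ((continuousOn_matPow_mulVec E ξ).mono fun s hs => lt_of_lt_of_le ht₀ hs.1).norm
  have hlow : ‖(matPow t₀ E).mulVec ξ‖ ≤ 1 := by
    have := ht t₀ ht₀ le_rfl ξ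
    rwa [one_div, inv_mul_cancel₀ hξ0.ne'] at this
  obtain ⟨t, htm, ht1⟩ := intermediate_value_Icc ht₁.le hcont
    ⟨hlow, by simpa [matPow_one] using hξ.le⟩
  have ht0 : 0 < t := ht₀.trans_le htm.1
  have h1 : m ≤ t * R ξ := by rw [← h.map_matPow ht0]; exact hm' _ ht1
  have h2 : t * m ≤ C / ‖ξ‖ ^ 2 := by
    have e1 : m ≤ R (‖ξ‖⁻¹ • ξ) := hm' _ (by
      rw [norm_smul, norm_inv, norm_norm, inv_mul_cancel₀ hξ0.ne'])
    have e2 : ‖(matPow t E).mulVec (‖ξ‖⁻¹ • ξ)‖ = ‖ξ‖⁻¹ := by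
      rw [Matrix.mulVec_smul, norm_smul, norm_inv, norm_norm]
      simp only at ht1
      rw [ht1, mul_one]
    have e3 := hC ((matPow t E).mulVec (‖ξ‖⁻¹ • ξ)) (by
      rw [e2]; exact inv_le_one_of_one_le₀ hξ.le)
    rw [h.map_matPow ht0, e2, inv_pow, ← div_eq_mul_inv] at e3
    exact (mul_le_mul_of_nonneg_left e1 ht0.le).trans e3
  have h3 : ‖ξ‖ ^ 2 * m ^ 2 ≤ C * R ξ := by
    rw [le_div_iff₀ (by positivity)] at h2
    calc ‖ξ‖ ^ 2 * m ^ 2 ≤ ‖ξ‖ ^ 2 * m * (t * R ξ) := by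
          rw [sq m, ← mul_assoc]; gcongr
      _ = (t * m * ‖ξ‖ ^ 2) * R ξ := by ring
      _ ≤ C * R ξ := by gcongr
  calc ‖ξ‖ ^ 2 ≤ C / m ^ 2 * R ξ := by
        rw [div_mul_eq_mul_div, le_div_iff₀ (by positivity)]; exact h3
    _ ≤ max 1 (C / m ^ 2) * (1 + R ξ) := by
        gcongr
        · exact le_max_right _ _
        · linarith

theorem exists_norm_le (h : PosHomFun R E) (T : ℝ) : ∃ K, 1 ≤ K ∧ ∀ ξ, R ξ ≤ T → ‖ξ‖ ≤ K := by
  obtain ⟨C, hC, hC'⟩ := h.sq_norm_le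
  refine ⟨max 1 (C * (1 + T)), le_max_left _ _, fun ξ hξ => ?_⟩
  rcases le_or_gt ‖ξ‖ 1 with h1 | h1
  · exact le_max_of_le_left h1
  · refine le_max_of_le_right ?_
    calc ‖ξ‖ ≤ ‖ξ‖ ^ 2 := by nlinarith
      _ ≤ C * (1 + R ξ) := hC' ξ
      _ ≤ _ := by gcongr

/-- Choose t₀ so that t₀^E halves norms. If R(ξ) lies between t₀^(j+1) and t₀^j, then ξ is the image
under t₀^(jE) of a point with R ≤ 1, so ‖ξ‖ ≤ 2^(-j)K. Taking 2^(-N) < t₀ compares ‖ξ‖^N with t₀^j.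
-/
theorem exists_pow_norm_le (h : PosHomFun R E) :
    ∃ N C, 0 < C ∧ ∀ ξ, ‖ξ‖ ≤ 1 → ‖ξ‖ ^ N ≤ C * R ξ := by
  obtain ⟨t₀, ht₀, ht₁, ht⟩ := h.exists_norm_matPow_le (r := 1 / 2) (by norm_num)
  obtain ⟨K, hK1, hK⟩ := h.exists_norm_le 1
  obtain ⟨N, hN⟩ := exists_pow_lt_of_lt_one ht₀ (by norm_num : (1 / 2 : ℝ) < 1)
  have hN0 : N ≠ 0 := by
    rintro rfl
    simp only [pow_zero] at hN
    linarith
  have hiter : ∀ j : ℕ, ∀ η, ‖(matPow (t₀ ^ j) E).mulVec η‖ ≤ (1 / 2) ^ j * ‖η‖ := by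
    intro j
    induction j with
    | zero => intro η; simp [matPow_one]
    | succ j ih =>
      intro η
      rw [pow_succ', ← matPow_mulVec_mulVec ht₀ (pow_pos ht₀ j), pow_succ', mul_assoc]
      exact (ht t₀ ht₀ le_rfl _).trans (by gcongr; exact ih η)
  refine ⟨N, max 1 (K ^ N / t₀), by positivity, fun ξ hξ => ?_⟩
  by_cases h0 : ξ = 0
  · simp [h0, hN0, h.map_zero]
  have hR := h.pos ξ h0
  rcases le_or_gt (R ξ) 1 with hR1 | hR1
  · obtain ⟨j, hj1, hj2⟩ := exists_nat_pow_near_of_lt_one hR hR1 ht₀ ht₁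
    have htj : 0 < t₀ ^ j := pow_pos ht₀ j
    set η := (matPow (t₀ ^ j)⁻¹ E).mulVec ξ with hη
    have hηR : ‖η‖ ≤ K := by
      refine hK _ ?_
      rw [hη, h.map_matPow (inv_pos.2 htj), inv_mul_le_iff₀ htj]
      simpa using hj2
    have hξη : ‖ξ‖ ≤ (1 / 2) ^ j * K := by
      have := hiter j η
      rw [hη, matPow_inv_mulVec htj] at this
      exact this.trans (by gcongr)
    calc ‖ξ‖ ^ N ≤ ((1 / 2) ^ j * K) ^ N := by gcongr
      _ = ((1 / 2) ^ N) ^ j * K ^ N := by rw [mul_pow, ← pow_mul, ← pow_mul, mul_comm j N]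
      _ ≤ t₀ ^ j * K ^ N := by gcongr
      _ = K ^ N / t₀ * t₀ ^ (j + 1) := by field_simp; ring
      _ ≤ max 1 (K ^ N / t₀) * R ξ := by
        gcongr
        exact le_max_right _ _
  · calc ‖ξ‖ ^ N ≤ 1 := pow_le_one₀ (norm_nonneg _) hξ
      _ ≤ max 1 (K ^ N / t₀) * R ξ := by
        nlinarith [le_max_left 1 (K ^ N / t₀)]

/-- Rescaling both vectors by T^E with T = R(ξ) + R(ν) reduces to a bounded set. -/
theorem map_add_smul_le (h : PosHomFun R E) (s : ℝ) :
    ∃ C, 0 < C ∧ ∀ ξ ν, R (ξ + s • ν) ≤ C * (R ξ + R ν) := by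
  obtain ⟨K, hK1, hK⟩ := h.exists_norm_le 1
  obtain ⟨C, hC0, hC⟩ := h.exists_le (K + |s| * K)
  refine ⟨C, hC0, fun ξ ν => ?_⟩
  have hξ0 := h.nonneg ξ
  have hν0 := h.nonneg ν
  rcases (add_nonneg hξ0 hν0).eq_or_lt with h0 | hT
  · have hξ : ξ = 0 := by
      by_contra hc
      have := h.pos ξ hc
      linarith
    have hν : ν = 0 := by
      by_contra hc
      have := h.pos ν hc
      linarith
    simp [hξ, hν, h.map_zero]
  · set T := R ξ + R ν with hTdef
    obtain ⟨ξ', hξ'⟩ := exists_eq_matPow_mulVec hT E ξ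
    obtain ⟨ν', hν'⟩ := exists_eq_matPow_mulVec hT E ν
    have e1 : T * R ξ' = R ξ := by rw [hξ', h.map_matPow hT]
    have e2 : T * R ν' = R ν := by rw [hν', h.map_matPow hT]
    have n1 : ‖ξ'‖ ≤ K := hK _ (by by_contra! hc; nlinarith)
    have n2 : ‖ν'‖ ≤ K := hK _ (by by_contra! hc; nlinarith)
    rw [hξ', hν', ← Matrix.mulVec_smul, ← Matrix.mulVec_add, h.map_matPow hT, mul_comm]
    gcongr
    refine hC _ ((norm_add_le _ _).trans ?_)
    rw [norm_smul, Real.norm_eq_abs]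
    gcongr

/-- Scalars commute with t^E, so it is enough to treat R(ξ) = 1, where second-order vanishing
handles small θξ and boundedness the rest. That the exponent of θ exceeds 1 is what `exists_shift`
needs. -/
theorem map_smul_le (h : PosHomFun R E) :
    ∃ C, 1 ≤ C ∧ ∀ θ, 0 ≤ θ → θ ≤ 1 → ∀ ξ, R (θ • ξ) ≤ C * θ ^ 2 * R ξ := by
  obtain ⟨K, hK1, hK⟩ := h.exists_norm_le 1
  obtain ⟨C₀, hC₀⟩ := h.le_sq
  obtain ⟨C₁, hC₁, hC₁'⟩ := h.exists_le K
  have hb : ∀ θ, 0 ≤ θ → θ ≤ 1 → ∀ ξ, ‖ξ‖ ≤ K →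
      R (θ • ξ) ≤ max 1 (max (C₀ * K ^ 2) (C₁ * K ^ 2)) * θ ^ 2 := by
    intro θ hθ0 hθ1 ξ hξ
    have hn : ‖θ • ξ‖ ≤ θ * K := by
      rw [norm_smul, Real.norm_of_nonneg hθ0]; gcongr
    rcases le_or_gt (θ * K) 1 with h1 | h1
    · have h2 := hC₀ _ (hn.trans h1)
      have h3 : ‖θ • ξ‖ ^ 2 ≤ (θ * K) ^ 2 := by gcongr
      rcases le_or_gt C₀ 0 with hc | hc
      · have : C₀ * ‖θ • ξ‖ ^ 2 ≤ 0 := mul_nonpos_of_nonpos_of_nonneg hc (by positivity)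
        exact (h2.trans this).trans (by positivity)
      · calc R (θ • ξ) ≤ C₀ * (θ * K) ^ 2 := h2.trans (by gcongr)
          _ = (C₀ * K ^ 2) * θ ^ 2 := by ring
          _ ≤ _ := by
            gcongr
            exact (le_max_left _ _).trans (le_max_right _ _)
    · have h2 := hC₁' (θ • ξ) (hn.trans (by nlinarith))
      calc R (θ • ξ) ≤ C₁ * 1 := by linarith
        _ ≤ C₁ * (θ * K) ^ 2 := by gcongr; exact one_le_pow₀ h1.le
        _ = (C₁ * K ^ 2) * θ ^ 2 := by ring
        _ ≤ _ := by
            gcongr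
            exact (le_max_right _ _).trans (le_max_right _ _)
  refine ⟨max 1 (max (C₀ * K ^ 2) (C₁ * K ^ 2)), le_max_left _ _, fun θ hθ0 hθ1 ξ => ?_⟩
  by_cases h0 : ξ = 0
  · simp [h0, h.map_zero]
  have hT := h.pos ξ h0
  obtain ⟨ξ', hξ'⟩ := exists_eq_matPow_mulVec hT E ξ
  have e1 : R ξ * R ξ' = R ξ := by
    conv_rhs => rw [hξ', h.map_matPow hT]
  have e2 : R ξ' = 1 := by
    have : R ξ * R ξ' = R ξ * 1 := by rw [e1, mul_one]
    exact mul_left_cancel₀ hT.ne' this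
  have e3 : R (θ • ξ) = R ξ * R (θ • ξ') := by
    conv_lhs => rw [hξ']
    rw [← Matrix.mulVec_smul, h.map_matPow hT]
  rw [e3, mul_comm]
  gcongr
  exact hb θ hθ0 hθ1 ξ' (hK _ e2.le)

end PosHomFun

end ConvPow

/-! ### The Legendre-Fenchel transform and integrals of exp(-nεR) -/

namespace ConvPow

variable {d : ℕ}

theorem abs_dot_le (y η : Fin d → ℝ) : |∑ i, y i * η i| ≤ d * ‖y‖ * ‖η‖ := by
  calc |∑ i, y i * η i| ≤ ∑ i, |y i * η i| := Finset.abs_sum_le_sum_abs _ _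
    _ ≤ ∑ _i : Fin d, ‖y‖ * ‖η‖ := by
        refine Finset.sum_le_sum fun i _ => ?_
        rw [abs_mul]
        gcongr
        · exact norm_le_pi_norm y i
        · exact norm_le_pi_norm η i
    _ = _ := by simp [mul_assoc]

theorem dot_le (y η : Fin d → ℝ) : ∑ i, y i * η i ≤ d * ‖y‖ * ‖η‖ :=
  (le_abs_self _).trans (abs_dot_le y η)

namespace PosHomFun

variable {R : (Fin d → ℝ) → ℝ} {E : Matrix (Fin d) (Fin d) ℝ}

/-- Quadratic growth of R beats the linear term. This is the finiteness of R^#: for an unbounded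
family the real supremum in `legendre` would only be a default value. -/
theorem bddAbove_legendre (h : PosHomFun R E) (y : Fin d → ℝ) :
    BddAbove (Set.range fun η : Fin d → ℝ => (∑ i, y i * η i) - R η) := by
  obtain ⟨C, hC0, hC⟩ := h.sq_norm_le
  refine ⟨C * (d * ‖y‖) ^ 2 + 1, ?_⟩
  rintro _ ⟨η, rfl⟩
  simp only
  have h1 := dot_le y η
  have h2 := hC η
  have h3 : 0 ≤ (‖η‖ - C * (d * ‖y‖)) ^ 2 + ‖η‖ ^ 2 * 0 := by positivity
  have h4 : ‖η‖ ^ 2 / C ≤ 1 + R η := by rw [div_le_iff₀ hC0]; linarith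
  have h5 : (d * ‖y‖) * ‖η‖ ≤ C * (d * ‖y‖) ^ 2 + ‖η‖ ^ 2 / C := by
    have : 0 ≤ (‖η‖ - C * (d * ‖y‖)) ^ 2 / C + (d * ‖y‖) * ‖η‖ := by positivity
    have e : (‖η‖ - C * (d * ‖y‖)) ^ 2 / C
        = ‖η‖ ^ 2 / C - 2 * ((d * ‖y‖) * ‖η‖) + C * (d * ‖y‖) ^ 2 := by
      field_simp
      ring
    linarith
  linarith

/-- The value at η = 0 is 0, and quadratic growth confines the nonnegative values to one ball for
all ‖y‖ ≤ Y, so the supremum is attained there. -/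
theorem exists_legendre_eq (h : PosHomFun R E) (Y : ℝ) :
    ∃ H, 0 < H ∧ ∀ y, ‖y‖ ≤ Y → ∃ η, ‖η‖ ≤ H ∧ legendre R y = (∑ i, y i * η i) - R η ∧
      0 ≤ legendre R y := by
  obtain ⟨C, hC0, hC⟩ := h.sq_norm_le
  set H := max 1 (C * (1 + d * Y)) with hH
  have hH0 : 0 < H := by positivity
  refine ⟨H, hH0, fun y hy => ?_⟩
  have hbig : ∀ η, 0 ≤ (∑ i, y i * η i) - R η → ‖η‖ ≤ H := by
    intro η hη
    rcases le_or_gt ‖η‖ 1 with h1 | h1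
    · exact le_max_of_le_left h1
    · refine le_max_of_le_right ?_
      have h2 : R η ≤ d * Y * ‖η‖ := by
        have := dot_le y η
        have : (d : ℝ) * ‖y‖ * ‖η‖ ≤ d * Y * ‖η‖ := by gcongr
        linarith
      have h3 : ‖η‖ * ‖η‖ ≤ C * (1 + d * Y) * ‖η‖ := by
        calc ‖η‖ * ‖η‖ = ‖η‖ ^ 2 := by ring
          _ ≤ C * (1 + R η) := hC η
          _ ≤ C * (‖η‖ + d * Y * ‖η‖) := by gcongr
          _ = _ := by ring
      exact le_of_mul_le_mul_right h3 (by linarith)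
  have hcont : Continuous fun η : Fin d → ℝ => (∑ i, y i * η i) - R η := by
    have := h.continuous
    fun_prop
  obtain ⟨η, hη, hmax⟩ := (isCompact_closedBall (0 : Fin d → ℝ) H).exists_isMaxOn
    ⟨0, by simpa using hH0.le⟩ hcont.continuousOn
  have h0 : 0 ≤ (∑ i, y i * η i) - R η := by
    have := hmax (a := 0) (by simpa using hH0.le)
    simpa [h.map_zero] using this
  have heq : legendre R y = (∑ i, y i * η i) - R η := by
    refine le_antisymm (ciSup_le fun η' => ?_) (le_ciSup (h.bddAbove_legendre y) η)
    by_cases hη' : ‖η'‖ ≤ H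
    · exact hmax (by simpa using hη')
    · have : ¬ 0 ≤ (∑ i, y i * η' i) - R η' := fun hc => hη' (hbig η' hc)
      linarith
  exact ⟨η, by simpa using hη, heq, heq ▸ h0⟩

theorem exists_shift (h : PosHomFun R E) {Y r M : ℝ} (hY : 0 ≤ Y) (hr : 0 < r) (hM : 0 < M) :
    ∃ θ V, 0 < θ ∧ 0 < V ∧ ∀ y, ‖y‖ ≤ Y → 0 ≤ legendre R y ∧ legendre R y ≤ V ∧
      ∃ ν, ‖ν‖ ≤ r ∧ -(∑ i, ν i * y i) + M * R ν ≤ -(θ * legendre R y) := by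
  obtain ⟨H, hH, hη⟩ := h.exists_legendre_eq Y
  obtain ⟨C, hC1, hC⟩ := h.map_smul_le
  -- The bound 1/(MC) gives M·R(θη) ≤ M·Cθ²R(η) ≤ θR(η), and r/H keeps the shift θη within radius r.
  set θ := min 1 (min (1 / (M * C)) (r / H)) with hθ
  have hC0 : 0 < C := by linarith
  have hθ0 : 0 < θ := by positivity
  have hθ1 : θ ≤ 1 := min_le_left _ _
  have hθ2 : θ * (M * C) ≤ 1 := by
    rw [← le_div_iff₀ (by positivity)]
    exact (min_le_right _ _).trans (min_le_left _ _)
  have hθ3 : θ * H ≤ r := by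
    rw [← le_div_iff₀ hH]
    exact (min_le_right _ _).trans (min_le_right _ _)
  refine ⟨θ, d * Y * H + 1, hθ0, by positivity, fun y hy => ?_⟩
  obtain ⟨η, hηH, heq, h0⟩ := hη y hy
  refine ⟨h0, ?_, θ • η, ?_, ?_⟩
  · have h1 := dot_le y η
    have h2 : (d : ℝ) * ‖y‖ * ‖η‖ ≤ d * Y * H := by gcongr
    have h3 := h.nonneg η
    linarith
  · rw [norm_smul, Real.norm_of_nonneg hθ0.le]
    exact (by gcongr : θ * ‖η‖ ≤ θ * H).trans hθ3
  · have e : ∑ i, (θ • η) i * y i = θ * ∑ i, y i * η i := by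
      rw [Finset.mul_sum]
      refine Finset.sum_congr rfl fun i _ => ?_
      simp only [Pi.smul_apply, smul_eq_mul]
      ring
    rw [e, heq]
    have h1 := hC θ hθ0.le hθ1 η
    have h2 : M * R (θ • η) ≤ θ * R η := by
      calc M * R (θ • η) ≤ M * (C * θ ^ 2 * R η) := by gcongr
        _ = θ * (M * C) * (θ * R η) := by ring
        _ ≤ 1 * (θ * R η) := by
          have := h.nonneg η
          gcongr
        _ = _ := one_mul _
    linarith

open MeasureTheory

theorem integrable_exp_neg (h : PosHomFun R E) {ε : ℝ} (hε : 0 < ε) :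
    Integrable fun ξ : Fin d → ℝ => Real.exp (-(ε * R ξ)) := by
  obtain ⟨C, hC0, hC⟩ := h.sq_norm_le
  set a := ε / C / (d + 1) with ha
  have ha0 : 0 < a := by positivity
  have hG : Integrable fun ξ : Fin d → ℝ => Real.exp ε * ∏ i, Real.exp (-a * ξ i ^ 2) :=
    (Integrable.fintype_prod (𝕜 := ℝ) (f := fun _ t => Real.exp (-a * t ^ 2))
      fun _ => integrable_exp_neg_mul_sq ha0).const_mul _
  refine hG.mono' ?_ (Filter.Eventually.of_forall fun ξ => ?_)
  · have := h.continuous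
    exact Continuous.aestronglyMeasurable (by fun_prop)
  · rw [Real.norm_of_nonneg (Real.exp_pos _).le, ← Real.exp_sum, ← Real.exp_add]
    refine Real.exp_le_exp.2 ?_
    have h1 : ∑ i, ξ i ^ 2 ≤ d * ‖ξ‖ ^ 2 := by
      calc ∑ i, ξ i ^ 2 ≤ ∑ _i : Fin d, ‖ξ‖ ^ 2 := by
            refine Finset.sum_le_sum fun i _ => ?_
            rw [← sq_abs]
            gcongr
            exact norm_le_pi_norm ξ i
        _ = _ := by simp
    rw [← Finset.mul_sum]
    have h2 : a * ∑ i, ξ i ^ 2 ≤ ε * (1 + R ξ) := by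
      calc a * ∑ i, ξ i ^ 2 ≤ a * ((d + 1) * ‖ξ‖ ^ 2) := by
            gcongr
            exact h1.trans (by gcongr; linarith)
        _ = ε / C * ‖ξ‖ ^ 2 := by rw [ha]; field_simp
        _ ≤ ε / C * (C * (1 + R ξ)) := by gcongr; exact hC ξ
        _ = _ := by field_simp
    linarith

/-- Since nR(ξ) = R(n^E ξ), the substitution by n^E, whose determinant is n^(tr E), removes n from
the integrand. -/
theorem integral_exp_neg_le (h : PosHomFun R E) {ε : ℝ} (hε : 0 < ε) :
    ∃ C, 0 < C ∧ ∀ n : ℕ, 1 ≤ n →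
      Integrable (fun ξ : Fin d → ℝ => Real.exp (-(n * (ε * R ξ)))) ∧
      ∫ ξ : Fin d → ℝ, Real.exp (-(n * (ε * R ξ))) ≤ C / (n : ℝ) ^ E.trace := by
  set I := ∫ ξ : Fin d → ℝ, Real.exp (-(ε * R ξ)) with hI
  have hI0 : 0 ≤ I := integral_nonneg fun _ => (Real.exp_pos _).le
  refine ⟨I + 1, by positivity, fun n hn => ?_⟩
  have hn0 : (0 : ℝ) < n := by exact_mod_cast hn
  constructor
  · have := h.integrable_exp_neg (ε := n * ε) (by positivity)
    simpa only [mul_assoc] using this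
  · have hdet : (matPow (n : ℝ) E).det ≠ 0 := by
      rw [det_matPow hn0]
      positivity
    have hmeas : Measurable (Matrix.toLin' (matPow (n : ℝ) E)) :=
      (LinearMap.continuous_of_finiteDimensional _).measurable
    have e1 : ∫ ξ : Fin d → ℝ, Real.exp (-(n * (ε * R ξ)))
        = ∫ ξ, Real.exp (-(ε * R ξ)) ∂(Measure.map (Matrix.toLin' (matPow (n : ℝ) E)) volume) := by
      rw [integral_map hmeas.aemeasurable]
      · refine integral_congr_ae (Filter.Eventually.of_forall fun ξ => ?_)
        simp only [Matrix.toLin'_apply]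
        rw [h.map_matPow hn0]
        congr 1
        ring
      · have := h.continuous
        exact Continuous.aestronglyMeasurable (by fun_prop)
    rw [e1, Real.map_matrix_volume_pi_eq_smul_volume_pi hdet, integral_smul_measure,
      det_matPow hn0, abs_of_pos (by positivity), ENNReal.toReal_ofReal (by positivity),
      smul_eq_mul, ← hI, div_eq_inv_mul]
    gcongr
    linarith

end PosHomFun

end ConvPow

/-! ### Polynomials at complex points and coercivity -/

namespace ConvPow

variable {d : ℕ}

/-- The point `ξ - iν` of `ℂ^d`. -/
def cpoint (ξ ν : Fin d → ℝ) : Fin d → ℂ := fun i => (ξ i : ℂ) - Complex.I * (ν i : ℂ)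

theorem continuous_cpoint : Continuous fun p : (Fin d → ℝ) × (Fin d → ℝ) => cpoint p.1 p.2 := by
  unfold cpoint
  fun_prop

theorem cpoint_zero (ξ : Fin d → ℝ) : cpoint ξ 0 = toComplex ξ := by
  ext i
  simp [cpoint, toComplex]

/-- Extrapolation of polynomials from the points `0, 1, …, N` to `-i`. -/
theorem exists_lagrange (N : ℕ) : ∃ c : ℕ → ℂ, ∀ p : Polynomial ℂ, p.natDegree ≤ N →
    p.eval (-Complex.I) = ∑ j ∈ Finset.range (N + 1), c j * p.eval (j : ℂ) := by
  refine ⟨fun j => (Lagrange.basis (Finset.range (N + 1)) (fun j : ℕ => (j : ℂ)) j).eval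
    (-Complex.I), fun p hp => ?_⟩
  have h := Lagrange.eq_interpolate (f := p) (s := Finset.range (N + 1))
    (v := fun j : ℕ => (j : ℂ)) (fun a _ b _ hab => Nat.cast_injective hab)
    (by
      rw [Finset.card_range]
      exact lt_of_le_of_lt Polynomial.degree_le_natDegree (by exact_mod_cast Nat.lt_succ_of_le hp))
  conv_lhs => rw [h, Lagrange.interpolate_apply]
  rw [Polynomial.eval_finsetSum]
  refine Finset.sum_congr rfl fun j _ => ?_
  rw [Polynomial.eval_mul, Polynomial.eval_C, mul_comm]

/-- The restriction of a polynomial to the line `s ↦ ξ + sν`. -/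
theorem exists_line_polynomial (P : MvPolynomial (Fin d) ℂ) (ξ ν : Fin d → ℂ) :
    ∃ p : Polynomial ℂ, p.natDegree ≤ P.totalDegree ∧
      ∀ s, p.eval s = MvPolynomial.eval (ξ + s • ν) P := by
  refine ⟨MvPolynomial.aeval (fun i => Polynomial.C (ν i) * Polynomial.X + Polynomial.C (ξ i)) P,
    ?_, fun s => ?_⟩
  · have := MvPolynomial.aeval_natDegree_le P le_rfl
      (fun i => Polynomial.C (ν i) * Polynomial.X + Polynomial.C (ξ i)) (n := 1)
      (fun i => Polynomial.natDegree_linear_le)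
    simpa using this
  · rw [← Polynomial.coe_evalRingHom, MvPolynomial.map_aeval]
    have h1 : (Polynomial.evalRingHom s).comp (algebraMap ℂ (Polynomial ℂ)) = RingHom.id ℂ := by
      ext; simp
    rw [h1]
    have h2 : (fun i => Polynomial.evalRingHom s
        (Polynomial.C (ν i) * Polynomial.X + Polynomial.C (ξ i))) = ξ + s • ν := by
      ext i
      simp
      ring
    rw [h2]
    rfl

theorem toComplex_add_smul (ξ ν : Fin d → ℝ) (s : ℝ) :
    toComplex (ξ + s • ν) = toComplex ξ + (s : ℂ) • toComplex ν := by
  ext i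
  simp [toComplex]

theorem cpoint_eq (ξ ν : Fin d → ℝ) :
    cpoint ξ ν = toComplex ξ + (-Complex.I) • toComplex ν := by
  ext i
  simp [toComplex, cpoint, sub_eq_add_neg]

/-- A fixed linear combination of real values recovers P at ξ - iν. Homogeneity, assumed only at
real points, therefore passes to complex ones. -/
theorem exists_eval_cpoint (P : MvPolynomial (Fin d) ℂ) :
    ∃ (N : ℕ) (c : ℕ → ℂ), ∀ ξ ν : Fin d → ℝ, MvPolynomial.eval (cpoint ξ ν) P =
      ∑ j ∈ Finset.range (N + 1), c j * polyFun P (ξ + (j : ℝ) • ν) := by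
  obtain ⟨c, hc⟩ := exists_lagrange P.totalDegree
  refine ⟨P.totalDegree, c, fun ξ ν => ?_⟩
  obtain ⟨p, hp, hp'⟩ := exists_line_polynomial P (toComplex ξ) (toComplex ν)
  have := hc p hp
  rw [hp', ← cpoint_eq] at this
  rw [this]
  refine Finset.sum_congr rfl fun j _ => ?_
  rw [hp', polyFun, toComplex_add_smul]
  simp

theorem eval_cpoint_matPow {P : MvPolynomial (Fin d) ℂ} {E : Matrix (Fin d) (Fin d) ℝ}
    (hE : E ∈ expSet (polyFun P)) {t : ℝ} (ht : 0 < t) (ξ ν : Fin d → ℝ) :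
    MvPolynomial.eval (cpoint ((matPow t E).mulVec ξ) ((matPow t E).mulVec ν)) P =
      t * MvPolynomial.eval (cpoint ξ ν) P := by
  obtain ⟨N, c, hc⟩ := exists_eval_cpoint P
  rw [hc, hc, Finset.mul_sum]
  refine Finset.sum_congr rfl fun j _ => ?_
  rw [← Matrix.mulVec_smul, ← Matrix.mulVec_add, ← hE t ht]
  simp only [Complex.real_smul]
  ring

theorem expSet_polyFun_subset (P : MvPolynomial (Fin d) ℂ) :
    expSet (polyFun P) ⊆ expSet (rePoly P) := by
  intro E hE t ht ξ
  rw [rePoly, rePoly, ← hE t ht ξ]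
  simp

theorem continuous_toComplex : Continuous (toComplex (d := d)) := by
  unfold toComplex
  fun_prop

theorem continuous_rePoly (P : MvPolynomial (Fin d) ℂ) : Continuous (rePoly P) := by
  unfold rePoly polyFun
  exact Complex.continuous_re.comp ((MvPolynomial.continuous_eval P).comp continuous_toComplex)

theorem prod_abs_pow_le (ξ : Fin d → ℝ) (m : Fin d →₀ ℕ) :
    ∏ i, |ξ i| ^ m i ≤ ‖ξ‖ ^ (∑ i, m i) := by
  rw [← Finset.prod_pow_eq_pow_sum]
  refine Finset.prod_le_prod (fun i _ => by positivity) fun i _ => ?_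
  gcongr
  exact norm_le_pi_norm ξ i

/-- Adding R(-ξ) ≥ 0 cancels all terms of odd degree, and subtracting the value at 0 removes the
constant; only degrees 2 and higher remain. -/
theorem rePoly_le_sq (P : MvPolynomial (Fin d) ℂ) (h0 : rePoly P 0 = 0)
    (hnn : ∀ ξ, 0 ≤ rePoly P ξ) : ∃ C, ∀ ξ, ‖ξ‖ ≤ 1 → rePoly P ξ ≤ C * ‖ξ‖ ^ 2 := by
  refine ⟨∑ m ∈ P.support, ‖MvPolynomial.coeff m P‖ * 2, fun ξ hξ => ?_⟩
  have h1 : rePoly P ξ ≤ (polyFun P ξ + polyFun P (-ξ) - 2 * polyFun P 0).re := by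
    have e1 : (polyFun P ξ).re = rePoly P ξ := rfl
    have e2 : (polyFun P (-ξ)).re = rePoly P (-ξ) := rfl
    have e3 : (polyFun P 0).re = 0 := h0
    have := hnn (-ξ)
    simp [e1, e2, e3, this]
  refine h1.trans ((Complex.re_le_norm _).trans ?_)
  have e : polyFun P ξ + polyFun P (-ξ) - 2 * polyFun P 0 = ∑ m ∈ P.support,
      MvPolynomial.coeff m P * (∏ i, (ξ i : ℂ) ^ m i + ∏ i, (-(ξ i : ℂ)) ^ m i
        - 2 * ∏ i, (0 : ℂ) ^ m i) := by
    simp only [polyFun, MvPolynomial.eval_eq', toComplex, Finset.mul_sum,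
      ← Finset.sum_add_distrib, ← Finset.sum_sub_distrib]
    refine Finset.sum_congr rfl fun m _ => ?_
    simp only [Pi.neg_apply, Complex.ofReal_neg, Pi.zero_apply, Complex.ofReal_zero]
    ring
  rw [e, Finset.sum_mul]
  refine (norm_sum_le _ _).trans (Finset.sum_le_sum fun m _ => ?_)
  rw [norm_mul, mul_assoc]
  gcongr
  have hneg : ∏ i, (-(ξ i : ℂ)) ^ m i = (-1) ^ (∑ i, m i) * ∏ i, (ξ i : ℂ) ^ m i := by
    rw [← Finset.prod_pow_eq_pow_sum, ← Finset.prod_mul_distrib]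
    exact Finset.prod_congr rfl fun i _ => by rw [← mul_pow]; ring
  have hzero : ∏ i, (0 : ℂ) ^ m i = 0 ^ (∑ i, m i) := Finset.prod_pow_eq_pow_sum _ _ _
  have hnorm : ‖∏ i, (ξ i : ℂ) ^ m i‖ ≤ ‖ξ‖ ^ (∑ i, m i) := by
    rw [norm_prod]
    simpa using prod_abs_pow_le ξ m
  rw [hneg, hzero]
  rcases Nat.lt_or_ge (∑ i, m i) 2 with hlt | hge
  · interval_cases hk : ∑ i, m i
    · have : ∀ i, m i = 0 := by simpa using hk
      simp [this]
      norm_num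
    · simp
  · have hc : ‖∏ i, (ξ i : ℂ) ^ m i‖ ≤ ‖ξ‖ ^ 2 :=
      hnorm.trans (pow_le_pow_of_le_one (norm_nonneg _) hξ hge)
    rw [zero_pow (by omega), mul_zero, sub_zero]
    refine (norm_add_le _ _).trans ?_
    rw [norm_mul, norm_pow, norm_neg, norm_one, one_pow, one_mul]
    linarith

theorem IsPosHomPoly.posHomFun {P : MvPolynomial (Fin d) ℂ} (hP : IsPosHomPoly P)
    {E : Matrix (Fin d) (Fin d) ℝ} (hE : E ∈ expSet (rePoly P)) : PosHomFun (rePoly P) E := by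
  have h0 : rePoly P 0 = 0 := by
    have := hE 2 two_pos 0
    rw [Matrix.mulVec_zero, smul_eq_mul] at this
    linarith
  exact ⟨continuous_rePoly P, h0, fun ξ hξ => lt_of_le_of_ne (hP.2 ξ).1
    fun h => hξ ((hP.2 ξ).2 h.symm), hE, rePoly_le_sq P h0 fun ξ => (hP.2 ξ).1⟩

/-- By homogeneity it suffices to work on the compact set R(ξ) + R(ν) = 1. Where F > 1/2 the claim
holds with ε = 1/2; elsewhere R(ν) is bounded below and a large M compensates for the lower bound of
F. -/
theorem PosHomFun.exists_coercive {R : (Fin d → ℝ) → ℝ} {E : Matrix (Fin d) (Fin d) ℝ}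
    (h : PosHomFun R E) {F : (Fin d → ℝ) × (Fin d → ℝ) → ℝ} (hF : Continuous F)
    (hF0 : ∀ ξ, F (ξ, 0) = R ξ) (hom : ∀ t, 0 < t → ∀ ξ ν,
      F ((matPow t E).mulVec ξ, (matPow t E).mulVec ν) = t * F (ξ, ν)) :
    ∃ ε M, 0 < ε ∧ 0 < M ∧ ∀ ξ ν : Fin d → ℝ, ε * R ξ - M * R ν ≤ F (ξ, ν) := by
  have hS : Continuous fun p : (Fin d → ℝ) × (Fin d → ℝ) => R p.1 + R p.2 :=
    (h.continuous.comp continuous_fst).add (h.continuous.comp continuous_snd)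
  obtain ⟨K, hK1, hK⟩ := h.exists_norm_le 1
  set S : Set ((Fin d → ℝ) × (Fin d → ℝ)) := {p | R p.1 + R p.2 = 1} with hSdef
  have hScompact : IsCompact S := by
    refine Metric.isCompact_of_isClosed_isBounded (isClosed_eq hS continuous_const) ?_
    refine (Metric.isBounded_closedBall (x := (0 : (Fin d → ℝ) × (Fin d → ℝ))) (r := K)).subset ?_
    rintro ⟨ξ, ν⟩ hp
    have hp' : R ξ + R ν = 1 := hp
    have h1 := h.nonneg ξ
    have h2 := h.nonneg ν
    simp only [Metric.mem_closedBall, dist_zero_right, Prod.norm_def, sup_le_iff]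
    exact ⟨hK _ (by linarith), hK _ (by linarith)⟩
  obtain ⟨B, hB⟩ := hScompact.bddBelow_image hF.continuousOn
  -- If ν = 0, then F = R(ξ) = 1, so on the part where F ≤ 1/2 the function R(ν) is positive, hence
  -- bounded away from 0.
  obtain ⟨c, hc0, hc⟩ := IsCompact.exists_forall_le'
    (s := S ∩ {p | F p ≤ 1 / 2})
    (hScompact.inter_right (isClosed_le hF continuous_const))
    (f := fun p => R p.2) (h.continuous.comp continuous_snd).continuousOn (a := 0) (by
      rintro ⟨ξ, ν⟩ ⟨hp, hp2⟩
      refine h.pos _ fun hν => ?_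
      have hp' : R ξ + R ν = 1 := hp
      simp only at hν
      rw [hν, h.map_zero, add_zero] at hp'
      simp only [Set.mem_ofPred_eq, hν, hF0] at hp2
      linarith)
  have key : ∀ p ∈ S, 1 / 2 * R p.1 - (|B| + 1) / c * R p.2
      ≤ F p := by
    rintro ⟨ξ, ν⟩ hp
    have hp' : R ξ + R ν = 1 := hp
    have h1 := h.nonneg ξ
    have h2 := h.nonneg ν
    simp only
    rcases le_or_gt (F (ξ, ν)) (1 / 2) with hle | hgt
    · have e1 : c ≤ R ν := hc (ξ, ν) ⟨hp, hle⟩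
      have e2 : B ≤ F (ξ, ν) := hB ⟨(ξ, ν), hp, rfl⟩
      have e3 : |B| + 1 ≤ (|B| + 1) / c * R ν := by
        rw [div_mul_eq_mul_div, le_div_iff₀ hc0]
        gcongr
      have := neg_abs_le B
      linarith
    · have : 0 ≤ (|B| + 1) / c * R ν := by positivity
      linarith
  refine ⟨1 / 2, (|B| + 1) / c, by norm_num, by positivity, fun ξ ν => ?_⟩
  have hξ0 := h.nonneg ξ
  have hν0 := h.nonneg ν
  rcases (add_nonneg hξ0 hν0).eq_or_lt with h0 | hT
  · have hξ : ξ = 0 := by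
      by_contra hc
      have := h.pos ξ hc
      linarith
    have hν : ν = 0 := by
      by_contra hc
      have := h.pos ν hc
      linarith
    rw [hξ, hν, hF0, h.map_zero]
    simp
  · set T := R ξ + R ν with hTdef
    obtain ⟨ξ', hξ'⟩ := exists_eq_matPow_mulVec hT E ξ
    obtain ⟨ν', hν'⟩ := exists_eq_matPow_mulVec hT E ν
    have e1 : T * R ξ' = R ξ := by rw [hξ', h.map_matPow hT]
    have e2 : T * R ν' = R ν := by rw [hν', h.map_matPow hT]
    have e3 : R ξ' + R ν' = 1 := by
      have : T * (R ξ' + R ν') = T * 1 := by rw [mul_add, e1, e2, mul_one]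
      exact mul_left_cancel₀ hT.ne' this
    have e4 := key (ξ', ν') e3
    rw [← e1, ← e2, hξ', hν', hom T hT]
    have e5 := mul_le_mul_of_nonneg_left e4 hT.le
    calc _ = T * (1 / 2 * R ξ' - (|B| + 1) / c * R ν') := by ring
      _ ≤ _ := e5

theorem IsPosHomPoly.exists_coercive {P : MvPolynomial (Fin d) ℂ} (hP : IsPosHomPoly P) :
    ∃ ε M, 0 < ε ∧ 0 < M ∧ ∀ ξ ν : Fin d → ℝ,
      ε * rePoly P ξ - M * rePoly P ν ≤ (MvPolynomial.eval (cpoint ξ ν) P).re := by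
  obtain ⟨E, hE⟩ := hP.1
  refine (hP.posHomFun (expSet_polyFun_subset P hE)).exists_coercive
    (F := fun p => (MvPolynomial.eval (cpoint p.1 p.2) P).re)
    (Complex.continuous_re.comp ((MvPolynomial.continuous_eval P).comp continuous_cpoint))
    (fun ξ => ?_) fun t ht ξ ν => ?_
  · simp only [cpoint_zero]
    rfl
  · simp only [eval_cpoint_matPow hE ht, Complex.re_ofReal_mul]

end ConvPow

/-! ### Trigonometric series with exponentially decaying coefficients -/

namespace ConvPow

variable {d : ℕ}

/-- The character `ζ ↦ exp(i x · ζ)` on `ℂ^d`. -/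
noncomputable def character (x : Fin d → ℤ) (ζ : Fin d → ℂ) : ℂ :=
  Complex.exp (Complex.I * ∑ i, (x i : ℂ) * ζ i)

/-- The `ℓ¹` norm on `ℤ^d`. -/
noncomputable def oneNorm (x : Fin d → ℤ) : ℝ := ∑ i, |(x i : ℝ)|

/-- The points of `ℂ^d` whose coordinates have imaginary part at most `ρ` in modulus. -/
def strip (d : ℕ) (ρ : ℝ) : Set (Fin d → ℂ) := {ζ | ∀ i, |(ζ i).im| ≤ ρ}

theorem oneNorm_nonneg (x : Fin d → ℤ) : 0 ≤ oneNorm x :=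
  Finset.sum_nonneg fun _ _ => abs_nonneg _

theorem oneNorm_add_le (x y : Fin d → ℤ) : oneNorm (x + y) ≤ oneNorm x + oneNorm y := by
  rw [oneNorm, oneNorm, oneNorm, ← Finset.sum_add_distrib]
  refine Finset.sum_le_sum fun i _ => ?_
  simpa using abs_add_le (x i : ℝ) (y i)

theorem character_add (x y : Fin d → ℤ) (ζ : Fin d → ℂ) :
    character (x + y) ζ = character x ζ * character y ζ := by
  rw [character, character, character, ← Complex.exp_add, ← mul_add, ← Finset.sum_add_distrib]
  congr 2
  refine Finset.sum_congr rfl fun i _ => ?_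
  simp
  ring

theorem character_zero (ζ : Fin d → ℂ) : character 0 ζ = 1 := by
  simp [character]

theorem continuous_character (x : Fin d → ℤ) : Continuous (character x) := by
  unfold character
  fun_prop

theorem norm_character (x : Fin d → ℤ) (ζ : Fin d → ℂ) :
    ‖character x ζ‖ = Real.exp (-∑ i, (x i : ℝ) * (ζ i).im) := by
  rw [character, Complex.norm_exp]
  congr 1
  simp

theorem norm_character_le {ρ : ℝ} {ζ : Fin d → ℂ} (hζ : ζ ∈ strip d ρ) (x : Fin d → ℤ) :
    ‖character x ζ‖ ≤ Real.exp (ρ * oneNorm x) := by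
  rw [norm_character]
  refine Real.exp_le_exp.2 ?_
  rw [oneNorm, Finset.mul_sum, ← Finset.sum_neg_distrib]
  refine Finset.sum_le_sum fun i _ => ?_
  calc -((x i : ℝ) * (ζ i).im) ≤ |(x i : ℝ) * (ζ i).im| := neg_le_abs _
    _ = |(ζ i).im| * |(x i : ℝ)| := by rw [abs_mul, mul_comm]
    _ ≤ _ := by gcongr; exact hζ i

theorem cpoint_mem_strip {ρ : ℝ} (ξ : Fin d → ℝ) {ν : Fin d → ℝ} (hν : ‖ν‖ ≤ ρ) :
    cpoint ξ ν ∈ strip d ρ := by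
  intro i
  simpa [cpoint] using (norm_le_pi_norm ν i).trans hν

theorem toComplex_mem_strip {ρ : ℝ} (hρ : 0 ≤ ρ) (ξ : Fin d → ℝ) : toComplex ξ ∈ strip d ρ := by
  intro i
  simpa [toComplex] using hρ

theorem character_toComplex (x : Fin d → ℤ) (ξ : Fin d → ℝ) :
    character x (toComplex ξ) = Complex.exp (Complex.I * ((∑ i, (x i : ℝ) * ξ i : ℝ) : ℂ)) := by
  simp [character, toComplex]

theorem character_cpoint (x : Fin d → ℤ) (ξ ν : Fin d → ℝ) :
    character x (cpoint ξ ν) =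
      character x (toComplex ξ) * Complex.exp ((∑ i, (x i : ℝ) * ν i : ℝ) : ℂ) := by
  rw [character, character, ← Complex.exp_add]
  congr 1
  simp only [cpoint, toComplex, mul_sub, Finset.sum_sub_distrib]
  push_cast
  rw [sub_eq_add_neg]
  congr 1
  rw [Finset.mul_sum, ← Finset.sum_neg_distrib]
  refine Finset.sum_congr rfl fun i _ => ?_
  linear_combination (-(x i : ℂ) * (ν i : ℂ)) * Complex.I_sq

/-- `F` is given on the strip `|Im ζᵢ| ≤ ρ` by a trigonometric series with exponentially decaying
coefficients `ψ`. -/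
structure StripSeries (ρ : ℝ) (ψ : (Fin d → ℤ) → ℂ) (F : (Fin d → ℂ) → ℂ) : Prop where
  summable : Summable fun x => ‖ψ x‖ * Real.exp (ρ * oneNorm x)
  hasSum : ∀ ζ ∈ strip d ρ, HasSum (fun x => ψ x * character x ζ) (F ζ)

theorem norm_mul_character_le {ρ : ℝ} {ζ : Fin d → ℂ} (hζ : ζ ∈ strip d ρ)
    (ψ : (Fin d → ℤ) → ℂ) (x : Fin d → ℤ) :
    ‖ψ x * character x ζ‖ ≤ ‖ψ x‖ * Real.exp (ρ * oneNorm x) := by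
  rw [norm_mul]
  gcongr
  exact norm_character_le hζ x

theorem StripSeries.of_summable {ρ : ℝ} {ψ : (Fin d → ℤ) → ℂ}
    (h : Summable fun x => ‖ψ x‖ * Real.exp (ρ * oneNorm x)) :
    StripSeries ρ ψ fun ζ => ∑' x, ψ x * character x ζ :=
  ⟨h, fun _ hζ => (Summable.of_norm_bounded h (norm_mul_character_le hζ ψ)).hasSum⟩

namespace StripSeries

variable {ρ : ℝ} {ψ χ : (Fin d → ℤ) → ℂ} {F G : (Fin d → ℂ) → ℂ}

theorem continuousOn (h : StripSeries ρ ψ F) : ContinuousOn F (strip d ρ) := by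
  have := continuousOn_tsum (s := strip d ρ) (f := fun x ζ => ψ x * character x ζ)
    (fun x => (continuous_const.mul (continuous_character x)).continuousOn) h.summable
    fun x ζ hζ => norm_mul_character_le hζ ψ x
  exact this.congr fun ζ hζ => (h.hasSum ζ hζ).tsum_eq.symm

theorem norm_le (h : StripSeries ρ ψ F) {ζ : Fin d → ℂ} (hζ : ζ ∈ strip d ρ) :
    ‖F ζ‖ ≤ ∑' x, ‖ψ x‖ * Real.exp (ρ * oneNorm x) := by
  rw [← (h.hasSum ζ hζ).tsum_eq]
  exact tsum_of_norm_bounded h.summable.hasSum (norm_mul_character_le hζ ψ)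

theorem single (ρ : ℝ) (x : Fin d → ℤ) (c : ℂ) :
    StripSeries ρ (Pi.single x c) fun ζ => c * character x ζ := by
  constructor
  · refine summable_of_ne_finset_zero (s := {x}) fun y hy => ?_
    rw [Pi.single_eq_of_ne (by simpa using hy)]
    simp
  · intro ζ _
    have := hasSum_single (f := fun y => (Pi.single x c : (Fin d → ℤ) → ℂ) y * character y ζ) x
      fun y hy => by rw [Pi.single_eq_of_ne hy, zero_mul]
    simpa using this

theorem add (hF : StripSeries ρ ψ F) (hG : StripSeries ρ χ G) :
    StripSeries ρ (ψ + χ) (F + G) := by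
  refine ⟨Summable.of_nonneg_of_le (fun x => by positivity) (fun x => ?_)
    (hF.summable.add hG.summable), fun ζ hζ => ?_⟩
  · rw [← add_mul]
    gcongr
    exact norm_add_le _ _
  · simpa [add_mul] using (hF.hasSum ζ hζ).add (hG.hasSum ζ hζ)

/-- The change of variables `(x, y) ↦ (x - y, y)`. -/
def subEquiv (d : ℕ) : (Fin d → ℤ) × (Fin d → ℤ) ≃ (Fin d → ℤ) × (Fin d → ℤ) where
  toFun p := (p.1 - p.2, p.2)
  invFun p := (p.1 + p.2, p.2)
  left_inv p := by simp
  right_inv p := by simp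

/-- The weight exp(ρ|x|₁) is submultiplicative, so weighted absolute convergence survives
convolution, and the double series may be regrouped along x = (x - y) + y. -/
theorem mul (hF : StripSeries ρ ψ F) (hG : StripSeries ρ χ G) (hρ : 0 ≤ ρ) :
    StripSeries ρ (conv ψ χ) (F * G) := by
  have hprod : Summable fun p : (Fin d → ℤ) × (Fin d → ℤ) =>
      (‖ψ p.1‖ * Real.exp (ρ * oneNorm p.1)) * (‖χ p.2‖ * Real.exp (ρ * oneNorm p.2)) :=
    hF.summable.mul_of_nonneg hG.summable (fun x => by positivity) fun x => by positivity
  have hprod' := (subEquiv d).summable_iff.2 hprod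
  have hbound : ∀ x y, ‖ψ (x - y) * χ y‖ * Real.exp (ρ * oneNorm x) ≤
      (‖ψ (x - y)‖ * Real.exp (ρ * oneNorm (x - y))) * (‖χ y‖ * Real.exp (ρ * oneNorm y)) := by
    intro x y
    rw [norm_mul, mul_mul_mul_comm, ← Real.exp_add, ← mul_add]
    gcongr
    simpa using oneNorm_add_le (x - y) y
  have hS : ∀ x, Summable fun y => ‖ψ (x - y) * χ y‖ * Real.exp (ρ * oneNorm x) := fun x =>
    Summable.of_nonneg_of_le (fun y => by positivity) (hbound x) (hprod'.prod_factor x)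
  have hS' : ∀ x, Summable fun y => ‖ψ (x - y) * χ y‖ := fun x => by
    have := (hS x).mul_right (Real.exp (ρ * oneNorm x))⁻¹
    refine this.congr fun y => ?_
    field_simp
  constructor
  · refine Summable.of_nonneg_of_le (fun x => by positivity) (fun x => ?_) hprod'.prod
    calc ‖conv ψ χ x‖ * Real.exp (ρ * oneNorm x)
        ≤ (∑' y, ‖ψ (x - y) * χ y‖) * Real.exp (ρ * oneNorm x) := by
          gcongr
          exact norm_tsum_le_tsum_norm (hS' x)
      _ = ∑' y, ‖ψ (x - y) * χ y‖ * Real.exp (ρ * oneNorm x) := by rw [tsum_mul_right]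
      _ ≤ _ := (hS x).tsum_le_tsum (hbound x) (hprod'.prod_factor x)
  · intro ζ hζ
    have h1 := (hF.hasSum ζ hζ)
    have h2 := (hG.hasSum ζ hζ)
    have hsum : Summable fun p : (Fin d → ℤ) × (Fin d → ℤ) =>
        (ψ p.1 * character p.1 ζ) * (χ p.2 * character p.2 ζ) := by
      refine Summable.of_norm_bounded hprod fun p => ?_
      rw [norm_mul]
      gcongr
      · exact norm_mul_character_le hζ ψ _
      · exact norm_mul_character_le hζ χ _
    have h3 := (subEquiv d).hasSum_iff.2 (h1.mul h2 hsum)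
    refine h3.prod_fiberwise fun x => ?_
    have h4 : HasSum (fun y => ψ (x - y) * χ y * character x ζ) (conv ψ χ x * character x ζ) :=
      (hS' x).of_norm.hasSum.mul_right _
    convert! h4 using 2 with y
    have h5 := character_add (x - y) y ζ
    rw [sub_add_cancel] at h5
    simp only [subEquiv, Equiv.coe_fn_mk, Function.comp_apply, h5]
    ring

theorem pow_convPow (h : StripSeries ρ ψ F) (hρ : 0 ≤ ρ) :
    ∀ n : ℕ, StripSeries ρ (convPow ψ n) (F ^ n)
  | 0 => by
    have := single (d := d) ρ 0 1
    simp only [character_zero, mul_one] at this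
    rw [pow_zero]
    exact this
  | 1 => by simpa [convPow] using h
  | n + 2 => by
    rw [pow_succ]
    exact (pow_convPow h hρ (n + 1)).mul h hρ

end StripSeries

/-- The functions given on a strip by trigonometric series with exponentially decaying
coefficients. -/
def IsStripFun (ρ : ℝ) (F : (Fin d → ℂ) → ℂ) : Prop := ∃ ψ, StripSeries ρ ψ F

namespace IsStripFun

variable {ρ : ℝ} {F G : (Fin d → ℂ) → ℂ}

theorem character (ρ : ℝ) (x : Fin d → ℤ) : IsStripFun ρ (ConvPow.character x) :=
  ⟨_, by simpa using StripSeries.single ρ x 1⟩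

theorem const (ρ : ℝ) (c : ℂ) : IsStripFun (d := d) ρ fun _ => c :=
  ⟨_, by simpa [character_zero] using StripSeries.single (d := d) ρ 0 c⟩

theorem add (hF : IsStripFun ρ F) (hG : IsStripFun ρ G) : IsStripFun ρ (F + G) :=
  let ⟨_, h⟩ := hF
  let ⟨_, h'⟩ := hG
  ⟨_, h.add h'⟩

theorem mul (hρ : 0 ≤ ρ) (hF : IsStripFun ρ F) (hG : IsStripFun ρ G) : IsStripFun ρ (F * G) :=
  let ⟨_, h⟩ := hF
  let ⟨_, h'⟩ := hG
  ⟨_, h.mul h' hρ⟩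

theorem pow (hρ : 0 ≤ ρ) (hF : IsStripFun ρ F) (n : ℕ) : IsStripFun ρ (F ^ n) :=
  let ⟨_, h⟩ := hF
  ⟨_, h.pow_convPow hρ n⟩

theorem sum {ι : Type*} (s : Finset ι) {F : ι → (Fin d → ℂ) → ℂ}
    (h : ∀ i ∈ s, IsStripFun ρ (F i)) : IsStripFun ρ (∑ i ∈ s, F i) := by
  classical
  induction s using Finset.induction_on with
  | empty => exact const ρ 0
  | insert a s ha ih =>
    rw [Finset.sum_insert ha]
    exact (h a (by simp)).add (ih fun i hi => h i (by simp [hi]))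

theorem prod (hρ : 0 ≤ ρ) {ι : Type*} (s : Finset ι) {F : ι → (Fin d → ℂ) → ℂ}
    (h : ∀ i ∈ s, IsStripFun ρ (F i)) : IsStripFun ρ (∏ i ∈ s, F i) := by
  classical
  induction s using Finset.induction_on with
  | empty => exact const ρ 1
  | insert a s ha ih =>
    rw [Finset.prod_insert ha]
    exact (h a (by simp)).mul hρ (ih fun i hi => h i (by simp [hi]))

end IsStripFun

end ConvPow

/-! ### Fourier coefficients as integrals over shifted tori -/

namespace ConvPow

open MeasureTheory

variable {d : ℕ}

/-- The cube of side `2π` centred at `a`. -/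
def box (a : Fin d → ℝ) : Set (Fin d → ℝ) :=
  Set.univ.pi fun i => Set.Ioc (a i - Real.pi) (a i + Real.pi)

theorem setIntegral_exp_int_mul (a : ℝ) (m : ℤ) :
    ∫ t in Set.Ioc (a - Real.pi) (a + Real.pi), Complex.exp (Complex.I * ((m : ℂ) * (t : ℂ))) =
      if m = 0 then 2 * (Real.pi : ℂ) else 0 := by
  have hle : a - Real.pi ≤ a + Real.pi := by linarith [Real.pi_pos]
  rw [← intervalIntegral.integral_of_le hle]
  split_ifs with hm
  · simp [hm]
    ring
  · have hc : Complex.I * (m : ℂ) ≠ 0 := mul_ne_zero Complex.I_ne_zero (by exact_mod_cast hm)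
    have e := integral_exp_mul_complex (a := a - Real.pi) (b := a + Real.pi) hc
    simp only [mul_assoc] at e
    rw [e, div_eq_zero_iff]
    left
    rw [sub_eq_zero]
    refine Complex.exp_eq_exp_iff_exists_int.2 ⟨m, ?_⟩
    push_cast
    ring

theorem restrict_box (a : Fin d → ℝ) : (volume : Measure (Fin d → ℝ)).restrict (box a) =
    Measure.pi fun i => volume.restrict (Set.Ioc (a i - Real.pi) (a i + Real.pi)) := by
  rw [box, volume_pi, Measure.restrict_pi_pi]

instance isFiniteMeasure_restrict_box (a : Fin d → ℝ) :
    IsFiniteMeasure ((volume : Measure (Fin d → ℝ)).restrict (box a)) := by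
  rw [restrict_box]
  infer_instance

theorem measureReal_box (a : Fin d → ℝ) :
    (volume : Measure (Fin d → ℝ)).real (box a) = (2 * Real.pi) ^ d := by
  rw [measureReal_def, box, Real.volume_pi_Ioc_toReal]
  · simp only [add_sub_sub_cancel, Finset.prod_const, Finset.card_univ, Fintype.card_fin]
    congr 1
    ring
  · intro i
    simp only
    linarith [Real.pi_pos]

theorem setIntegral_character (a : Fin d → ℝ) (x : Fin d → ℤ) :
    ∫ ξ in box a, character x (toComplex ξ) =
      if x = 0 then (2 * (Real.pi : ℂ)) ^ d else 0 := by
  have h : ∀ ξ : Fin d → ℝ, character x (toComplex ξ) =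
      ∏ i, Complex.exp (Complex.I * ((x i : ℂ) * (ξ i : ℂ))) := by
    intro ξ
    rw [character, Finset.mul_sum, Complex.exp_sum]
    rfl
  simp only [h]
  rw [restrict_box, integral_fintype_prod_eq_prod (𝕜 := ℂ)
    (fun i t => Complex.exp (Complex.I * ((x i : ℂ) * ((t : ℝ) : ℂ))))]
  simp only [setIntegral_exp_int_mul]
  split_ifs with hx
  · simp [hx]
  · obtain ⟨i, hi⟩ := Function.ne_iff.1 hx
    exact Finset.prod_eq_zero (Finset.mem_univ i) (if_neg hi)

namespace StripSeries

variable {ρ : ℝ} {ψ : (Fin d → ℤ) → ℂ} {F : (Fin d → ℂ) → ℂ}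

/-- Termwise, only the frequency x survives integration over a cube of side 2π, and the imaginary
shift multiplies it by exp(x·ν). The centre a is free, so that later ξ₀ can be put in the middle. -/
theorem coeff_eq (h : StripSeries ρ ψ F) (a : Fin d → ℝ) {ν : Fin d → ℝ} (hν : ‖ν‖ ≤ ρ)
    (x : Fin d → ℤ) :
    ∫ ξ in box a, F (cpoint ξ ν) * character (-x) (toComplex ξ) =
      (2 * (Real.pi : ℂ)) ^ d * (ψ x * Complex.exp ((∑ i, (x i : ℝ) * ν i : ℝ) : ℂ)) := by
  have hterm : ∀ y : Fin d → ℤ, ∀ ξ : Fin d → ℝ,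
      ψ y * character y (cpoint ξ ν) * character (-x) (toComplex ξ) =
        (ψ y * Complex.exp ((∑ i, (y i : ℝ) * ν i : ℝ) : ℂ)) *
          character (y - x) (toComplex ξ) := by
    intro y ξ
    rw [character_cpoint, sub_eq_add_neg, character_add]
    ring
  have hcont : Continuous (toComplex (d := d)) := continuous_toComplex
  have hnorm1 : ∀ (y : Fin d → ℤ) (ξ : Fin d → ℝ), ‖character y (toComplex ξ)‖ = 1 := by
    intro y ξ
    rw [norm_character]
    simp [toComplex]
  have hint : ∀ y, Integrable (fun ξ => ψ y * character y (cpoint ξ ν) *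
      character (-x) (toComplex ξ)) (volume.restrict (box a)) := by
    intro y
    simp only [hterm]
    refine Integrable.const_mul ?_ _
    refine (integrable_const (1 : ℝ)).mono' ?_ (Filter.Eventually.of_forall fun ξ => ?_)
    · exact ((continuous_character _).comp hcont).aestronglyMeasurable
    · rw [hnorm1]
  have hsum : Summable fun y => ∫ ξ in box a,
      ‖ψ y * character y (cpoint ξ ν) * character (-x) (toComplex ξ)‖ := by
    refine Summable.of_nonneg_of_le (fun y => integral_nonneg fun _ => norm_nonneg _) (fun y => ?_)
      (h.summable.mul_right ((2 * Real.pi) ^ d))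
    calc ∫ ξ in box a, ‖ψ y * character y (cpoint ξ ν) * character (-x) (toComplex ξ)‖
        ≤ ∫ _ξ in box a, ‖ψ y‖ * Real.exp (ρ * oneNorm y) := by
          refine integral_mono_of_nonneg (Filter.Eventually.of_forall fun _ => norm_nonneg _)
            (integrable_const _) (Filter.Eventually.of_forall fun ξ => ?_)
          simp only [norm_mul _ (character (-x) _), hnorm1, mul_one]
          exact norm_mul_character_le (cpoint_mem_strip ξ hν) ψ y
      _ = _ := by
          rw [setIntegral_const, measureReal_box, smul_eq_mul, mul_comm]
  have key := hasSum_integral_of_summable_integral_norm hint hsum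
  have e1 : ∫ ξ in box a, ∑' y, ψ y * character y (cpoint ξ ν) * character (-x) (toComplex ξ) =
      ∫ ξ in box a, F (cpoint ξ ν) * character (-x) (toComplex ξ) := by
    refine integral_congr_ae (Filter.Eventually.of_forall fun ξ => ?_)
    simp only
    rw [tsum_mul_right, (h.hasSum _ (cpoint_mem_strip ξ hν)).tsum_eq]
  rw [e1] at key
  refine key.unique ?_
  have e2 : ∀ y, ∫ ξ in box a, ψ y * character y (cpoint ξ ν) * character (-x) (toComplex ξ) =
      (ψ y * Complex.exp ((∑ i, (y i : ℝ) * ν i : ℝ) : ℂ)) *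
        if y - x = 0 then (2 * (Real.pi : ℂ)) ^ d else 0 := by
    intro y
    simp only [hterm]
    rw [integral_const_mul, setIntegral_character]
  simp only [e2]
  have := hasSum_single (f := fun y => (ψ y * Complex.exp ((∑ i, (y i : ℝ) * ν i : ℝ) : ℂ)) *
    if y - x = 0 then (2 * (Real.pi : ℂ)) ^ d else 0) x fun y hy => by
      rw [if_neg (sub_ne_zero.2 hy), mul_zero]
  simpa [mul_comm] using this

theorem integrableOn_norm (h : StripSeries ρ ψ F) (a : Fin d → ℝ) {ν : Fin d → ℝ}
    (hν : ‖ν‖ ≤ ρ) : IntegrableOn (fun ξ => ‖F (cpoint ξ ν)‖) (box a) := by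
  have hc : Continuous fun ξ => F (cpoint ξ ν) := by
    refine h.continuousOn.comp_continuous ?_ fun ξ => cpoint_mem_strip ξ hν
    exact continuous_cpoint.comp (continuous_id.prodMk continuous_const)
  refine (integrable_const (∑' x, ‖ψ x‖ * Real.exp (ρ * oneNorm x))).mono'
    hc.norm.aestronglyMeasurable (Filter.Eventually.of_forall fun ξ => ?_)
  rw [norm_norm]
  exact h.norm_le (cpoint_mem_strip ξ hν)

/-- The coefficients are bounded by integrals over a shifted torus. -/
theorem norm_coeff_le (h : StripSeries ρ ψ F) (a : Fin d → ℝ) {ν : Fin d → ℝ} (hν : ‖ν‖ ≤ ρ)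
    (x : Fin d → ℤ) :
    ‖ψ x‖ ≤ Real.exp (-∑ i, (x i : ℝ) * ν i) *
      (((2 * Real.pi) ^ d)⁻¹ * ∫ ξ in box a, ‖F (cpoint ξ ν)‖) := by
  have h1 := congrArg norm (h.coeff_eq a hν x)
  have h2 : ‖∫ ξ in box a, F (cpoint ξ ν) * character (-x) (toComplex ξ)‖ ≤
      ∫ ξ in box a, ‖F (cpoint ξ ν)‖ := by
    refine (norm_integral_le_integral_norm _).trans (le_of_eq ?_)
    refine integral_congr_ae (Filter.Eventually.of_forall fun ξ => ?_)
    simp only [norm_mul, norm_character]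
    simp [toComplex]
  have hpi : (0 : ℝ) < (2 * Real.pi) ^ d := by positivity
  rw [h1, norm_mul, norm_mul, Complex.norm_exp, Complex.ofReal_re, norm_pow, norm_mul,
    Complex.norm_real, Complex.norm_two, Real.norm_of_nonneg Real.pi_pos.le] at h2
  rw [Real.exp_neg, inv_mul_eq_div, le_div_iff₀ (Real.exp_pos _), inv_mul_eq_div,
    le_div_iff₀ hpi]
  linarith

end StripSeries

end ConvPow

/-! ### Cauchy estimates and holomorphic slices of the Fourier transform -/

namespace ConvPow

variable {d : ℕ}

/-- A finite linear combination of point evaluations that annihilates the first `k` monomials is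
small on functions that are holomorphic and bounded on a large disc. -/
theorem norm_sum_le_of_annihilates {ι : Type*} (s : Finset ι) (c z : ι → ℂ) {k : ℕ}
    (hann : ∀ l < k, ∑ j ∈ s, c j * z j ^ l = 0) {A S B : ℝ} (hA : 0 ≤ A)
    (hz : ∀ j ∈ s, ‖z j‖ ≤ A) (hS : 0 < S) (hAS : 4 * A ≤ S) {f : ℂ → ℂ}
    (hf : DifferentiableOn ℂ f (Metric.ball 0 S)) (hB : ∀ w ∈ Metric.ball (0 : ℂ) S, ‖f w‖ ≤ B) :
    ‖∑ j ∈ s, c j * f (z j)‖ ≤ 2 * B * (∑ j ∈ s, ‖c j‖) * (2 * A / S) ^ k := by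
  have hB0 : 0 ≤ B := (norm_nonneg _).trans (hB 0 (Metric.mem_ball_self hS))
  set a : ℕ → ℂ := fun l => (l.factorial : ℂ)⁻¹ * iteratedDeriv l f 0 with ha
  have ha_le : ∀ l, ‖a l‖ ≤ B * (2 / S) ^ l := by
    intro l
    have hsub : Metric.closedBall (0 : ℂ) (S / 2) ⊆ Metric.ball 0 S :=
      Metric.closedBall_subset_ball (by linarith)
    -- Cauchy's estimate is applied on radius S/2, since f is controlled only on the open disc of
    -- radius S.
    have h1 := Complex.norm_iteratedDeriv_le_of_forall_mem_sphere_norm_le (c := (0 : ℂ))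
      (R := S / 2) (C := B) (f := f) l (by linarith)
      ((hf.mono hsub).diffContOnCl_ball (subset_refl _))
      fun w hw => hB w (hsub (Metric.sphere_subset_closedBall hw))
    have hfac : (0 : ℝ) < l.factorial := by exact_mod_cast l.factorial_pos
    rw [ha, norm_mul, norm_inv, Complex.norm_natCast, inv_mul_le_iff₀ hfac]
    refine h1.trans (le_of_eq ?_)
    rw [div_pow, div_pow]
    field_simp
  have hsum : ∀ j ∈ s, HasSum (fun l => c j * (a l * z j ^ l)) (c j * f (z j)) := by
    intro j hj
    have hmem : z j ∈ Metric.ball (0 : ℂ) S := by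
      have := hz j hj
      rw [mem_ball_zero_iff]
      linarith
    have := (Complex.hasSum_taylorSeries_on_ball hf hmem).mul_left (c j)
    convert! this using 3 with l
    simp only [ha, sub_zero, smul_eq_mul]
    ring
  have htot := hasSum_sum hsum
  have e0 : ∀ l, ∑ j ∈ s, c j * (a l * z j ^ l) = a l * ∑ j ∈ s, c j * z j ^ l := by
    intro l
    rw [Finset.mul_sum]
    exact Finset.sum_congr rfl fun j _ => by ring
  simp only [e0] at htot
  -- The first k Taylor terms cancel; what remains is a geometric tail of ratio q ≤ 1/2.
  have hshift := (hasSum_nat_add_iff' k).2 htot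
  rw [Finset.sum_eq_zero (s := Finset.range k) (fun l hl => by rw [hann l (Finset.mem_range.1 hl), mul_zero]),
    sub_zero] at hshift
  set q := 2 * A / S with hq
  have hq0 : 0 ≤ q := by positivity
  have hq1 : q ≤ 1 / 2 := by
    rw [hq, div_le_iff₀ hS]
    linarith
  set Cs := ∑ j ∈ s, ‖c j‖ with hCs
  have hCs0 : 0 ≤ Cs := Finset.sum_nonneg fun _ _ => norm_nonneg _
  have hgeo := (hasSum_geometric_of_lt_one hq0 (by linarith)).mul_left (B * Cs * q ^ k)
  have hbd : ∀ l, ‖a (l + k) * ∑ j ∈ s, c j * z j ^ (l + k)‖ ≤ B * Cs * q ^ k * q ^ l := by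
    intro l
    have h2 : ‖∑ j ∈ s, c j * z j ^ (l + k)‖ ≤ Cs * A ^ (l + k) := by
      rw [hCs, Finset.sum_mul]
      refine (norm_sum_le _ _).trans (Finset.sum_le_sum fun j hj => ?_)
      rw [norm_mul, norm_pow]
      gcongr
      exact hz j hj
    rw [norm_mul]
    calc _ ≤ B * (2 / S) ^ (l + k) * (Cs * A ^ (l + k)) := by gcongr; exact ha_le _
      _ = B * Cs * (2 / S * A) ^ (l + k) := by rw [mul_pow]; ring
      _ = B * Cs * q ^ (l + k) := by rw [hq]; congr 2; ring
      _ = _ := by rw [pow_add]; ring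
  have h3 := tsum_of_norm_bounded hgeo hbd
  rw [hshift.tsum_eq] at h3
  refine h3.trans ?_
  have : (1 - q)⁻¹ ≤ 2 := by
    rw [inv_le_comm₀ (by linarith) two_pos]
    linarith
  calc B * Cs * q ^ k * (1 - q)⁻¹ ≤ B * Cs * q ^ k * 2 := by gcongr
    _ = _ := by ring

theorem summable_exp_neg_oneNorm {c : ℝ} (hc : 0 < c) :
    Summable fun x : Fin d → ℤ => Real.exp (-(c * oneNorm x)) := by
  set f : ℤ → ℝ := fun m => Real.exp (-(c * |(m : ℝ)|)) with hf
  have hgeo : Summable fun n : ℕ => Real.exp (-(c * (n : ℝ))) := by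
    have := Real.summable_exp_nat_mul_iff.2 (neg_lt_zero.2 hc)
    refine this.congr fun n => ?_
    congr 1
    ring
  have hfs : Summable f := by
    refine Summable.of_nat_of_neg ?_ ?_ <;> simpa [hf] using hgeo
  have hf0 : ∀ m, 0 ≤ f m := fun m => (Real.exp_pos _).le
  have heq : ∀ x : Fin d → ℤ, Real.exp (-(c * oneNorm x)) = ∏ i, f (x i) := by
    intro x
    rw [oneNorm, Finset.mul_sum, ← Finset.sum_neg_distrib, Real.exp_sum]
  simp only [heq]
  refine summable_of_sum_le (c := (∑' m, f m) ^ d)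
    (fun x => Finset.prod_nonneg fun i _ => hf0 _) fun u => ?_
  calc ∑ x ∈ u, ∏ i, f (x i)
      ≤ ∑ x ∈ Fintype.piFinset (fun i : Fin d => u.image fun x => x i), ∏ i, f (x i) := by
        refine Finset.sum_le_sum_of_subset_of_nonneg (fun x hx => ?_)
          fun x _ _ => Finset.prod_nonneg fun i _ => hf0 _
        rw [Fintype.mem_piFinset]
        exact fun i => Finset.mem_image_of_mem _ hx
    _ = ∏ i : Fin d, ∑ m ∈ u.image (fun x => x i), f m := by rw [Finset.prod_univ_sum]
    _ ≤ ∏ _i : Fin d, ∑' m, f m := by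
        refine Finset.prod_le_prod (fun i _ => Finset.sum_nonneg fun m _ => hf0 m) fun i _ => ?_
        exact hfs.sum_le_tsum _ fun m _ => hf0 m
    _ = _ := by simp

theorem fourier_eq_tsum_character (φ : (Fin d → ℤ) → ℂ) (ξ : Fin d → ℝ) :
    fourier φ ξ = ∑' x, φ x * character x (toComplex ξ) := by
  simp only [fourier, character_toComplex]

/-- The point `2πm` of the dual lattice. -/
noncomputable def period (m : Fin d → ℤ) : Fin d → ℝ := fun i => 2 * Real.pi * m i

theorem period_zero : period (0 : Fin d → ℤ) = 0 := by
  ext i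
  simp [period]

theorem toComplex_add (ξ η : Fin d → ℝ) : toComplex (ξ + η) = toComplex ξ + toComplex η := by
  ext i
  simp [toComplex]

theorem character_add_period (x : Fin d → ℤ) (ζ : Fin d → ℂ) (m : Fin d → ℤ) :
    character x (ζ + toComplex (period m)) = character x ζ := by
  refine Complex.exp_eq_exp_iff_exists_int.2 ⟨∑ i, x i * m i, ?_⟩
  simp only [Pi.add_apply, toComplex, period, mul_add, Finset.sum_add_distrib]
  congr 1
  push_cast
  rw [Finset.mul_sum, Finset.sum_mul]
  exact Finset.sum_congr rfl fun i _ => by ring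

theorem fourier_add_period (φ : (Fin d → ℤ) → ℂ) (ξ : Fin d → ℝ) (m : Fin d → ℤ) :
    fourier φ (ξ + period m) = fourier φ ξ := by
  simp only [fourier_eq_tsum_character, toComplex_add, character_add_period]

theorem exists_add_period_mem_torus (ξ : Fin d → ℝ) : ∃ m, ξ + period m ∈ torus d := by
  choose m hm _ using fun i =>
    existsUnique_add_zsmul_mem_Ioc Real.two_pi_pos (ξ i) (-Real.pi)
  refine ⟨m, fun i _ => ?_⟩
  have := hm i
  simp only [zsmul_eq_mul] at this
  simp only [Pi.add_apply, period]
  rw [show -Real.pi + 2 * Real.pi = Real.pi by ring] at this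
  rwa [mul_comm]

theorem torus_subset_closedBall : torus d ⊆ Metric.closedBall 0 Real.pi := by
  intro ξ hξ
  rw [mem_closedBall_zero_iff, pi_norm_le_iff_of_nonneg Real.pi_pos.le]
  intro i
  have := hξ i trivial
  rw [Real.norm_eq_abs, abs_le]
  exact ⟨this.1.le, this.2⟩

/-- Along the coordinate directions, the Fourier transform extends holomorphically from `ξ` to discs
of radius `r`, with bound `B`. -/
def HasSlices (φ : (Fin d → ℤ) → ℂ) (r B : ℝ) (ξ : Fin d → ℝ) : Prop :=
  ∀ i : Fin d, ∃ f : ℂ → ℂ,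
    DifferentiableOn ℂ f (Metric.ball 0 r) ∧ (∀ z ∈ Metric.ball (0 : ℂ) r, ‖f z‖ ≤ B) ∧
      ∀ t : ℝ, |t| < r → f t = fourier φ (ξ + t • Pi.single i 1)

theorem HasSlices.mono {φ : (Fin d → ℤ) → ℂ} {r r' B B' : ℝ} {ξ : Fin d → ℝ}
    (h : HasSlices φ r B ξ) (hr : r' ≤ r) (hB : B ≤ B') : HasSlices φ r' B' ξ := by
  intro i
  obtain ⟨f, h1, h2, h3⟩ := h i
  have hsub := Metric.ball_subset_ball (x := (0 : ℂ)) hr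
  exact ⟨f, h1.mono hsub, fun z hz => (h2 z (hsub hz)).trans hB, fun t ht => h3 t (ht.trans_le hr)⟩

theorem dist_toComplex_add_smul_single (ξ τ : Fin d → ℝ) (z : ℂ) (i : Fin d) :
    dist (toComplex ξ + z • Pi.single i 1) (toComplex τ) ≤ dist ξ τ + ‖z‖ := by
  rw [dist_eq_norm, dist_eq_norm]
  have e : toComplex ξ + z • Pi.single i 1 - toComplex τ =
      toComplex (ξ - τ) + z • Pi.single i 1 := by
    ext j
    simp only [toComplex, Pi.add_apply, Pi.sub_apply, Complex.ofReal_sub]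
    ring
  have e1 : ‖toComplex (ξ - τ)‖ ≤ ‖ξ - τ‖ := by
    rw [pi_norm_le_iff_of_nonneg (norm_nonneg _)]
    intro j
    simp only [toComplex, Complex.norm_real]
    exact norm_le_pi_norm (ξ - τ) j
  have e2 : ‖z • (Pi.single i 1 : Fin d → ℂ)‖ ≤ ‖z‖ := by
    rw [norm_smul, Pi.norm_single, norm_one, mul_one]
  rw [e]
  linarith [norm_add_le (toComplex (ξ - τ)) (z • (Pi.single i 1 : Fin d → ℂ))]

theorem toComplex_add_smul_single (ξ : Fin d → ℝ) (t : ℝ) (i : Fin d) :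
    toComplex ξ + (t : ℂ) • Pi.single i 1 = toComplex (ξ + t • Pi.single i 1) := by
  ext j
  by_cases hj : j = i
  · subst hj
    simp [toComplex]
  · simp [toComplex, hj]

theorem HasSlices.of_add_period {φ : (Fin d → ℤ) → ℂ} {r B : ℝ} {ξ : Fin d → ℝ} {m : Fin d → ℤ}
    (h : HasSlices φ r B (ξ + period m)) : HasSlices φ r B ξ := by
  intro i
  obtain ⟨f, h1, h2, h3⟩ := h i
  refine ⟨f, h1, h2, fun t ht => ?_⟩
  rw [h3 t ht, add_right_comm, fourier_add_period]

theorem MemH.exists_slices_near {φ : (Fin d → ℤ) → ℂ} (hφ : MemH φ) {τ : Fin d → ℝ}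
    (hτ : τ ∈ torus d) : ∃ δ B, 0 < δ ∧ ∀ ξ, dist ξ τ < δ → HasSlices φ δ B ξ := by
  obtain ⟨-, U, F, hU, htU, hF, hFφ⟩ := hφ
  have hτU := htU τ hτ
  have hcont : ContinuousAt F (toComplex τ) :=
    (hF.differentiableAt (hU.mem_nhds hτU)).continuousAt
  have hev : ∀ᶠ ζ in 𝓝 (toComplex τ), ζ ∈ U ∧ ‖F ζ‖ < ‖F (toComplex τ)‖ + 1 :=
    (hU.eventually_mem hτU).and (hcont.norm.eventually_lt continuousAt_const (lt_add_one _))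
  obtain ⟨δ, hδ, hball⟩ := Metric.eventually_nhds_iff.1 hev
  refine ⟨δ / 2, ‖F (toComplex τ)‖ + 1, half_pos hδ, fun ξ hξ i => ?_⟩
  have hdist : ∀ z ∈ Metric.ball (0 : ℂ) (δ / 2),
      dist (toComplex ξ + z • Pi.single i 1) (toComplex τ) < δ := by
    intro z hz
    rw [mem_ball_zero_iff] at hz
    linarith [dist_toComplex_add_smul_single ξ τ z i]
  refine ⟨fun z => F (toComplex ξ + z • Pi.single i 1), ?_, ?_, ?_⟩
  · refine hF.comp ?_ fun z hz => (hball (hdist z hz)).1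
    exact ((differentiable_id.smul_const _).const_add _).differentiableOn
  · exact fun z hz => (hball (hdist z hz)).2.le
  · intro t ht
    have hmem := (hball (hdist t (by simpa using ht))).1
    simp only
    rw [toComplex_add_smul_single] at hmem ⊢
    exact hFφ _ hmem

/-- The half-open torus is not compact, so a uniform radius is found on the closed cube, each of
whose points is first translated into the torus by a period. The local extensions need not be glued
together. -/
theorem MemH.exists_slices {φ : (Fin d → ℤ) → ℂ} (hφ : MemH φ) :
    ∃ r B, 0 < r ∧ ∀ ξ : Fin d → ℝ, HasSlices φ r B ξ := by
  have hcpt : ∃ r B, 0 < r ∧ ∀ ξ ∈ Metric.closedBall (0 : Fin d → ℝ) Real.pi,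
      HasSlices φ r B ξ := by
    refine (isCompact_closedBall (0 : Fin d → ℝ) Real.pi).induction_on
      (p := fun s => ∃ r B, 0 < r ∧ ∀ ξ ∈ s, HasSlices φ r B ξ)
      ⟨1, 0, one_pos, fun _ h => h.elim⟩
      (fun s t hst ⟨r, B, hr, h⟩ => ⟨r, B, hr, fun ξ hξ => h ξ (hst hξ)⟩) ?_ ?_
    · rintro s t ⟨r, B, hr, h⟩ ⟨r', B', hr', h'⟩
      refine ⟨min r r', max B B', lt_min hr hr', ?_⟩
      rintro ξ (hξ | hξ)
      · exact (h ξ hξ).mono (min_le_left _ _) (le_max_left _ _)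
      · exact (h' ξ hξ).mono (min_le_right _ _) (le_max_right _ _)
    · intro ξ₀ _
      obtain ⟨m, hm⟩ := exists_add_period_mem_torus ξ₀
      obtain ⟨δ, B, hδ, h⟩ := hφ.exists_slices_near hm
      refine ⟨Metric.ball ξ₀ δ, mem_nhdsWithin_of_mem_nhds (Metric.ball_mem_nhds _ hδ), δ, B, hδ,
        fun ξ hξ => HasSlices.of_add_period (m := m) (h _ ?_)⟩
      rw [dist_add_right]
      exact hξ
  obtain ⟨r, B, hr, h⟩ := hcpt
  refine ⟨r, B, hr, fun ξ => ?_⟩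
  obtain ⟨m, hm⟩ := exists_add_period_mem_torus ξ
  exact (h _ (torus_subset_closedBall hm)).of_add_period

end ConvPow

/-! ### Exponential decay of the coefficients -/

namespace ConvPow

open MeasureTheory

variable {d : ℕ}

theorem sum_binomial_mul_pow_eq_zero {k l : ℕ} (hl : l < k) (t : ℂ) :
    ∑ j ∈ Finset.range (k + 1), ((-1) ^ (k - j) * (k.choose j : ℂ)) * ((j : ℂ) * t) ^ l = 0 := by
  have h := congrFun (fwdDiff_iter_pow_eq_zero_of_lt (R := ℂ) hl) 0
  rw [fwdDiff_iter_eq_sum_shift] at h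
  have h2 : ∑ j ∈ Finset.range (k + 1), ((-1) ^ (k - j) * (k.choose j : ℂ)) * (j : ℂ) ^ l = 0 := by
    simpa using h
  simp only [mul_pow, ← mul_assoc]
  rw [← Finset.sum_mul, h2, zero_mul]

theorem character_toComplex_add_smul_single (x : Fin d → ℤ) (ξ : Fin d → ℝ) (t : ℝ) (i : Fin d) :
    character x (toComplex (ξ + t • Pi.single i 1)) =
      character x (toComplex ξ) * Complex.exp (Complex.I * ((x i : ℂ) * t)) := by
  rw [character, character, ← Complex.exp_add, ← mul_add]
  congr 2
  simp only [toComplex, Pi.add_apply, Complex.ofReal_add, mul_add, Finset.sum_add_distrib]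
  congr 1
  rw [Finset.sum_eq_single i]
  · simp
  · intro j _ hj
    simp [hj]
  · simp

/-- The finite differences of the Fourier transform bound the corresponding multiples of the
coefficients. -/
theorem norm_mul_pow_le_of_slices {φ : (Fin d → ℤ) → ℂ} (hs : Summable fun x => ‖φ x‖) {r B : ℝ}
    (hr : 0 < r) (hφ : ∀ ξ, HasSlices φ r B ξ) (x : Fin d → ℤ) (i : Fin d) (k : ℕ) {t : ℝ}
    (ht : 0 ≤ t) (htr : 4 * (k * t) ≤ r) :
    ‖φ x‖ * ‖Complex.exp (Complex.I * ((x i : ℂ) * t)) - 1‖ ^ k ≤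
      2 * B * (4 * k / r) ^ k * t ^ k := by
  set e : ℤ → ℂ := fun m => Complex.exp (Complex.I * ((m : ℂ) * t)) with he
  have he1 : ∀ m, ‖e m‖ = 1 := by
    intro m
    rw [he, Complex.norm_exp]
    simp
  -- These are the coefficients of the k-th difference of the Fourier transform, with step t in
  -- direction i. That difference annihilates the powers below k, so it is of order t^k.
  set ψ : (Fin d → ℤ) → ℂ := fun y => φ y * (e (y i) - 1) ^ k with hψ
  have hψs : Summable fun y => ‖ψ y‖ * Real.exp (0 * oneNorm y) := by
    simp only [zero_mul, Real.exp_zero, mul_one]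
    refine Summable.of_nonneg_of_le (fun y => norm_nonneg _) (fun y => ?_) (hs.mul_right (2 ^ k))
    rw [hψ, norm_mul, norm_pow]
    gcongr
    refine (norm_sub_le _ _).trans ?_
    rw [he1, norm_one]
    norm_num
  have hS := StripSeries.of_summable hψs
  have hb := hS.norm_coeff_le 0 (ν := 0) (by simp) x
  have hbound : ∀ ξ : Fin d → ℝ, ‖∑' y, ψ y * character y (cpoint ξ 0)‖ ≤
      2 * B * (4 * k / r) ^ k * t ^ k := by
    intro ξ
    obtain ⟨f, h1, h2, h3⟩ := hφ ξ i
    have hval : ∀ j ∈ Finset.range (k + 1), f ((j : ℂ) * t) =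
        ∑' y, φ y * (character y (toComplex ξ) * e (y i) ^ j) := by
      intro j hj
      have hj' : (j : ℝ) ≤ k := by exact_mod_cast Nat.lt_succ_iff.1 (Finset.mem_range.1 hj)
      have hjt : |(j : ℝ) * t| < r := by
        rw [abs_of_nonneg (by positivity)]
        have : (j : ℝ) * t ≤ k * t := by gcongr
        have : 0 ≤ (j : ℝ) * t := by positivity
        linarith
      have := h3 _ hjt
      push_cast at this
      rw [this, fourier_eq_tsum_character]
      refine tsum_congr fun y => ?_
      rw [character_toComplex_add_smul_single, he, ← Complex.exp_nat_mul]
      congr 3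
      push_cast
      ring
    have hsumm : ∀ j : ℕ, Summable fun y => φ y * (character y (toComplex ξ) * e (y i) ^ j) := by
      intro j
      refine Summable.of_norm_bounded hs fun y => ?_
      rw [norm_mul, norm_mul, norm_pow, he1, one_pow, norm_character]
      simp [toComplex]
    have hsum : ∑' y, ψ y * character y (cpoint ξ 0) = ∑ j ∈ Finset.range (k + 1),
        ((-1) ^ (k - j) * (k.choose j : ℂ)) * f ((j : ℂ) * t) := by
      rw [Finset.sum_congr rfl fun j hj => by rw [hval j hj, ← tsum_mul_left],
        ← Summable.tsum_finsetSum fun j _ => (hsumm j).mul_left _]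
      refine tsum_congr fun y => ?_
      rw [hψ, cpoint_zero]
      simp only [sub_eq_add_neg]
      rw [add_pow, Finset.mul_sum, Finset.sum_mul]
      exact Finset.sum_congr rfl fun j _ => by ring
    rw [hsum]
    have := norm_sum_le_of_annihilates (Finset.range (k + 1))
      (fun j => (-1) ^ (k - j) * (k.choose j : ℂ)) (fun j => (j : ℂ) * t) (k := k)
      (fun l hl => sum_binomial_mul_pow_eq_zero hl t) (A := k * t) (S := r) (B := B)
      (by positivity) (fun j hj => by
        have hj' : (j : ℝ) ≤ k := by exact_mod_cast Nat.lt_succ_iff.1 (Finset.mem_range.1 hj)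
        rw [norm_mul, Complex.norm_natCast, Complex.norm_real, Real.norm_of_nonneg ht]
        gcongr) hr htr h1 h2
    refine this.trans (le_of_eq ?_)
    have e2 : ∑ j ∈ Finset.range (k + 1), ‖(-1 : ℂ) ^ (k - j) * (k.choose j : ℂ)‖ = 2 ^ k := by
      simp only [norm_mul, norm_pow, norm_neg, norm_one, one_pow, one_mul, Complex.norm_natCast]
      exact_mod_cast Nat.sum_range_choose k
    rw [e2, mul_assoc (2 * B), mul_assoc (2 * B), ← mul_pow, ← mul_pow]
    congr 2
    ring
  have hpi : (0 : ℝ) < (2 * Real.pi) ^ d := by positivity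
  have hint : ∫ ξ in box 0, ‖∑' y, ψ y * character y (cpoint ξ 0)‖ ≤
      (2 * Real.pi) ^ d * (2 * B * (4 * k / r) ^ k * t ^ k) := by
    rw [← measureReal_box (d := d) 0, ← smul_eq_mul, ← setIntegral_const]
    exact integral_mono_of_nonneg (Filter.Eventually.of_forall fun _ => norm_nonneg _)
      (integrable_const _) (Filter.Eventually.of_forall hbound)
  have hψx : ‖ψ x‖ = ‖φ x‖ * ‖e (x i) - 1‖ ^ k := by rw [hψ, norm_mul, norm_pow]
  rw [← hψx]
  refine hb.trans ?_
  simp only [Pi.zero_apply, mul_zero, Finset.sum_const_zero, neg_zero, Real.exp_zero, one_mul]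
  rw [inv_mul_le_iff₀ hpi]
  exact hint

theorem tendsto_norm_exp_sub_one_div (m : ℝ) :
    Filter.Tendsto (fun t : ℝ => ‖Complex.exp (Complex.I * ((m : ℂ) * t)) - 1‖ / t) (𝓝[>] 0)
      (𝓝 |m|) := by
  have h1 : HasDerivAt (fun t : ℝ => Complex.exp (Complex.I * ((m : ℂ) * t))) (Complex.I * m) 0 := by
    have h2 : HasDerivAt (fun t : ℝ => Complex.I * ((m : ℂ) * (t : ℂ))) (Complex.I * m) 0 := by
      have := ((Complex.ofRealCLM.hasDerivAt (x := (0 : ℝ))).const_mul (m : ℂ)).const_mul Complex.I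
      simpa using this
    simpa using h2.cexp
  have h3 := ((hasDerivAt_iff_tendsto_slope_zero.1 h1).mono_left
    (nhdsWithin_mono _ fun t (ht : t ∈ Set.Ioi (0 : ℝ)) => ne_of_gt ht)).norm
  have e : ‖Complex.I * (m : ℂ)‖ = |m| := by simp
  rw [e] at h3
  refine h3.congr' ?_
  filter_upwards [self_mem_nhdsWithin] with t ht
  have ht' : (0 : ℝ) < t := ht
  rw [norm_smul, norm_inv, Real.norm_of_nonneg ht'.le, div_eq_inv_mul]
  simp

/-- Divide the finite-difference bound by t^k and let t decrease to 0. -/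
theorem norm_mul_abs_pow_le {φ : (Fin d → ℤ) → ℂ} (hs : Summable fun x => ‖φ x‖) {r B : ℝ}
    (hr : 0 < r) (hφ : ∀ ξ, HasSlices φ r B ξ) (x : Fin d → ℤ) (i : Fin d) (k : ℕ) :
    ‖φ x‖ * |(x i : ℝ)| ^ k ≤ 2 * B * (4 * k / r) ^ k := by
  have h1 := ((tendsto_norm_exp_sub_one_div (x i : ℝ)).pow k).const_mul ‖φ x‖
  refine le_of_tendsto h1 ?_
  have h2 : ∀ᶠ t in 𝓝[>] (0 : ℝ), 4 * (k * t) ≤ r := by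
    have : Filter.Tendsto (fun t : ℝ => 4 * (k * t)) (𝓝[>] 0) (𝓝 (4 * (k * 0))) :=
      (Continuous.tendsto (by fun_prop) 0).mono_left nhdsWithin_le_nhds
    rw [mul_zero, mul_zero] at this
    exact this.eventually_le_const hr
  filter_upwards [self_mem_nhdsWithin, h2] with t ht htr
  have ht' : (0 : ℝ) < t := ht
  have h3 := norm_mul_pow_le_of_slices hs hr hφ x i k ht'.le htr
  rw [div_pow, mul_div_assoc', div_le_iff₀ (pow_pos ht' k)]
  simpa using h3

/-- Sum the moment bounds against s^k/k!. Because k^k ≤ e^k k!, the choice s = r/(8e) gives a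
geometric series of ratio 1/2. -/
theorem norm_mul_exp_le {φ : (Fin d → ℤ) → ℂ} (hs : Summable fun x => ‖φ x‖) {r B : ℝ}
    (hr : 0 < r) (hφ : ∀ ξ, HasSlices φ r B ξ) (x : Fin d → ℤ) (i : Fin d) :
    ‖φ x‖ * Real.exp (r / (8 * Real.exp 1) * |(x i : ℝ)|) ≤ 4 * B := by
  have hB0 : 0 ≤ B := by
    obtain ⟨f, -, h2, -⟩ := hφ 0 i
    exact (norm_nonneg _).trans (h2 0 (Metric.mem_ball_self hr))
  set s := r / (8 * Real.exp 1) with hsdef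
  have he : 0 < Real.exp 1 := Real.exp_pos _
  have hexp : HasSum (fun k : ℕ => ‖φ x‖ * ((s * |(x i : ℝ)|) ^ k / k.factorial))
      (‖φ x‖ * Real.exp (s * |(x i : ℝ)|)) := by
    rw [Real.exp_eq_exp_ℝ]
    exact (NormedSpace.expSeries_div_hasSum_exp (s * |(x i : ℝ)|)).mul_left _
  have hgeo := (hasSum_geometric_of_lt_one (r := (1 / 2 : ℝ)) (by norm_num)
    (by norm_num)).mul_left (2 * B)
  refine (hasSum_le (fun k => ?_) hexp hgeo).trans (le_of_eq (by ring))
  have hk : (0 : ℝ) < k.factorial := by exact_mod_cast k.factorial_pos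
  have h1 := norm_mul_abs_pow_le hs hr hφ x i k
  have h2 : (k : ℝ) ^ k ≤ Real.exp 1 ^ k * k.factorial := by
    have := Real.pow_div_factorial_le_exp (k : ℝ) (by positivity) k
    rw [div_le_iff₀ hk] at this
    rwa [← Real.exp_nat_mul, mul_one]
  rw [mul_div_assoc', div_le_iff₀ hk, mul_pow]
  calc ‖φ x‖ * (s ^ k * |(x i : ℝ)| ^ k) = s ^ k * (‖φ x‖ * |(x i : ℝ)| ^ k) := by ring
    _ ≤ s ^ k * (2 * B * (4 * k / r) ^ k) := by gcongr
    _ = 2 * B * ((s * (4 / r)) ^ k * (k : ℝ) ^ k) := by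
        rw [mul_div_right_comm, mul_pow, mul_pow]; ring
    _ ≤ 2 * B * ((s * (4 / r)) ^ k * (Real.exp 1 ^ k * k.factorial)) := by gcongr
    _ = 2 * B * (s * (4 / r) * Real.exp 1) ^ k * k.factorial := by rw [mul_pow _ (Real.exp 1)]; ring
    _ = _ := by
        congr 3
        rw [hsdef]
        field_simp
        norm_num

/-- A function whose Fourier transform is holomorphic near the torus decays exponentially. -/
theorem MemH.exists_summable {φ : (Fin d → ℤ) → ℂ} (hφ : MemH φ) :
    ∃ ρ, 0 < ρ ∧ Summable fun x => ‖φ x‖ * Real.exp (ρ * oneNorm x) := by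
  obtain ⟨r, B, hr, h⟩ := hφ.exists_slices
  have hs := hφ.1
  set s := r / (8 * Real.exp 1) with hsdef
  have hs0 : 0 < s := by positivity
  -- Some coordinate satisfies s|xᵢ| ≥ c|x|₁ unless |x|₁ = 0; the denominator d + 1 rather than d
  -- also covers d = 0.
  set c := s / (d + 1) with hc
  have hc0 : 0 < c := by positivity
  set K := max (4 * B) (∑' x, ‖φ x‖) with hK
  have hbound : ∀ x, ‖φ x‖ * Real.exp (c * oneNorm x) ≤ K := by
    intro x
    have hmax : c * oneNorm x ≤ 0 ∨ ∃ i, c * oneNorm x ≤ s * |(x i : ℝ)| := by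
      by_contra! hcon
      obtain ⟨h0, h1⟩ := hcon
      have h2 : ∑ i : Fin d, s * |(x i : ℝ)| ≤ ∑ _i : Fin d, c * oneNorm x :=
        Finset.sum_le_sum fun i _ => (h1 i).le
      rw [← Finset.mul_sum, ← oneNorm, Finset.sum_const, Finset.card_univ, Fintype.card_fin,
        nsmul_eq_mul] at h2
      have h3 : s * oneNorm x = (d + 1) * (c * oneNorm x) := by rw [hc]; field_simp
      linarith
    rcases hmax with h0 | ⟨i, hi⟩
    · calc ‖φ x‖ * Real.exp (c * oneNorm x) ≤ ‖φ x‖ * 1 := by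
            gcongr
            exact Real.exp_le_one_iff.2 h0
        _ ≤ _ := by
            rw [mul_one]
            exact le_max_of_le_right (hs.le_tsum x fun _ _ => norm_nonneg _)
    · calc ‖φ x‖ * Real.exp (c * oneNorm x) ≤ ‖φ x‖ * Real.exp (s * |(x i : ℝ)|) := by gcongr
        _ ≤ 4 * B := norm_mul_exp_le hs hr h x i
        _ ≤ K := le_max_left _ _
  -- Half of the decay rate is spent on summability over the lattice.
  refine ⟨c / 2, by positivity, Summable.of_nonneg_of_le (fun x => by positivity) (fun x => ?_)
    ((summable_exp_neg_oneNorm (d := d) (half_pos hc0)).mul_left K)⟩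
  have h1 := hbound x
  have e : Real.exp (c / 2 * oneNorm x) =
      Real.exp (c * oneNorm x) * Real.exp (-(c / 2 * oneNorm x)) := by
    rw [← Real.exp_add]
    congr 1
    ring
  rw [e, ← mul_assoc]
  gcongr

end ConvPow

/-! ### The estimate of F at complex points near ξ₀ -/

namespace ConvPow

variable {d : ℕ}

/-- The interpolation formula at 0, …, N minus evaluation at -i annihilates all powers up to N, so
it is of order S^(-(N+1)) on functions bounded on a disc of radius S. -/
theorem exists_lagrange_error (N : ℕ) : ∃ (c : ℕ → ℂ) (K : ℝ), 0 < K ∧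
    ∑ j ∈ Finset.range (N + 1), c j = 1 ∧ ∀ (f : ℂ → ℂ) (S B : ℝ),
    4 * ((N : ℝ) + 1) ≤ S → DifferentiableOn ℂ f (Metric.ball 0 S) →
    (∀ w ∈ Metric.ball (0 : ℂ) S, ‖f w‖ ≤ B) →
    ‖f (-Complex.I) - ∑ j ∈ Finset.range (N + 1), c j * f (j : ℂ)‖ ≤ K * B * (1 / S) ^ (N + 1) := by
  obtain ⟨c, hc⟩ := exists_lagrange N
  set c' : ℕ → ℂ := fun j => if j < N + 1 then c j else -1 with hc'
  set z : ℕ → ℂ := fun j => if j < N + 1 then (j : ℂ) else -Complex.I with hz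
  have hsplit : ∀ g : ℂ → ℂ, ∑ j ∈ Finset.range (N + 2), c' j * g (z j) =
      (∑ j ∈ Finset.range (N + 1), c j * g (j : ℂ)) - g (-Complex.I) := by
    intro g
    rw [Finset.sum_range_succ, sub_eq_add_neg]
    congr 1
    · refine Finset.sum_congr rfl fun j hj => ?_
      simp only [hc', hz, if_pos (Finset.mem_range.1 hj)]
    · simp [hc', hz]
  have hann : ∀ l < N + 1, ∑ j ∈ Finset.range (N + 2), c' j * z j ^ l = 0 := by
    intro l hl
    rw [hsplit fun w => w ^ l, sub_eq_zero]
    have := hc (Polynomial.X ^ l) (by rw [Polynomial.natDegree_X_pow]; omega)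
    simpa using this.symm
  have hC0 : 0 ≤ ∑ j ∈ Finset.range (N + 2), ‖c' j‖ := Finset.sum_nonneg fun _ _ => norm_nonneg _
  refine ⟨c, 2 * (∑ j ∈ Finset.range (N + 2), ‖c' j‖ + 1) * (2 * ((N : ℝ) + 1)) ^ (N + 1),
    by positivity, ?_, fun f S B hS hf hB => ?_⟩
  · simpa using (hc 1 (by simp)).symm
  have hS0 : 0 < S := lt_of_lt_of_le (by positivity) hS
  have hB0 : 0 ≤ B := (norm_nonneg _).trans (hB 0 (Metric.mem_ball_self hS0))
  have h := norm_sum_le_of_annihilates (Finset.range (N + 2)) c' z hann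
    (A := (N : ℝ) + 1) (by positivity) (fun j hj => by
      simp only [hz]
      split_ifs with hj'
      · rw [Complex.norm_natCast]
        exact_mod_cast hj'.le
      · rw [norm_neg, Complex.norm_I]
        linarith [(Nat.cast_nonneg N : (0 : ℝ) ≤ N)]) hS0 hS hf hB
  rw [hsplit, norm_sub_rev] at h
  refine h.trans ?_
  rw [div_eq_mul_one_div, mul_pow]
  calc _ = 2 * (∑ j ∈ Finset.range (N + 2), ‖c' j‖) * (2 * ((N : ℝ) + 1)) ^ (N + 1) * B *
        (1 / S) ^ (N + 1) := by ring
    _ ≤ _ := by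
        gcongr
        linarith

theorem norm_toComplex_le (ξ : Fin d → ℝ) : ‖toComplex ξ‖ ≤ ‖ξ‖ := by
  rw [pi_norm_le_iff_of_nonneg (norm_nonneg _)]
  intro j
  simp only [toComplex, Complex.norm_real]
  exact norm_le_pi_norm ξ j

theorem mem_strip_of_norm_le {ρ : ℝ} {ζ : Fin d → ℂ} (hζ : ‖ζ‖ ≤ ρ) (ξ : Fin d → ℝ) :
    ζ + toComplex ξ ∈ strip d ρ := by
  intro i
  have : (ζ + toComplex ξ) i = ζ i + (ξ i : ℂ) := rfl
  rw [this, Complex.add_im, Complex.ofReal_im, add_zero]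
  exact (Complex.abs_im_le_norm _).trans ((norm_le_pi_norm ζ i).trans hζ)

namespace StripSeries

variable {ρ : ℝ} {φ : (Fin d → ℤ) → ℂ} {F : (Fin d → ℂ) → ℂ}

theorem eq_fourier (h : StripSeries ρ φ F) (hρ : 0 ≤ ρ) (ξ : Fin d → ℝ) :
    F (toComplex ξ) = fourier φ ξ := by
  rw [fourier_eq_tsum_character, (h.hasSum _ (toComplex_mem_strip hρ ξ)).tsum_eq]

theorem differentiableOn_line (h : StripSeries ρ φ F) (ζ ω : Fin d → ℂ) {S : ℝ}
    (hS : ∀ s ∈ Metric.ball (0 : ℂ) S, ζ + s • ω ∈ strip d ρ) :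
    DifferentiableOn ℂ (fun s : ℂ => F (ζ + s • ω)) (Metric.ball 0 S) := by
  have h1 := Complex.differentiableOn_tsum_of_summable_norm h.summable
    (F := fun x (s : ℂ) => φ x * character x (ζ + s • ω)) (U := Metric.ball (0 : ℂ) S)
    (fun x => by
      unfold character
      refine Differentiable.differentiableOn ?_
      simp only [Pi.add_apply, Pi.smul_apply, smul_eq_mul]
      fun_prop) Metric.isOpen_ball
    fun x s hs => norm_mul_character_le (hS s hs) φ x
  exact h1.congr fun s hs => (h.hasSum _ (hS s hs)).tsum_eq.symm

theorem continuousAt_toComplex (h : StripSeries ρ φ F) (hρ : 0 < ρ) (ξ : Fin d → ℝ) :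
    ContinuousAt F (toComplex ξ) := by
  refine h.continuousOn.continuousAt (Filter.mem_of_superset
    (Metric.ball_mem_nhds (toComplex ξ) hρ) fun ζ hζ => ?_)
  rw [Metric.mem_ball, dist_eq_norm] at hζ
  have := mem_strip_of_norm_le (ρ := ρ) hζ.le ξ
  rwa [sub_add_cancel] at this

end StripSeries

/-- The remainder in the expansion of `Log (F (ζ + ξ₀) / F ξ₀)` at complex points. -/
noncomputable def remainder (F : (Fin d → ℂ) → ℂ) (ξ₀ α : Fin d → ℝ)
    (P : MvPolynomial (Fin d) ℂ) (ζ : Fin d → ℂ) : ℂ :=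
  Complex.log (F (ζ + toComplex ξ₀) / F (toComplex ξ₀)) -
    (Complex.I * (∑ i, (α i : ℂ) * ζ i) - MvPolynomial.eval ζ P)

section Local

variable {ρ : ℝ} {φ : (Fin d → ℤ) → ℂ} {F : (Fin d → ℂ) → ℂ} {ξ₀ α : Fin d → ℝ}
  {P : MvPolynomial (Fin d) ℂ}

theorem remainder_toComplex (h : StripSeries ρ φ F) (hρ : 0 ≤ ρ) (η : Fin d → ℝ) :
    remainder F ξ₀ α P (toComplex η) =
      Gam φ ξ₀ η - (Complex.I * ((∑ i, α i * η i : ℝ) : ℂ) - polyFun P η) := by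
  rw [remainder, ← toComplex_add, h.eq_fourier hρ, h.eq_fourier hρ, Gam, polyFun]
  simp [toComplex]

theorem exists_remainder_bound (h : StripSeries ρ φ F) (hρ : 0 < ρ) (h1 : ‖F (toComplex ξ₀)‖ = 1) :
    ∃ δ B, 0 < δ ∧ δ ≤ ρ ∧ ∀ ζ, ‖ζ‖ < δ →
      F (ζ + toComplex ξ₀) / F (toComplex ξ₀) ∈ Complex.slitPlane ∧
        ‖remainder F ξ₀ α P ζ‖ ≤ B := by
  have hF0 : F (toComplex ξ₀) ≠ 0 := by
    intro h0
    rw [h0, norm_zero] at h1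
    exact zero_ne_one h1
  have hc1 : ContinuousAt (fun ζ => F (ζ + toComplex ξ₀) / F (toComplex ξ₀)) 0 := by
    refine ContinuousAt.div_const ?_ _
    have := h.continuousAt_toComplex hρ ξ₀
    refine ContinuousAt.comp_of_eq this (by fun_prop) (by simp)
  have hslit : F (0 + toComplex ξ₀) / F (toComplex ξ₀) ∈ Complex.slitPlane := by
    rw [zero_add, div_self hF0]
    exact Complex.one_mem_slitPlane
  have hc2 : ContinuousAt (remainder F ξ₀ α P) 0 := by
    unfold remainder
    have hlin : Continuous fun ζ : Fin d → ℂ => Complex.I * ∑ i, (α i : ℂ) * ζ i := by fun_prop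
    refine (hc1.clog hslit).sub (hlin.continuousAt.sub ?_)
    exact (MvPolynomial.continuous_eval P).continuousAt
  have hev := (hc1.eventually_mem (Complex.isOpen_slitPlane.mem_nhds hslit)).and
    (hc2.norm.eventually_lt continuousAt_const (lt_add_one _))
  obtain ⟨δ, hδ, hball⟩ := Metric.eventually_nhds_iff.1 hev
  refine ⟨min δ ρ, ‖remainder F ξ₀ α P 0‖ + 1, lt_min hδ hρ, min_le_right _ _, fun ζ hζ => ?_⟩
  have := hball (y := ζ) (by simpa using hζ.trans_le (min_le_left _ _))
  exact ⟨this.1, this.2.le⟩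

/-- Near a point of positive-homogeneous type, the Fourier transform is controlled on complex
arguments by the real part of the polynomial. -/
theorem exists_local_bound (h : StripSeries ρ φ F) (hρ : 0 < ρ) (h1 : ‖F (toComplex ξ₀)‖ = 1)
    (hP : IsPosHomTypeWith φ ξ₀ α P) :
    ∃ ε M r, 0 < ε ∧ 0 < M ∧ 0 < r ∧ r ≤ ρ ∧ ∀ ξ ν : Fin d → ℝ, ‖ξ‖ ≤ r → ‖ν‖ ≤ r →
      ‖F (cpoint (ξ + ξ₀) ν)‖ ≤
        Real.exp ((∑ i, α i * ν i) - ε * rePoly P ξ + M * rePoly P ν) := by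
  obtain ⟨hPh, hlo⟩ := hP
  obtain ⟨E, hE⟩ := hPh.1
  have hR := hPh.posHomFun (expSet_polyFun_subset P hE)
  set R := rePoly P with hRdef
  obtain ⟨ε, M, hε, hM, hcoer⟩ := hPh.exists_coercive
  obtain ⟨N, C, hC, hpow⟩ := hR.exists_pow_norm_le
  obtain ⟨c, K, hK, hc1, hlag⟩ := exists_lagrange_error N
  obtain ⟨δ, B, hδ, hδρ, hball⟩ := exists_remainder_bound (α := α) (P := P) h hρ h1
  choose D hD0 hD using fun j : ℕ => hR.map_add_smul_le (j : ℝ)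
  set T := ∑ j ∈ Finset.range (N + 1), ‖c j‖ * D j with hT
  have hT0 : 0 ≤ T := Finset.sum_nonneg fun j _ => mul_nonneg (norm_nonneg _) (hD0 j).le
  -- The little-o constant is chosen so that the N + 1 real samples of the remainder cost at most
  -- half of ε after extrapolation.
  set κ := ε / 2 / (T + 1) with hκ
  have hκ0 : 0 < κ := by positivity
  have hκT : κ * T ≤ ε / 2 := by
    rw [hκ, div_mul_eq_mul_div, div_le_iff₀ (by positivity)]
    gcongr
    linarith
  obtain ⟨δ₂, hδ₂, hsmall⟩ := Metric.eventually_nhds_iff.1 (hlo.bound hκ0)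
  have hB0 : 0 ≤ B := (norm_nonneg _).trans (hball 0 (by simpa using hδ)).2
  -- The three bounds serve, in order, to make the disc below large enough for the Lagrange error,
  -- to compare powers of ‖ν‖, and to put the points ξ + jν where the little-o estimate holds.
  set r := min (min (δ / (8 * ((N : ℝ) + 1))) 1) (δ₂ / (2 * ((N : ℝ) + 1))) with hr
  have hr0 : 0 < r := by positivity
  have hr1 : r ≤ 1 := (min_le_left _ _).trans (min_le_right _ _)
  have hN0 : (0 : ℝ) ≤ N := Nat.cast_nonneg N
  have hr2 : r * (8 * ((N : ℝ) + 1)) ≤ δ :=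
    (le_div_iff₀ (by positivity)).1 ((min_le_left _ _).trans (min_le_left _ _))
  have hr3 : r * (2 * ((N : ℝ) + 1)) ≤ δ₂ :=
    (le_div_iff₀ (by positivity)).1 (min_le_right _ _)
  have hr8 : 8 * r ≤ δ := by nlinarith
  have hreal : ∀ ξ ν : Fin d → ℝ, ‖ξ‖ ≤ r → ‖ν‖ ≤ r → ∀ j ∈ Finset.range (N + 1),
      ‖remainder F ξ₀ α P (toComplex (ξ + (j : ℝ) • ν))‖ ≤ κ * (D j * (R ξ + R ν)) := by
    intro ξ ν hξ hν j hj
    have hj' : (j : ℝ) ≤ N := by exact_mod_cast Nat.lt_succ_iff.1 (Finset.mem_range.1 hj)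
    have hn : ‖ξ + (j : ℝ) • ν‖ < δ₂ := by
      have e1 := norm_add_le ξ ((j : ℝ) • ν)
      rw [norm_smul, Real.norm_of_nonneg (Nat.cast_nonneg j)] at e1
      have e2 : (j : ℝ) * ‖ν‖ ≤ N * r := by gcongr
      nlinarith
    have e3 := hsmall (y := ξ + (j : ℝ) • ν) (by simpa using hn)
    rw [← remainder_toComplex h hρ.le, Real.norm_of_nonneg (hR.nonneg _)] at e3
    refine e3.trans ?_
    gcongr
    exact hD j ξ ν
  set M' := K * B * (2 / δ) ^ (N + 1) * C with hM'
  have hM'0 : 0 ≤ M' := by positivity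
  have hrem : ∀ ξ ν : Fin d → ℝ, ‖ξ‖ ≤ r → ‖ν‖ ≤ r →
      ‖remainder F ξ₀ α P (cpoint ξ ν)‖ ≤ ε / 2 * (R ξ + R ν) + M' * R ν := by
    intro ξ ν hξ hν
    have hξ0 := hR.nonneg ξ
    have hν0 := hR.nonneg ν
    set f : ℂ → ℂ := fun s => remainder F ξ₀ α P (toComplex ξ + s • toComplex ν) with hf
    have hmain : ‖∑ j ∈ Finset.range (N + 1), c j * f (j : ℂ)‖ ≤ ε / 2 * (R ξ + R ν) := by
      calc ‖∑ j ∈ Finset.range (N + 1), c j * f (j : ℂ)‖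
          ≤ ∑ j ∈ Finset.range (N + 1), ‖c j‖ * (κ * (D j * (R ξ + R ν))) := by
            refine (norm_sum_le _ _).trans (Finset.sum_le_sum fun j hj => ?_)
            rw [norm_mul]
            gcongr
            have := hreal ξ ν hξ hν j hj
            rw [toComplex_add_smul] at this
            simpa [hf] using this
        _ = κ * T * (R ξ + R ν) := by
            rw [hT, Finset.mul_sum, Finset.sum_mul]
            exact Finset.sum_congr rfl fun j _ => by ring
        _ ≤ _ := by gcongr
    have herr : ‖f (-Complex.I) - ∑ j ∈ Finset.range (N + 1), c j * f (j : ℂ)‖ ≤ M' * R ν := by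
      -- For ν = 0 the radius below would be infinite; f is then constant and the error vanishes
      -- because the weights sum to 1.
      by_cases hν' : ν = 0
      · have hconst : ∀ s, f s = f 0 := by
          intro s
          have : toComplex (0 : Fin d → ℝ) = 0 := by
            ext i
            simp [toComplex]
          simp [hf, hν', this]
        have hz : f (-Complex.I) - ∑ j ∈ Finset.range (N + 1), c j * f (j : ℂ) = 0 := by
          rw [hconst (-Complex.I), Finset.sum_congr rfl fun j _ => by rw [hconst j],
            ← Finset.sum_mul, hc1, one_mul, sub_self]
        rw [hz, norm_zero]
        positivity
      have hνpos : 0 < ‖ν‖ := norm_pos_iff.2 hν'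
      -- In this disc ξ + sν stays in the ball of radius δ. As 1/S is proportional to ‖ν‖, the error
      -- is of order ‖ν‖^(N+1), which R(ν) dominates.
      set S : ℝ := δ / (2 * ‖ν‖) with hS
      have hSν : S * ‖ν‖ = δ / 2 := by
        rw [hS]
        field_simp
      have hdom : ∀ s ∈ Metric.ball (0 : ℂ) S, ‖toComplex ξ + s • toComplex ν‖ < δ := by
        intro s hs
        rw [mem_ball_zero_iff] at hs
        have e1 := norm_add_le (toComplex ξ) (s • toComplex ν)
        rw [norm_smul] at e1
        have e2 : ‖s‖ * ‖toComplex ν‖ ≤ S * ‖ν‖ := by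
          gcongr
          exact norm_toComplex_le ν
        linarith [norm_toComplex_le ξ]
      have hSbig : 4 * ((N : ℝ) + 1) ≤ S := by
        rw [hS, le_div_iff₀ (by positivity)]
        calc 4 * ((N : ℝ) + 1) * (2 * ‖ν‖) = ‖ν‖ * (8 * ((N : ℝ) + 1)) := by ring
          _ ≤ r * (8 * ((N : ℝ) + 1)) := by gcongr
          _ ≤ δ := hr2
      have hfd : DifferentiableOn ℂ f (Metric.ball 0 S) := by
        have e1 := h.differentiableOn_line (toComplex ξ + toComplex ξ₀) (toComplex ν) (S := S)
          fun s hs => by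
            rw [add_right_comm]
            exact mem_strip_of_norm_le ((hdom s hs).le.trans hδρ) ξ₀
        have e2 : DifferentiableOn ℂ (fun s : ℂ =>
            F (toComplex ξ + s • toComplex ν + toComplex ξ₀)) (Metric.ball 0 S) :=
          e1.congr fun s _ => by rw [add_right_comm]
        have e3 : Differentiable ℂ fun s : ℂ =>
            Complex.I * ∑ i, (α i : ℂ) * (toComplex ξ + s • toComplex ν) i := by
          simp only [Pi.add_apply, Pi.smul_apply, smul_eq_mul]
          fun_prop
        have e4 : Differentiable ℂ fun s : ℂ =>
            MvPolynomial.eval (toComplex ξ + s • toComplex ν) P := by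
          obtain ⟨p, -, hp⟩ := exists_line_polynomial P (toComplex ξ) (toComplex ν)
          simp only [← hp]
          exact p.differentiable
        exact ((e2.div_const _).clog fun s hs => (hball _ (hdom s hs)).1).sub
          (e3.sub e4).differentiableOn
      have e5 := hlag f S B hSbig hfd fun s hs => (hball _ (hdom s hs)).2
      refine e5.trans ?_
      have e6 : 1 / S = 2 / δ * ‖ν‖ := by
        rw [hS]
        field_simp
      have e7 : ‖ν‖ ^ (N + 1) ≤ C * R ν :=
        (pow_le_pow_of_le_one (norm_nonneg _) (hν.trans hr1) (Nat.le_succ N)).trans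
          (hpow ν (hν.trans hr1))
      rw [e6, mul_pow]
      calc K * B * ((2 / δ) ^ (N + 1) * ‖ν‖ ^ (N + 1))
          ≤ K * B * ((2 / δ) ^ (N + 1) * (C * R ν)) := by gcongr
        _ = M' * R ν := by rw [hM']; ring
    rw [cpoint_eq]
    have := norm_add_le (f (-Complex.I) - ∑ j ∈ Finset.range (N + 1), c j * f (j : ℂ))
      (∑ j ∈ Finset.range (N + 1), c j * f (j : ℂ))
    rw [sub_add_cancel] at this
    linarith
  refine ⟨ε / 2, M + ε / 2 + M', r, by positivity, by positivity, hr0, by linarith, ?_⟩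
  intro ξ ν hξ hν
  have hζ : ‖cpoint ξ ν‖ < δ := by
    rw [cpoint_eq]
    have e1 := norm_add_le (toComplex ξ) ((-Complex.I) • toComplex ν)
    rw [norm_smul, norm_neg, Complex.norm_I, one_mul] at e1
    linarith [norm_toComplex_le ξ, norm_toComplex_le ν]
  have hadd : cpoint (ξ + ξ₀) ν = cpoint ξ ν + toComplex ξ₀ := by
    rw [cpoint_eq, cpoint_eq, toComplex_add]
    abel
  have hslit := (hball _ hζ).1
  have hne := Complex.slitPlane_ne_zero hslit
  have hnorm : ‖F (cpoint (ξ + ξ₀) ν)‖ = Real.exp (Complex.log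
      (F (cpoint ξ ν + toComplex ξ₀) / F (toComplex ξ₀))).re := by
    rw [← Complex.norm_exp, Complex.exp_log hne, norm_div, h1, div_one, hadd]
  rw [hnorm]
  refine Real.exp_le_exp.2 ?_
  have hlog : Complex.log (F (cpoint ξ ν + toComplex ξ₀) / F (toComplex ξ₀)) =
      remainder F ξ₀ α P (cpoint ξ ν) +
        (Complex.I * (∑ i, (α i : ℂ) * cpoint ξ ν i) - MvPolynomial.eval (cpoint ξ ν) P) := by
    rw [remainder]
    ring
  have hlin : (Complex.I * (∑ i, (α i : ℂ) * cpoint ξ ν i)).re = ∑ i, α i * ν i := by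
    simp [cpoint]
  rw [hlog, Complex.add_re, Complex.sub_re, hlin]
  have e1 := (Complex.re_le_norm _).trans (hrem ξ ν hξ hν)
  have e2 := hcoer ξ ν
  linarith

end Local

end ConvPow

/-! ### An analytic partition of unity from binomial tails -/

namespace ConvPow

variable {d : ℕ}

/-- The part of the binomial expansion of `(z + (1 - z))^n` with the larger powers of `z`: a
polynomial version of the indicator function of a neighborhood of `1`. -/
def upperBinomial (n : ℕ) (z : ℂ) : ℂ :=
  ∑ j ∈ (Finset.range (n + 1)).filter (fun j => n ≤ 2 * j),
    z ^ j * (1 - z) ^ (n - j) * (n.choose j : ℂ)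

theorem one_sub_upperBinomial (n : ℕ) (z : ℂ) : 1 - upperBinomial n z =
    ∑ j ∈ (Finset.range (n + 1)).filter (fun j => ¬ n ≤ 2 * j),
      z ^ j * (1 - z) ^ (n - j) * (n.choose j : ℂ) := by
  have h := add_pow z (1 - z) n
  rw [add_sub_cancel, one_pow, ← Finset.sum_filter_add_sum_filter_not _ (fun j => n ≤ 2 * j)] at h
  rw [sub_eq_iff_eq_add', upperBinomial]
  exact h

/-- A Chernoff bound: weights u^j v^(n-j) that are at least 1 on the retained indices are inserted,
and the sum is completed to a full binomial. -/
theorem norm_sum_binomial_le (n : ℕ) (s : Finset ℕ) (hs : s ⊆ Finset.range (n + 1)) (z : ℂ)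
    {u v : ℝ} (hu : 0 ≤ u) (hv : 0 ≤ v) (huv : ∀ j ∈ s, 1 ≤ u ^ j * v ^ (n - j)) :
    ‖∑ j ∈ s, z ^ j * (1 - z) ^ (n - j) * (n.choose j : ℂ)‖ ≤ (u * ‖z‖ + v * ‖1 - z‖) ^ n := by
  rw [add_pow]
  calc ‖∑ j ∈ s, z ^ j * (1 - z) ^ (n - j) * (n.choose j : ℂ)‖
      ≤ ∑ j ∈ s, (u * ‖z‖) ^ j * (v * ‖1 - z‖) ^ (n - j) * (n.choose j : ℝ) := by
        refine (norm_sum_le _ _).trans (Finset.sum_le_sum fun j hj => ?_)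
        rw [norm_mul, norm_mul, norm_pow, norm_pow, Complex.norm_natCast, mul_pow, mul_pow]
        refine mul_le_mul_of_nonneg_right ?_ (Nat.cast_nonneg _)
        calc ‖z‖ ^ j * ‖1 - z‖ ^ (n - j) = 1 * (‖z‖ ^ j * ‖1 - z‖ ^ (n - j)) := (one_mul _).symm
          _ ≤ (u ^ j * v ^ (n - j)) * (‖z‖ ^ j * ‖1 - z‖ ^ (n - j)) := by
            gcongr
            exact huv j hj
          _ = _ := by ring
    _ ≤ _ := Finset.sum_le_sum_of_subset_of_nonneg hs fun j _ _ => by positivity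

theorem norm_upperBinomial_le (n : ℕ) (z : ℂ) {l : ℝ} (hl : 1 ≤ l) :
    ‖upperBinomial n z‖ ≤ (l * ‖z‖ + l⁻¹ * ‖1 - z‖) ^ n := by
  have hl0 : 0 < l := by linarith
  refine norm_sum_binomial_le n _ (Finset.filter_subset _ _) z hl0.le (by positivity)
    fun j hj => ?_
  have hj2 := (Finset.mem_filter.1 hj).2
  rw [inv_pow, ← div_eq_mul_inv, one_le_div (by positivity)]
  exact pow_le_pow_right₀ hl (by omega)

theorem norm_one_sub_upperBinomial_le (n : ℕ) (z : ℂ) {l : ℝ} (hl : 1 ≤ l) :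
    ‖1 - upperBinomial n z‖ ≤ (l⁻¹ * ‖z‖ + l * ‖1 - z‖) ^ n := by
  have hl0 : 0 < l := by linarith
  rw [one_sub_upperBinomial]
  refine norm_sum_binomial_le n _ (Finset.filter_subset _ _) z (by positivity) hl0.le
    fun j hj => ?_
  have hj2 := (Finset.mem_filter.1 hj).2
  rw [inv_pow, ← div_eq_inv_mul, one_le_div (by positivity)]
  exact pow_le_pow_right₀ hl (by omega)

theorem IsStripFun.const_mul {ρ : ℝ} (hρ : 0 ≤ ρ) {F : (Fin d → ℂ) → ℂ} (hF : IsStripFun ρ F)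
    (c : ℂ) : IsStripFun ρ fun ζ => c * F ζ :=
  (IsStripFun.const ρ c).mul hρ hF

theorem IsStripFun.one_sub {ρ : ℝ} (hρ : 0 ≤ ρ) {F : (Fin d → ℂ) → ℂ} (hF : IsStripFun ρ F) :
    IsStripFun ρ fun ζ => 1 - F ζ := by
  have := (IsStripFun.const ρ 1).add (hF.const_mul hρ (-1))
  convert! this using 2 with ζ
  simp [sub_eq_add_neg]

theorem IsStripFun.upperBinomial {ρ : ℝ} (hρ : 0 ≤ ρ) {q : (Fin d → ℂ) → ℂ}
    (hq : IsStripFun ρ q) (n : ℕ) : IsStripFun ρ fun ζ => upperBinomial n (q ζ) := by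
  have := IsStripFun.sum ((Finset.range (n + 1)).filter (fun j => n ≤ 2 * j)) (ρ := ρ)
    (F := fun j => (q ^ j * (fun ζ => 1 - q ζ) ^ (n - j)) * fun _ => (n.choose j : ℂ))
    fun j _ => ((hq.pow hρ j).mul hρ ((hq.one_sub hρ).pow hρ (n - j))).mul hρ
      (IsStripFun.const ρ _)
  convert! this using 2 with ζ
  simp [ConvPow.upperBinomial]

/-- A nonnegative trigonometric polynomial, as a function on `ℂ^d`, with maximum `1` at the
translates of `a` by the dual lattice. -/
noncomputable def bump (a : Fin d → ℝ) (ζ : Fin d → ℂ) : ℂ :=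
  ∏ i, (1 + Complex.cos (ζ i - a i)) / 2

theorem isStripFun_bump {ρ : ℝ} (hρ : 0 ≤ ρ) (a : Fin d → ℝ) : IsStripFun ρ (bump a) := by
  have h : ∀ i : Fin d, IsStripFun ρ fun ζ : Fin d → ℂ => (1 + Complex.cos (ζ i - a i)) / 2 := by
    intro i
    have h1 := ((IsStripFun.character ρ (Pi.single i 1)).const_mul hρ
      (Complex.exp (-(a i * Complex.I)) / 4)).add
      ((IsStripFun.character ρ (-Pi.single i 1)).const_mul hρ (Complex.exp (a i * Complex.I) / 4))
    have h2 := (IsStripFun.const ρ (1 / 2)).add h1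
    convert! h2 using 2 with ζ
    have e1 : character (Pi.single i 1) ζ = Complex.exp (ζ i * Complex.I) := by
      rw [character, Finset.sum_eq_single i]
      · simp [mul_comm]
      · intro j _ hj
        simp [hj]
      · simp
    have e2 : character (-Pi.single i 1) ζ = Complex.exp (-(ζ i * Complex.I)) := by
      rw [character, Finset.sum_eq_single i]
      · simp [mul_comm]
      · intro j _ hj
        simp [hj]
      · simp
    simp only [Pi.add_apply, e1, e2, Complex.cos]
    rw [div_mul_eq_mul_div, ← Complex.exp_add, div_mul_eq_mul_div, ← Complex.exp_add]
    rw [show (ζ i - a i) * Complex.I = -(a i * Complex.I) + ζ i * Complex.I by ring,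
      show -(ζ i - a i) * Complex.I = a i * Complex.I + -(ζ i * Complex.I) by ring]
    ring
  have := IsStripFun.prod hρ Finset.univ (fun i _ => h i)
  convert! this using 1
  ext ζ
  simp [bump]

theorem continuous_bump (a : Fin d → ℝ) : Continuous (bump a) := by
  unfold bump
  fun_prop

theorem bump_toComplex (a ξ : Fin d → ℝ) :
    bump a (toComplex ξ) = ((∏ i, (1 + Real.cos (ξ i - a i)) / 2 : ℝ) : ℂ) := by
  simp [bump, toComplex]

theorem half_one_add_cos_mem (t : ℝ) : 0 ≤ (1 + Real.cos t) / 2 ∧ (1 + Real.cos t) / 2 ≤ 1 := by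
  constructor <;> linarith [Real.neg_one_le_cos t, Real.cos_le_one t]

theorem bump_mem_Icc (a ξ : Fin d → ℝ) : ∃ b : ℝ, 0 ≤ b ∧ b ≤ 1 ∧ bump a (toComplex ξ) = b :=
  ⟨_, Finset.prod_nonneg fun _ _ => (half_one_add_cos_mem _).1,
    Finset.prod_le_one (fun _ _ => (half_one_add_cos_mem _).1) fun _ _ =>
      (half_one_add_cos_mem _).2, bump_toComplex a ξ⟩

theorem bump_add_period (a ξ : Fin d → ℝ) (m : Fin d → ℤ) :
    bump a (toComplex (ξ + period m)) = bump a (toComplex ξ) := by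
  rw [bump_toComplex, bump_toComplex]
  congr 1
  refine Finset.prod_congr rfl fun i _ => ?_
  have : (ξ + period m) i - a i = ξ i - a i + m i * (2 * Real.pi) := by
    simp only [Pi.add_apply, period]
    ring
  rw [this, Real.cos_add_int_mul_two_pi]

theorem bump_self (a : Fin d → ℝ) : bump a (toComplex a) = 1 := by
  simp [bump, toComplex]

theorem norm_bump_lt_one {a ξ : Fin d → ℝ} (h : ∀ m, ξ ≠ a + period m) :
    ‖bump a (toComplex ξ)‖ < 1 := by
  have hex : ∃ i, Real.cos (ξ i - a i) ≠ 1 := by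
    by_contra! hcon
    choose m hm using fun i => (Real.cos_eq_one_iff _).1 (hcon i)
    refine h m ?_
    ext i
    simp only [Pi.add_apply, period]
    linarith [hm i]
  obtain ⟨i, hi⟩ := hex
  rw [bump_toComplex, Complex.norm_real, Real.norm_of_nonneg
    (Finset.prod_nonneg fun i _ => (half_one_add_cos_mem _).1),
    ← Finset.mul_prod_erase _ _ (Finset.mem_univ i)]
  have h1 : (1 + Real.cos (ξ i - a i)) / 2 < 1 := by
    have := lt_of_le_of_ne (Real.cos_le_one _) hi
    linarith
  have h2 : ∏ j ∈ Finset.univ.erase i, (1 + Real.cos (ξ j - a j)) / 2 ≤ 1 :=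
    Finset.prod_le_one (fun i _ => (half_one_add_cos_mem _).1) fun i _ =>
      (half_one_add_cos_mem _).2
  have h3 : 0 ≤ ∏ j ∈ Finset.univ.erase i, (1 + Real.cos (ξ j - a j)) / 2 :=
    Finset.prod_nonneg fun i _ => (half_one_add_cos_mem _).1
  have h4 := (half_one_add_cos_mem (ξ i - a i)).1
  nlinarith

/-- A high power of `bump a` is used. The threshold 1/16 is small enough for 4b + (1 - b)/4 < 1,
which makes the binomial tail with parameter 4 exponentially small. -/
theorem exists_sharp_bump {ρ : ℝ} (hρ : 0 ≤ ρ) (a : Fin d → ℝ) (S : Finset (Fin d → ℝ))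
    (hS : ∀ s ∈ S, ∀ m, s ≠ a + period m) :
    ∃ q : (Fin d → ℂ) → ℂ, IsStripFun ρ q ∧ Continuous q ∧
      (∀ ξ, ∃ b : ℝ, 0 ≤ b ∧ b ≤ 1 ∧ q (toComplex ξ) = b) ∧
      (∀ m, q (toComplex (a + period m)) = 1) ∧
      ∀ s ∈ S, ∀ m, ‖q (toComplex (s + period m))‖ ≤ 1 / 16 := by
  have hk : ∃ k : ℕ, ∀ s ∈ S, ‖bump a (toComplex s)‖ ^ k ≤ 1 / 16 := by
    choose! k hk using fun s hs => exists_pow_lt_of_lt_one (by norm_num : (0 : ℝ) < 1 / 16)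
      (norm_bump_lt_one (hS s hs))
    refine ⟨S.sup k, fun s hs => ?_⟩
    exact (pow_le_pow_of_le_one (norm_nonneg _) (norm_bump_lt_one (hS s hs)).le
      (Finset.le_sup hs)).trans (hk s hs).le
  obtain ⟨k, hk⟩ := hk
  refine ⟨bump a ^ k, (isStripFun_bump hρ a).pow hρ k, (continuous_bump a).pow k, fun ξ => ?_,
    fun m => ?_, fun s hs m => ?_⟩
  · obtain ⟨b, hb0, hb1, hb⟩ := bump_mem_Icc a ξ
    exact ⟨b ^ k, by positivity, pow_le_one₀ hb0 hb1, by simp [hb]⟩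
  · simp [bump_add_period, bump_self]
  · rw [Pi.pow_apply, norm_pow, bump_add_period]
    exact hk s hs

theorem pow_le_min_pow {c x y : ℝ} {n : ℕ} (h1 : c ≤ x ^ n) (h2 : c ≤ y ^ n) :
    c ≤ (min x y) ^ n := by
  rcases le_total x y with h | h
  · rwa [min_eq_left h]
  · rwa [min_eq_right h]

/-- Multipliers localized at the points of `S`: the family `m` is a partition of unity, depending
on a parameter `n`, and `m s n` is exponentially small in `n` at the other points. -/
theorem exists_partition {ρ : ℝ} (hρ : 0 ≤ ρ) (S : Finset (Fin d → ℝ)) (hne : S.Nonempty)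
    (hS : ∀ s ∈ S, ∀ t ∈ S, s ≠ t → ∀ m, s ≠ t + period m) :
    ∃ (p : (Fin d → ℝ) → ℕ → (Fin d → ℂ) → ℂ) (g : (Fin d → ℝ) → (Fin d → ℂ) → ℝ),
      (∀ n ζ, ∑ s ∈ S, p s n ζ = 1) ∧ ∀ s ∈ S, (∀ n, IsStripFun ρ (p s n)) ∧ Continuous (g s) ∧
        (∀ n ζ, ‖p s n ζ‖ ≤ g s ζ ^ n) ∧ (∀ ζ, 0 ≤ g s ζ) ∧ (∀ ξ, g s (toComplex ξ) ≤ 1) ∧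
        (∀ t ∈ S, t ≠ s → ∀ m, g s (toComplex (t + period m)) < 1) ∧
        ∃ r C, 0 < r ∧ ∀ n ζ, dist ζ (toComplex s) < r → ‖p s n ζ‖ ≤ C := by
  -- Points are added one at a time: the new point a takes the upper binomial tail of q, and all
  -- earlier multipliers are multiplied by the complementary tail.
  induction hne using Finset.Nonempty.cons_induction with
  | singleton a =>
    refine ⟨fun _ _ _ => 1, fun _ _ => 1, by simp, fun s hs => ⟨fun n => IsStripFun.const ρ 1,
      continuous_const, by simp, by simp, by simp, ?_, 1, 1, one_pos, by simp⟩⟩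
    intro t ht hts
    rw [Finset.mem_singleton] at hs ht
    exact absurd (ht.trans hs.symm) hts
  | cons a S ha hne ih =>
    obtain ⟨p, g, hsum, hpg⟩ := ih fun s hs t ht => hS s (by simp [hs]) t (by simp [ht])
    have haS : ∀ s ∈ S, s ≠ a := fun s hs h => ha (h ▸ hs)
    obtain ⟨q, hq, hqc, hqr, hqa, hqS⟩ := exists_sharp_bump hρ a S fun s hs =>
      hS s (by simp [hs]) a (by simp) (haS s hs)
    -- Parameter 1 gives a bound by 1 at every real point; parameter 4 gives a strict inequality
    -- where q is near 0, and for G' where q is near 1.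
    set G : (Fin d → ℂ) → ℝ := fun ζ =>
      min (1 * ‖q ζ‖ + 1⁻¹ * ‖1 - q ζ‖) (4 * ‖q ζ‖ + 4⁻¹ * ‖1 - q ζ‖) with hG
    set G' : (Fin d → ℂ) → ℝ := fun ζ =>
      min (1⁻¹ * ‖q ζ‖ + 1 * ‖1 - q ζ‖) (4⁻¹ * ‖q ζ‖ + 4 * ‖1 - q ζ‖) with hG'
    have hGc : Continuous G := by fun_prop
    have hGc' : Continuous G' := by fun_prop
    have hG0 : ∀ ζ, 0 ≤ G ζ := fun ζ => le_min (by positivity) (by positivity)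
    have hG0' : ∀ ζ, 0 ≤ G' ζ := fun ζ => le_min (by positivity) (by positivity)
    have hb : ∀ n ζ, ‖upperBinomial n (q ζ)‖ ≤ G ζ ^ n := fun n ζ =>
      pow_le_min_pow (norm_upperBinomial_le n _ le_rfl) (norm_upperBinomial_le n _ (by norm_num))
    have hb' : ∀ n ζ, ‖1 - upperBinomial n (q ζ)‖ ≤ G' ζ ^ n := fun n ζ =>
      pow_le_min_pow (norm_one_sub_upperBinomial_le n _ le_rfl)
        (norm_one_sub_upperBinomial_le n _ (by norm_num))
    have hreal : ∀ ξ, ‖q (toComplex ξ)‖ + ‖1 - q (toComplex ξ)‖ = 1 := by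
      intro ξ
      obtain ⟨b, hb0, hb1, hbq⟩ := hqr ξ
      rw [hbq, ← Complex.ofReal_one, ← Complex.ofReal_sub, Complex.norm_real, Complex.norm_real,
        Real.norm_of_nonneg hb0, Real.norm_of_nonneg (by linarith)]
      ring
    have hGr : ∀ ξ, G (toComplex ξ) ≤ 1 := fun ξ =>
      (min_le_left _ _).trans (by rw [inv_one, one_mul, one_mul, hreal])
    have hGr' : ∀ ξ, G' (toComplex ξ) ≤ 1 := fun ξ =>
      (min_le_left _ _).trans (by rw [inv_one, one_mul, one_mul, hreal])
    have hGS : ∀ s ∈ S, ∀ m, G (toComplex (s + period m)) < 1 := by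
      intro s hs m
      refine (min_le_right _ _).trans_lt ?_
      have h1 := hqS s hs m
      have h2 := hreal (s + period m)
      have h3 := norm_nonneg (q (toComplex (s + period m)))
      linarith
    have hGa' : ∀ m, G' (toComplex (a + period m)) < 1 := by
      intro m
      refine (min_le_right _ _).trans_lt ?_
      rw [hqa]
      norm_num
    classical
    refine ⟨fun s n ζ => if s = a then upperBinomial n (q ζ)
        else (1 - upperBinomial n (q ζ)) * p s n ζ,
      fun s ζ => if s = a then G ζ else G' ζ * g s ζ, fun n ζ => ?_, fun s hs => ?_⟩
    · beta_reduce
      rw [Finset.sum_cons, if_pos rfl, Finset.sum_congr rfl fun s hs => if_neg (haS s hs),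
        ← Finset.mul_sum, hsum]
      ring
    · rw [Finset.mem_cons] at hs
      rcases hs with rfl | hs
      · simp only [if_true]
        refine ⟨hq.upperBinomial hρ, hGc, hb, hG0, hGr, fun t ht hts m => ?_, ?_⟩
        · rw [Finset.mem_cons] at ht
          exact hGS t (ht.resolve_left hts) m
        -- Near a the bound G may exceed 1 off the real points, but the complementary tail is at
        -- most 1 there, so the tail itself is at most 2.
        · have h1 := hGa' 0
          rw [period_zero, add_zero] at h1
          obtain ⟨r, hr, hball⟩ := Metric.eventually_nhds_iff.1
            (hGc'.continuousAt.eventually_lt continuousAt_const h1)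
          refine ⟨r, 2, hr, fun n ζ hζ => ?_⟩
          have h2 := (hb' n ζ).trans (pow_le_one₀ (hG0' ζ) (hball hζ).le)
          have h3 := norm_sub_le (1 : ℂ) (1 - upperBinomial n (q ζ))
          rw [sub_sub_cancel, norm_one] at h3
          linarith
      · simp only [if_neg (haS s hs)]
        obtain ⟨h1, h2, h3, h4, h5, h6, r, C, hr, h7⟩ := hpg s hs
        refine ⟨fun n => ((hq.upperBinomial hρ n).one_sub hρ).mul hρ (h1 n), hGc'.mul h2,
          fun n ζ => ?_, fun ζ => mul_nonneg (hG0' ζ) (h4 ζ),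
          fun ξ => mul_le_one₀ (hGr' ξ) (h4 _) (h5 ξ), fun t ht hts m => ?_, ?_⟩
        · rw [norm_mul, mul_pow]
          exact mul_le_mul (hb' n ζ) (h3 n ζ) (norm_nonneg _) (pow_nonneg (hG0' ζ) n)
        · rw [Finset.mem_cons] at ht
          rcases ht with rfl | ht
          · have e1 := hGa' m
            have e2 := h5 (t + period m)
            have e3 := h4 (toComplex (t + period m))
            have e4 := hG0' (toComplex (t + period m))
            nlinarith
          · have e1 := hGr' (t + period m)
            have e2 := h6 t ht hts m
            have e3 := h4 (toComplex (t + period m))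
            have e4 := hG0' (toComplex (t + period m))
            nlinarith
        · have e1 := hGS s hs 0
          rw [period_zero, add_zero] at e1
          obtain ⟨r', hr', hball⟩ := Metric.eventually_nhds_iff.1
            (hGc.continuousAt.eventually_lt continuousAt_const e1)
          refine ⟨min r r', 2 * C, lt_min hr hr', fun n ζ hζ => ?_⟩
          have e2 := (hb n ζ).trans (pow_le_one₀ (hG0 ζ)
            (hball (hζ.trans_le (min_le_right _ _))).le)
          have e3 := norm_sub_le (1 : ℂ) (upperBinomial n (q ζ))
          rw [norm_one] at e3
          have e4 := h7 n ζ (hζ.trans_le (min_le_left _ _))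
          rw [norm_mul]
          exact mul_le_mul (by linarith) e4 (norm_nonneg _) two_pos.le

end ConvPow

/-! ### The points where the Fourier transform has modulus 1 -/

namespace ConvPow

open MeasureTheory

variable {d : ℕ}

theorem norm_apply_le_latticeNorm (x : Fin d → ℤ) (i : Fin d) : |(x i : ℝ)| ≤ latticeNorm x := by
  refine Real.abs_le_sqrt ?_
  exact Finset.single_le_sum (f := fun i => (x i : ℝ) ^ 2) (fun _ _ => sq_nonneg _)
    (Finset.mem_univ i)

theorem latticeNorm_le_oneNorm (x : Fin d → ℤ) : latticeNorm x ≤ oneNorm x := by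
  refine Real.sqrt_le_iff.2 ⟨oneNorm_nonneg x, ?_⟩
  have := Finset.sum_sq_le_sq_sum_of_nonneg (s := Finset.univ) (f := fun i => |(x i : ℝ)|)
    fun _ _ => abs_nonneg _
  simpa [oneNorm] using this

theorem eq_zero_of_abs_period_lt {m : Fin d → ℤ} (h : ∀ i, |period m i| < 2 * Real.pi) :
    m = 0 := by
  ext i
  have h1 := h i
  rw [period, abs_mul, abs_of_pos Real.two_pi_pos] at h1
  have h2 : |(m i : ℝ)| < 1 := by
    have := Real.two_pi_pos
    by_contra! hc
    nlinarith
  exact Int.abs_lt_one_iff.1 (by exact_mod_cast h2)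

theorem torus_ne_add_period {s t : Fin d → ℝ} (hs : s ∈ torus d) (ht : t ∈ torus d) (hst : s ≠ t)
    (m : Fin d → ℤ) : s ≠ t + period m := by
  rintro h
  have hm : m = 0 := eq_zero_of_abs_period_lt fun i => by
    have e : period m i = s i - t i := by rw [h]; simp
    have h1 := hs i trivial
    have h2 := ht i trivial
    rw [e, abs_lt]
    constructor <;> linarith [h1.1, h1.2, h2.1, h2.2]
  rw [hm, period_zero, add_zero] at h
  exact hst h

theorem norm_fourier_le_one {φ : (Fin d → ℤ) → ℂ} (hφ : MemHStar φ) (ξ : Fin d → ℝ) :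
    ‖fourier φ ξ‖ ≤ 1 := by
  obtain ⟨m, hm⟩ := exists_add_period_mem_torus ξ
  rw [← fourier_add_period φ ξ m]
  exact hφ.2.1 ⟨_, hm, rfl⟩

namespace StripSeries

variable {ρ : ℝ} {φ ψ χ : (Fin d → ℤ) → ℂ} {F G : (Fin d → ℂ) → ℂ}

theorem unique (h : StripSeries ρ ψ F) (h' : StripSeries ρ χ F) (hρ : 0 ≤ ρ) : ψ = χ := by
  ext x
  have h1 := h.coeff_eq 0 (ν := 0) (by simpa using hρ) x
  rw [h'.coeff_eq 0 (ν := 0) (by simpa using hρ) x] at h1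
  have hpi : (2 * (Real.pi : ℂ)) ^ d ≠ 0 := by
    have : (Real.pi : ℂ) ≠ 0 := by exact_mod_cast Real.pi_ne_zero
    exact pow_ne_zero _ (mul_ne_zero two_ne_zero this)
  simpa [hpi] using h1.symm

theorem sum {ι : Type*} (s : Finset ι) {ψ : ι → (Fin d → ℤ) → ℂ} {F : ι → (Fin d → ℂ) → ℂ}
    (h : ∀ i ∈ s, StripSeries ρ (ψ i) (F i)) : StripSeries ρ (∑ i ∈ s, ψ i) (∑ i ∈ s, F i) := by
  classical
  induction s using Finset.induction_on with
  | empty =>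
    have := single (d := d) ρ 0 0
    simp only [Pi.single_zero, zero_mul] at this
    exact this
  | insert a s ha ih =>
    rw [Finset.sum_insert ha, Finset.sum_insert ha]
    exact (h a (by simp)).add (ih fun i hi => h i (by simp [hi]))

theorem continuous_fourier (h : StripSeries ρ φ F) (hρ : 0 ≤ ρ) : Continuous (fourier φ) := by
  have : Continuous fun ξ => F (toComplex ξ) :=
    h.continuousOn.comp_continuous continuous_toComplex fun ξ => toComplex_mem_strip hρ ξ
  simpa only [h.eq_fourier hρ] using this

/-- At ν = 0 the local bound reads exp(-εR(ξ - ξ₀)), which is below 1 unless ξ = ξ₀. -/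
theorem exists_isolated (h : StripSeries ρ φ F) (hρ : 0 < ρ) {ξ₀ α : Fin d → ℝ}
    {P : MvPolynomial (Fin d) ℂ} (hξ₀ : ξ₀ ∈ Omega φ) (hP : IsPosHomTypeWith φ ξ₀ α P) :
    ∃ r, 0 < r ∧ ∀ ξ, dist ξ ξ₀ < r → ‖fourier φ ξ‖ = 1 → ξ = ξ₀ := by
  obtain ⟨ε, M, r, hε, hM, hr, hrρ, hloc⟩ := exists_local_bound h hρ
    (by rw [h.eq_fourier hρ.le]; exact hξ₀.2) hP
  refine ⟨r, hr, fun ξ hξ h1 => ?_⟩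
  by_contra hne
  have hR : 0 < rePoly P (ξ - ξ₀) := by
    have := hP.1.2 (ξ - ξ₀)
    exact lt_of_le_of_ne this.1 fun h0 => hne (sub_eq_zero.1 (this.2 h0.symm))
  have hR0 : rePoly P 0 = 0 := by
    obtain ⟨E, hE⟩ := hP.1.1
    exact (hP.1.posHomFun (expSet_polyFun_subset P hE)).map_zero
  have := hloc (ξ - ξ₀) 0 (by rw [← dist_eq_norm]; exact hξ.le) (by simpa using hr.le)
  rw [sub_add_cancel, cpoint_zero, h.eq_fourier hρ.le, h1, hR0] at this
  simp only [Pi.zero_apply, mul_zero, Finset.sum_const_zero, zero_sub, add_zero] at this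
  have h2 : Real.exp (-(ε * rePoly P (ξ - ξ₀))) < 1 := Real.exp_lt_one_iff.2 (by
    have := mul_pos hε hR
    linarith)
  linarith

end StripSeries

theorem StripSeries.finite_Omega {ρ : ℝ} {φ : (Fin d → ℤ) → ℂ} {F : (Fin d → ℂ) → ℂ}
    (h : StripSeries ρ φ F) (hρ : 0 < ρ) {α : (Fin d → ℝ) → (Fin d → ℝ)}
    {P : (Fin d → ℝ) → MvPolynomial (Fin d) ℂ}
    (hP : ∀ ξ ∈ Omega φ, IsPosHomTypeWith φ ξ (α ξ) (P ξ)) : (Omega φ).Finite := by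
  have hcl : IsClosed {ξ | ‖fourier φ ξ‖ = 1} :=
    isClosed_eq (h.continuous_fourier hρ.le).norm continuous_const
  have hfin : ({ξ | ‖fourier φ ξ‖ = 1} ∩ Metric.closedBall (0 : Fin d → ℝ) Real.pi).Finite := by
    refine (isCompact_closedBall (0 : Fin d → ℝ) Real.pi).induction_on
      (p := fun s => ({ξ | ‖fourier φ ξ‖ = 1} ∩ s).Finite) (by simp)
      (fun s t hst ht => ht.subset (Set.inter_subset_inter_right _ hst))
      (fun s t hs ht => by rw [Set.inter_union_distrib_left]; exact hs.union ht) fun ξ₀ _ => ?_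
    by_cases h1 : ‖fourier φ ξ₀‖ = 1
    · obtain ⟨m, hm⟩ := exists_add_period_mem_torus ξ₀
      have hΩ : ξ₀ + period m ∈ Omega φ := ⟨hm, by rw [fourier_add_period, h1]⟩
      obtain ⟨r, hr, hiso⟩ := h.exists_isolated hρ hΩ (hP _ hΩ)
      refine ⟨Metric.ball ξ₀ r, mem_nhdsWithin_of_mem_nhds (Metric.ball_mem_nhds _ hr),
        (Set.finite_singleton ξ₀).subset ?_⟩
      rintro ξ ⟨hξ1, hξ2⟩
      have := hiso (ξ + period m) (by rw [dist_add_right]; exact hξ2)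
        (by rw [fourier_add_period]; exact hξ1)
      exact add_right_cancel this
    · refine ⟨{ξ | ‖fourier φ ξ‖ = 1}ᶜ, mem_nhdsWithin_of_mem_nhds (hcl.isOpen_compl.mem_nhds h1),
        ?_⟩
      simp
  exact hfin.subset fun ξ hξ => ⟨hξ.2, torus_subset_closedBall hξ.1⟩

/-- The maximum is attained on the closed cube and carried back into the torus by a period. -/
theorem StripSeries.nonempty_Omega {ρ : ℝ} {φ : (Fin d → ℤ) → ℂ} {F : (Fin d → ℂ) → ℂ}
    (h : StripSeries ρ φ F) (hρ : 0 < ρ) (hφ : MemHStar φ) : (Omega φ).Nonempty := by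
  obtain ⟨ξ, -, hmax⟩ := (isCompact_closedBall (0 : Fin d → ℝ) Real.pi).exists_isMaxOn
    ⟨0, by simpa using Real.pi_pos.le⟩ (h.continuous_fourier hρ.le).norm.continuousOn
  have h1 : 1 ≤ ‖fourier φ ξ‖ := by
    refine hφ.2.2 ?_
    rintro _ ⟨η, hη, rfl⟩
    exact hmax (torus_subset_closedBall hη)
  obtain ⟨m, hm⟩ := exists_add_period_mem_torus ξ
  exact ⟨_, hm, by rw [fourier_add_period]; exact le_antisymm (norm_fourier_le_one hφ ξ) h1⟩

/-- A strict bound on a compact set of real points persists for small imaginary parts. -/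
theorem exists_uniform_bound {ρ : ℝ} (hρ : 0 < ρ) {G : (Fin d → ℂ) → ℝ}
    (hG : ContinuousOn G (strip d ρ)) {K : Set (Fin d → ℝ)} (hK : IsCompact K)
    (h1 : ∀ ξ ∈ K, G (toComplex ξ) < 1) :
    ∃ r c, 0 < r ∧ r ≤ ρ ∧ 0 < c ∧ c < 1 ∧ ∀ ξ ∈ K, ∀ ν, ‖ν‖ ≤ r → G (cpoint ξ ν) ≤ c := by
  refine hK.induction_on (p := fun K => ∃ r c, 0 < r ∧ r ≤ ρ ∧ 0 < c ∧ c < 1 ∧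
    ∀ ξ ∈ K, ∀ ν, ‖ν‖ ≤ r → G (cpoint ξ ν) ≤ c)
    ⟨ρ, 1 / 2, hρ, le_rfl, by norm_num, by norm_num, fun _ h => h.elim⟩
    (fun s t hst ⟨r, c, a1, a2, a3, a4, h⟩ => ⟨r, c, a1, a2, a3, a4, fun ξ hξ => h ξ (hst hξ)⟩)
    ?_ fun ξ₀ hξ₀ => ?_
  · rintro s t ⟨r, c, a1, a2, a3, a4, h⟩ ⟨r', c', a1', a2', a3', a4', h'⟩
    refine ⟨min r r', max c c', lt_min a1 a1', (min_le_left _ _).trans a2, lt_max_of_lt_left a3,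
      max_lt a4 a4', ?_⟩
    rintro ξ (hξ | hξ) ν hν
    · exact (h ξ hξ ν (hν.trans (min_le_left _ _))).trans (le_max_left _ _)
    · exact (h' ξ hξ ν (hν.trans (min_le_right _ _))).trans (le_max_right _ _)
  · obtain ⟨c, hc, hc1⟩ := exists_between (max_lt (h1 ξ₀ hξ₀) one_pos)
    have hcont : ContinuousOn (fun p : (Fin d → ℝ) × (Fin d → ℝ) => G (cpoint p.1 p.2))
        {p | ‖p.2‖ ≤ ρ} :=
      hG.comp continuous_cpoint.continuousOn fun p hp => cpoint_mem_strip p.1 hp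
    have hnhds : {p : (Fin d → ℝ) × (Fin d → ℝ) | ‖p.2‖ ≤ ρ} ∈ 𝓝 (ξ₀, (0 : Fin d → ℝ)) := by
      have : ContinuousAt (fun p : (Fin d → ℝ) × (Fin d → ℝ) => ‖p.2‖) (ξ₀, 0) := by fun_prop
      have h2 := this.eventually_lt continuousAt_const (by simpa using hρ)
      filter_upwards [h2] with p hp using hp.le
    have hev := (hcont.continuousAt hnhds).eventually_lt continuousAt_const
      (show G (cpoint ξ₀ 0) < c by
        rw [cpoint_zero]
        exact (le_max_left _ _).trans_lt hc)
    obtain ⟨δ, hδ, hball⟩ := Metric.eventually_nhds_iff.1 hev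
    refine ⟨Metric.ball ξ₀ δ, mem_nhdsWithin_of_mem_nhds (Metric.ball_mem_nhds _ hδ),
      min (δ / 2) ρ, c, by positivity, min_le_right _ _, (le_max_right _ _).trans_lt hc, hc1, ?_⟩
    intro ξ hξ ν hν
    refine (hball (y := (ξ, ν)) ?_).le
    rw [Prod.dist_eq, max_lt_iff]
    refine ⟨hξ, ?_⟩
    rw [dist_zero_right]
    linarith [hν.trans (min_le_left _ _)]

end ConvPow

/-! ### The contribution of one point of modulus 1 -/

namespace ConvPow

open MeasureTheory

variable {d : ℕ}

section Piece

variable {ρ : ℝ} {φ : (Fin d → ℤ) → ℂ} {F : (Fin d → ℂ) → ℂ} {ξ₀ α : Fin d → ℝ}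
  {P : MvPolynomial (Fin d) ℂ} {p : ℕ → (Fin d → ℂ) → ℂ} {g : (Fin d → ℂ) → ℝ}

theorem box_subset (a : Fin d → ℝ) : box a ⊆ Metric.closedBall a Real.pi := by
  intro ξ hξ
  rw [Metric.mem_closedBall, dist_pi_le_iff Real.pi_pos.le]
  intro i
  have := hξ i trivial
  rw [Real.dist_eq, abs_le]
  constructor <;> linarith [this.1, this.2]

/-- Away from the translates of `ξ₀`, the localized powers of the Fourier transform are
exponentially small. -/
theorem exists_far_bound (h : StripSeries ρ φ F) (hρ : 0 < ρ) (h1 : ∀ ξ, ‖fourier φ ξ‖ ≤ 1)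
    (hg : Continuous g) (hg0 : ∀ ζ, 0 ≤ g ζ) (hg1 : ∀ ξ, g (toComplex ξ) ≤ 1)
    (hgΩ : ∀ t ∈ Omega φ, t ≠ ξ₀ → ∀ m, g (toComplex (t + period m)) < 1) {r₀ : ℝ} (hr₀ : 0 < r₀) :
    ∃ r c, 0 < r ∧ r ≤ ρ ∧ 0 < c ∧ c < 1 ∧ ∀ ξ ∈ box ξ₀, r₀ ≤ dist ξ ξ₀ → ∀ ν, ‖ν‖ ≤ r →
      g (cpoint ξ ν) * ‖F (cpoint ξ ν)‖ ≤ c := by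
  have hK : IsCompact (Metric.closedBall ξ₀ Real.pi ∩ {ξ | r₀ ≤ dist ξ ξ₀}) :=
    (isCompact_closedBall _ _).inter_right (isClosed_le continuous_const (by fun_prop))
  obtain ⟨r, c, hr, hrρ, hc, hc1, hb⟩ := exists_uniform_bound hρ
    (G := fun ζ => g ζ * ‖F ζ‖) (hg.continuousOn.mul h.continuousOn.norm) hK (by
      rintro ξ ⟨hξ1, hξ2⟩
      rw [h.eq_fourier hρ.le]
      -- Either the Fourier transform has modulus below 1, or ξ is a translate of a point of `Omega
      -- φ` other than ξ₀, where g < 1.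
      rcases (h1 ξ).lt_or_eq with hlt | heq
      · have := hg1 ξ
        have := hg0 (toComplex ξ)
        have := norm_nonneg (fourier φ ξ)
        nlinarith
      · rw [heq, mul_one]
        obtain ⟨m, hm⟩ := exists_add_period_mem_torus ξ
        have hΩ : ξ + period m ∈ Omega φ := ⟨hm, by rw [fourier_add_period, heq]⟩
        have hneg : period (-m) = -period m := by
          ext i
          simp [period]
        -- A translate of ξ₀ within distance π of ξ₀ is ξ₀ itself, which the condition of distance
        -- at least r₀ excludes.
        by_cases hξ₀ : ξ + period m = ξ₀
        · exfalso
          have hm0 : m = 0 := eq_zero_of_abs_period_lt fun i => by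
            have e1 := (dist_le_pi_dist ξ ξ₀ i).trans hξ1
            rw [← hξ₀, Real.dist_eq] at e1
            simp only [Pi.add_apply, sub_add_cancel_left, abs_neg] at e1
            linarith [Real.pi_pos]
          rw [hm0, period_zero, add_zero] at hξ₀
          have : r₀ ≤ dist ξ ξ₀ := hξ2
          rw [hξ₀, dist_self] at this
          linarith
        · have := hgΩ _ hΩ hξ₀ (-m)
          rwa [hneg, add_neg_cancel_right] at this)
  exact ⟨r, c, hr, hrρ, hc, hc1, fun ξ hξ hd ν hν => hb ξ ⟨box_subset ξ₀ hξ, hd⟩ ν hν⟩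

/-- The exponent picked in `homOrder` is one for R, not necessarily for P; every estimate on R holds
for it, so independence of the trace is not needed. -/
theorem IsPosHomPoly.posHomFun_homOrder (hP : IsPosHomPoly P) :
    ∃ E, PosHomFun (rePoly P) E ∧ homOrder (rePoly P) = E.trace := by
  have hne : (expSet (rePoly P)).Nonempty := hP.1.mono (expSet_polyFun_subset P)
  exact ⟨hne.choose, hP.posHomFun hne.choose_spec, by rw [homOrder, dif_pos hne]⟩

theorem dist_cpoint_toComplex_le (ξ a ν : Fin d → ℝ) :
    dist (cpoint ξ ν) (toComplex a) ≤ dist ξ a + ‖ν‖ := by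
  have e : cpoint ξ ν - toComplex a = toComplex (ξ - a) + (-Complex.I) • toComplex ν := by
    rw [cpoint_eq]
    ext i
    simp only [toComplex, Pi.add_apply, Pi.sub_apply, Complex.ofReal_sub]
    ring
  rw [dist_eq_norm, dist_eq_norm, e]
  refine (norm_add_le _ _).trans (add_le_add (norm_toComplex_le _) ?_)
  rw [norm_smul, norm_neg, Complex.norm_I, one_mul]
  exact norm_toComplex_le ν

/-- The coefficients of a localized power of the Fourier transform, in terms of the shift `ν` of the
torus of integration. -/
theorem exists_shifted_bound (h : StripSeries ρ φ F) (hρ : 0 < ρ)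
    (h1 : ∀ ξ, ‖fourier φ ξ‖ ≤ 1) (hξ₀ : ξ₀ ∈ Omega φ) (hP : IsPosHomTypeWith φ ξ₀ α P)
    (hg : Continuous g) (hg0 : ∀ ζ, 0 ≤ g ζ) (hg1 : ∀ ξ, g (toComplex ξ) ≤ 1)
    (hgΩ : ∀ t ∈ Omega φ, t ≠ ξ₀ → ∀ m, g (toComplex (t + period m)) < 1)
    (hpg : ∀ n ζ, ‖p n ζ‖ ≤ g ζ ^ n)
    (hpb : ∃ r C, 0 < r ∧ ∀ n ζ, dist ζ (toComplex ξ₀) < r → ‖p n ζ‖ ≤ C) :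
    ∃ r M D κ, 0 < r ∧ 0 < M ∧ 0 < D ∧ 0 < κ ∧ ∀ n : ℕ, 1 ≤ n → ∀ ψ,
      StripSeries ρ ψ (p n * F ^ n) → ∀ ν : Fin d → ℝ, ‖ν‖ ≤ r → ∀ x : Fin d → ℤ,
        ‖ψ x‖ ≤ Real.exp (-∑ i, (x i : ℝ) * ν i) *
          (D / (n : ℝ) ^ homOrder (rePoly P) *
            Real.exp (n * ((∑ i, α i * ν i) + M * rePoly P ν)) + Real.exp (-(κ * n))) := by
  obtain ⟨ε, M, r₁, hε, hM, hr₁, hr₁ρ, hloc⟩ := exists_local_bound h hρ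
    (by rw [h.eq_fourier hρ.le]; exact hξ₀.2) hP
  obtain ⟨r₂, C, hr₂, hC⟩ := hpb
  have hC0 : 0 ≤ C := (norm_nonneg _).trans (hC 0 (toComplex ξ₀) (by simpa using hr₂))
  -- Half of r₂ is reserved for the imaginary part: ξ - iν must lie within r₂ of ξ₀.
  set r₀ := min r₁ (r₂ / 2) with hr₀
  obtain ⟨r₃, c, hr₃, hr₃ρ, hc, hc1, hfar⟩ := exists_far_bound h hρ h1 hg hg0 hg1 hgΩ
    (r₀ := r₀) (by positivity)
  obtain ⟨E, hR, hE⟩ := hP.1.posHomFun_homOrder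
  obtain ⟨I, hI, hint⟩ := hR.integral_exp_neg_le hε
  set R := rePoly P with hRdef
  refine ⟨min r₀ r₃, M, C * I + 1, -Real.log c, by positivity, hM, by positivity,
    by linarith [Real.log_neg hc hc1], fun n hn ψ hψ ν hν x => ?_⟩
  have hνr₀ : ‖ν‖ ≤ r₀ := hν.trans (min_le_left _ _)
  have hνr₁ : ‖ν‖ ≤ r₁ := hνr₀.trans (min_le_left _ _)
  have hνr₂ : ‖ν‖ ≤ r₂ / 2 := hνr₀.trans (min_le_right _ _)
  have hνr₃ : ‖ν‖ ≤ r₃ := hν.trans (min_le_right _ _)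
  have hcn : Real.exp (-(-Real.log c * n)) = c ^ n := by
    rw [neg_mul, neg_neg, mul_comm, Real.exp_nat_mul, Real.exp_log hc]
  rw [hcn]
  set A := Real.exp (n * ((∑ i, α i * ν i) + M * R ν)) with hA
  refine (hψ.norm_coeff_le ξ₀ (hνr₁.trans hr₁ρ) x).trans ?_
  refine mul_le_mul_of_nonneg_left ?_ (Real.exp_pos _).le
  obtain ⟨hint1, hint2⟩ := hint n hn
  have hint1' : Integrable fun ξ : Fin d → ℝ => Real.exp (-(n * (ε * R (ξ - ξ₀)))) :=
    hint1.comp_sub_right ξ₀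
  have hpt : ∀ ξ ∈ box ξ₀, ‖(p n * F ^ n) (cpoint ξ ν)‖ ≤
      C * A * Real.exp (-(n * (ε * R (ξ - ξ₀)))) + c ^ n := by
    intro ξ hξ
    rw [Pi.mul_apply, Pi.pow_apply, norm_mul, norm_pow]
    rcases lt_or_ge (dist ξ ξ₀) r₀ with hlt | hge
    · have e1 : ‖p n (cpoint ξ ν)‖ ≤ C := hC n _ (by
        have := dist_cpoint_toComplex_le ξ ξ₀ ν
        have := hlt.trans_le (min_le_right _ _)
        linarith)
      have e2 := hloc (ξ - ξ₀) ν
        (by rw [← dist_eq_norm]; exact hlt.le.trans (min_le_left _ _)) hνr₁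
      rw [sub_add_cancel] at e2
      have e3 : ‖F (cpoint ξ ν)‖ ^ n ≤ A * Real.exp (-(n * (ε * R (ξ - ξ₀)))) := by
        refine (pow_le_pow_left₀ (norm_nonneg _) e2 n).trans (le_of_eq ?_)
        rw [← Real.exp_nat_mul, hA, ← Real.exp_add]
        congr 1
        ring
      calc ‖p n (cpoint ξ ν)‖ * ‖F (cpoint ξ ν)‖ ^ n
          ≤ C * (A * Real.exp (-(n * (ε * R (ξ - ξ₀))))) := by gcongr
        _ = C * A * Real.exp (-(n * (ε * R (ξ - ξ₀)))) := by ring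
        _ ≤ _ := le_add_of_nonneg_right (by positivity)
    · have e1 := hfar ξ hξ hge ν hνr₃
      calc ‖p n (cpoint ξ ν)‖ * ‖F (cpoint ξ ν)‖ ^ n
          ≤ g (cpoint ξ ν) ^ n * ‖F (cpoint ξ ν)‖ ^ n := by
            gcongr
            exact hpg n _
        _ = (g (cpoint ξ ν) * ‖F (cpoint ξ ν)‖) ^ n := (mul_pow _ _ _).symm
        _ ≤ c ^ n := by
            have := hg0 (cpoint ξ ν)
            gcongr
        _ ≤ _ := le_add_of_nonneg_left (by positivity)
  have hpi : (1 : ℝ) ≤ (2 * Real.pi) ^ d := one_le_pow₀ (by linarith [Real.pi_gt_three])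
  have hpi0 : (0 : ℝ) < (2 * Real.pi) ^ d := by positivity
  have hmain : ∫ ξ in box ξ₀, ‖(p n * F ^ n) (cpoint ξ ν)‖ ≤
      C * A * (I / (n : ℝ) ^ E.trace) + (2 * Real.pi) ^ d * c ^ n := by
    have hmeas : MeasurableSet (box ξ₀) := MeasurableSet.univ_pi fun i => measurableSet_Ioc
    calc ∫ ξ in box ξ₀, ‖(p n * F ^ n) (cpoint ξ ν)‖
        ≤ ∫ ξ in box ξ₀, (C * A * Real.exp (-(n * (ε * R (ξ - ξ₀)))) + c ^ n) :=
          setIntegral_mono_on (hψ.integrableOn_norm ξ₀ (hνr₁.trans hr₁ρ))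
            ((hint1'.integrableOn.const_mul _).add (integrable_const _)) hmeas hpt
      _ = C * A * (∫ ξ in box ξ₀, Real.exp (-(n * (ε * R (ξ - ξ₀))))) +
            (2 * Real.pi) ^ d * c ^ n := by
          rw [integral_add (hint1'.integrableOn.const_mul _) (integrable_const _),
            integral_const_mul, setIntegral_const, measureReal_box, smul_eq_mul]
      _ ≤ C * A * (∫ ξ, Real.exp (-(n * (ε * R (ξ - ξ₀))))) + (2 * Real.pi) ^ d * c ^ n := by
          refine add_le_add (mul_le_mul_of_nonneg_left ?_ (by positivity)) le_rfl
          exact setIntegral_le_integral hint1'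
            (Filter.Eventually.of_forall fun ξ => (Real.exp_pos _).le)
      _ ≤ _ := by
          gcongr
          rw [integral_sub_right_eq_self fun ξ => Real.exp (-(n * (ε * R ξ)))]
          exact hint2
  have hn0 : (0 : ℝ) < n := by exact_mod_cast hn
  have hμ : 0 < (n : ℝ) ^ E.trace := by positivity
  rw [hE, inv_mul_le_iff₀ hpi0, mul_add]
  refine hmain.trans (add_le_add ?_ le_rfl)
  calc C * A * (I / (n : ℝ) ^ E.trace) = 1 * ((C * I) / (n : ℝ) ^ E.trace * A) := by ring
    _ ≤ (2 * Real.pi) ^ d * ((C * I + 1) / (n : ℝ) ^ E.trace * A) := by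
        gcongr
        linarith

theorem exists_rpow_mul_exp_le (μ : ℝ) {b : ℝ} (hb : 0 < b) :
    ∃ W, 0 < W ∧ ∀ n : ℕ, 1 ≤ n → Real.exp (-(b * n)) ≤ W / (n : ℝ) ^ μ := by
  have h := (tendsto_rpow_mul_exp_neg_mul_atTop_nhds_zero μ b hb).comp
    tendsto_natCast_atTop_atTop
  obtain ⟨W, hW⟩ := h.bddAbove_range
  refine ⟨max W 1, by positivity, fun n hn => ?_⟩
  have hn0 : (0 : ℝ) < n := by exact_mod_cast hn
  rw [le_div_iff₀ (by positivity), mul_comm]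
  refine le_max_of_le_left ?_
  have := hW ⟨n, rfl⟩
  simpa using this

/-- The shift is the one from `exists_shift`. The rate κ of the far term is split three ways: κ/2
pays for exp(-x·ν), κ/4 for the Legendre factor and κ/4 for n^(-μ). -/
theorem exists_legendre_bound (h : StripSeries ρ φ F) (hρ : 0 < ρ)
    (h1 : ∀ ξ, ‖fourier φ ξ‖ ≤ 1) (hξ₀ : ξ₀ ∈ Omega φ) (hP : IsPosHomTypeWith φ ξ₀ α P)
    (hg : Continuous g) (hg0 : ∀ ζ, 0 ≤ g ζ) (hg1 : ∀ ξ, g (toComplex ξ) ≤ 1)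
    (hgΩ : ∀ t ∈ Omega φ, t ≠ ξ₀ → ∀ m, g (toComplex (t + period m)) < 1)
    (hpg : ∀ n ζ, ‖p n ζ‖ ≤ g ζ ^ n)
    (hpb : ∃ r C, 0 < r ∧ ∀ n ζ, dist ζ (toComplex ξ₀) < r → ‖p n ζ‖ ≤ C) {L : ℝ} (hL : 0 < L) :
    ∃ M C, 0 < M ∧ 0 < C ∧ ∀ n : ℕ, 1 ≤ n → ∀ ψ, StripSeries ρ ψ (p n * F ^ n) →
      ∀ x : Fin d → ℤ, latticeNorm x ≤ L * n →
        ‖ψ x‖ ≤ C / (n : ℝ) ^ homOrder (rePoly P) * Real.exp (-(n * M *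
          legendre (rePoly P) (fun i => ((x i : ℝ) - n * α i) / n))) := by
  obtain ⟨r, M, D, κ, hr, hM, hD, hκ, hb⟩ :=
    exists_shifted_bound h hρ h1 hξ₀ hP hg hg0 hg1 hgΩ hpg hpb
  obtain ⟨E, hR, -⟩ := hP.1.posHomFun_homOrder
  -- With this radius |x·ν| ≤ κn/2 whenever |x| ≤ Ln.
  set r' := min r (κ / (2 * (d * L + 1))) with hr'
  have hr'0 : 0 < r' := by positivity
  obtain ⟨θ, V, hθ, hV, hshift⟩ := hR.exists_shift (Y := L + ‖α‖) (by positivity) hr'0 hM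
  obtain ⟨W, hW, hW'⟩ := exists_rpow_mul_exp_le (homOrder (rePoly P)) (b := κ / 4) (by positivity)
  -- V bounds R^#(y) in this range, so M'·R^#(y) ≤ κ/4, and the far term also carries the Legendre
  -- factor.
  set M' := min θ (κ / 4 / V) with hM'
  refine ⟨M', D + W, by positivity, by positivity, fun n hn ψ hψ x hx => ?_⟩
  have hn0 : (0 : ℝ) < n := by exact_mod_cast hn
  set y : Fin d → ℝ := fun i => ((x i : ℝ) - n * α i) / n with hy
  have hyY : ‖y‖ ≤ L + ‖α‖ := by
    rw [pi_norm_le_iff_of_nonneg (by positivity)]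
    intro i
    have e1 := (norm_apply_le_latticeNorm x i).trans hx
    have e2 : |α i| ≤ ‖α‖ := norm_le_pi_norm α i
    rw [hy, Real.norm_eq_abs, abs_div, abs_of_pos hn0, div_le_iff₀ hn0]
    have e3 := abs_sub (x i : ℝ) (n * α i)
    rw [abs_mul, abs_of_pos hn0] at e3
    have e4 : (n : ℝ) * |α i| ≤ n * ‖α‖ := by gcongr
    linarith
  obtain ⟨hleg0, hlegV, ν, hν, hν'⟩ := hshift y hyY
  set Λ := legendre (rePoly P) y with hΛ
  have hM'Λ : θ * Λ ≥ M' * Λ := mul_le_mul_of_nonneg_right (min_le_left _ _) hleg0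
  have hM'κ : M' * Λ ≤ κ / 4 := by
    calc M' * Λ ≤ κ / 4 / V * V := by
          gcongr
          exact min_le_right _ _
      _ = κ / 4 := div_mul_cancel₀ _ hV.ne'
  have hmain := hb n hn ψ hψ ν (hν.trans (min_le_left _ _)) x
  refine hmain.trans ?_
  have hxν : -∑ i, (x i : ℝ) * ν i ≤ κ / 2 * n := by
    have e1 := abs_dot_le (fun i => (x i : ℝ)) ν
    have e2 : ‖fun i => (x i : ℝ)‖ ≤ L * n := by
      rw [pi_norm_le_iff_of_nonneg (by positivity)]
      exact fun i => (norm_apply_le_latticeNorm x i).trans hx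
    have e3 : ‖ν‖ * (2 * (d * L + 1)) ≤ κ := by
      rw [← le_div_iff₀ (by positivity)]
      exact hν.trans (min_le_right _ _)
    have e4 : (d : ℝ) * ‖fun i => (x i : ℝ)‖ * ‖ν‖ ≤ d * (L * n) * ‖ν‖ := by gcongr
    have e5 : (d : ℝ) * (L * n) * ‖ν‖ ≤ κ / 2 * n := by
      have : (d : ℝ) * L * ‖ν‖ ≤ κ / 2 := by
        have := norm_nonneg ν
        nlinarith
      calc (d : ℝ) * (L * n) * ‖ν‖ = (d : ℝ) * L * ‖ν‖ * n := by ring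
        _ ≤ κ / 2 * n := by gcongr
    linarith [neg_abs_le (∑ i, (x i : ℝ) * ν i)]
  have hμ : 0 < (n : ℝ) ^ homOrder (rePoly P) := by positivity
  have t1 : Real.exp (-∑ i, (x i : ℝ) * ν i) *
      Real.exp (n * ((∑ i, α i * ν i) + M * rePoly P ν)) ≤ Real.exp (-(n * M' * Λ)) := by
    rw [← Real.exp_add]
    refine Real.exp_le_exp.2 ?_
    have e1 : ∑ i, (x i : ℝ) * ν i = n * (∑ i, ν i * y i) + n * ∑ i, α i * ν i := by
      rw [Finset.mul_sum, Finset.mul_sum, ← Finset.sum_add_distrib]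
      refine Finset.sum_congr rfl fun i _ => ?_
      rw [hy]
      field_simp
      ring
    rw [e1]
    calc _ = n * (-(∑ i, ν i * y i) + M * rePoly P ν) := by ring
      _ ≤ n * (-(M' * Λ)) := by
          gcongr
          linarith
      _ = _ := by ring
  have t2 : Real.exp (-∑ i, (x i : ℝ) * ν i) * Real.exp (-(κ * n)) ≤
      W / (n : ℝ) ^ homOrder (rePoly P) * Real.exp (-(n * M' * Λ)) := by
    calc Real.exp (-∑ i, (x i : ℝ) * ν i) * Real.exp (-(κ * n))
        ≤ Real.exp (-(κ / 4 * n)) * Real.exp (-(n * M' * Λ)) := by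
          rw [← Real.exp_add, ← Real.exp_add]
          refine Real.exp_le_exp.2 ?_
          have : n * (M' * Λ) ≤ n * (κ / 4) := by gcongr
          linarith
      _ ≤ _ := by
          gcongr
          exact hW' n hn
  calc _ = D / (n : ℝ) ^ homOrder (rePoly P) * (Real.exp (-∑ i, (x i : ℝ) * ν i) *
          Real.exp (n * ((∑ i, α i * ν i) + M * rePoly P ν))) +
        Real.exp (-∑ i, (x i : ℝ) * ν i) * Real.exp (-(κ * n)) := by ring
    _ ≤ D / (n : ℝ) ^ homOrder (rePoly P) * Real.exp (-(n * M' * Λ)) +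
        W / (n : ℝ) ^ homOrder (rePoly P) * Real.exp (-(n * M' * Λ)) := by gcongr
    _ = _ := by ring

end Piece

/-- The shift ρ·sign(xᵢ) in each coordinate gains the full factor exp(-ρ|x|₁). -/
theorem StripSeries.norm_convPow_le {ρ : ℝ} {φ : (Fin d → ℤ) → ℂ} {F : (Fin d → ℂ) → ℂ}
    (h : StripSeries ρ φ F) (hρ : 0 < ρ) {a : ℝ} (ha : ∀ ζ ∈ strip d ρ, ‖F ζ‖ ≤ Real.exp a) (n : ℕ)
    (x : Fin d → ℤ) : ‖convPow φ n x‖ ≤ Real.exp (a * n - ρ * latticeNorm x) := by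
  set ν : Fin d → ℝ := fun i => ρ * (SignType.sign (x i : ℝ) : ℝ) with hν
  have hνρ : ‖ν‖ ≤ ρ := by
    rw [pi_norm_le_iff_of_nonneg hρ.le]
    intro i
    rw [hν, norm_mul, Real.norm_of_nonneg hρ.le]
    have : ‖(SignType.sign (x i : ℝ) : ℝ)‖ ≤ 1 := by
      rcases SignType.sign (x i : ℝ) with _ | _ | _ <;> simp
    nlinarith
  have hdot : ∑ i, (x i : ℝ) * ν i = ρ * oneNorm x := by
    rw [oneNorm, Finset.mul_sum]
    refine Finset.sum_congr rfl fun i _ => ?_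
    rw [hν, ← self_mul_sign]
    ring
  have hb := (h.pow_convPow hρ.le n).norm_coeff_le 0 hνρ x
  have hint : ∫ ξ in box 0, ‖(F ^ n) (cpoint ξ ν)‖ ≤ (2 * Real.pi) ^ d * Real.exp (a * n) := by
    rw [← measureReal_box (d := d) 0, ← smul_eq_mul, ← setIntegral_const]
    refine integral_mono_of_nonneg (Filter.Eventually.of_forall fun _ => norm_nonneg _)
      (integrable_const _) (Filter.Eventually.of_forall fun ξ => ?_)
    simp only [Pi.pow_apply, norm_pow]
    rw [mul_comm a, Real.exp_nat_mul]
    exact pow_le_pow_left₀ (norm_nonneg _) (ha _ (cpoint_mem_strip ξ hνρ)) n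
  have hpi : (0 : ℝ) < (2 * Real.pi) ^ d := by positivity
  rw [← inv_mul_le_iff₀ hpi] at hint
  refine hb.trans ?_
  rw [hdot, sub_eq_neg_add, Real.exp_add]
  gcongr
  exact latticeNorm_le_oneNorm x

end ConvPow

/-! ### Assembly of the pieces -/

theorem theorem1p5 {d : ℕ} (φ : (Fin d → ℤ) → ℂ) (hφ : ConvPow.MemHStar φ)
    (α : (Fin d → ℝ) → (Fin d → ℝ)) (P : (Fin d → ℝ) → MvPolynomial (Fin d) ℂ)
    (hP : ∀ ξ ∈ ConvPow.Omega φ, ConvPow.IsPosHomTypeWith φ ξ (α ξ) (P ξ)) :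
    ∃ hfin : (ConvPow.Omega φ).Finite,
      (∀ ξ ∈ ConvPow.Omega φ, ∀ y : Fin d → ℝ,
        BddAbove (Set.range fun η : Fin d → ℝ =>
          (∑ i, y i * η i) - ConvPow.rePoly (P ξ) η)) ∧
      ∃ (L M₀ : ℝ) (M C : (Fin d → ℝ) → ℝ),
        0 < L ∧ 0 < M₀ ∧ (∀ ξ ∈ ConvPow.Omega φ, 0 < M ξ ∧ 0 < C ξ) ∧
        ∀ n : ℕ, 1 ≤ n → ∀ x : Fin d → ℤ,
          (L * n < ConvPow.latticeNorm x →
            ‖ConvPow.convPow φ n x‖ ≤ Real.exp (-M₀ * (n + ConvPow.latticeNorm x))) ∧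
          (ConvPow.latticeNorm x ≤ L * n →
            ‖ConvPow.convPow φ n x‖ ≤
              ∑ ξ ∈ hfin.toFinset,
                C ξ / (n : ℝ) ^ ConvPow.homOrder (ConvPow.rePoly (P ξ)) *
                  Real.exp (-(n * M ξ *
                    ConvPow.legendre (ConvPow.rePoly (P ξ))
                      (fun i => ((x i : ℝ) - n * α ξ i) / n)))) := by
  obtain ⟨ρ, hρ, hs⟩ := hφ.1.exists_summable
  have h := ConvPow.StripSeries.of_summable hs
  set F : (Fin d → ℂ) → ℂ := fun ζ => ∑' x, φ x * ConvPow.character x ζ with hF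
  have h1 := ConvPow.norm_fourier_le_one hφ
  have hfin := h.finite_Omega hρ hP
  have hne : hfin.toFinset.Nonempty := by
    rw [Set.Finite.toFinset_nonempty]
    exact h.nonempty_Omega hρ hφ
  have hmem : ∀ {ξ}, ξ ∈ hfin.toFinset ↔ ξ ∈ ConvPow.Omega φ := hfin.mem_toFinset
  obtain ⟨p, g, hsum, hpg⟩ := ConvPow.exists_partition hρ.le hfin.toFinset hne
    fun s hs t ht hst => ConvPow.torus_ne_add_period (hmem.1 hs).1 (hmem.1 ht).1 hst
  -- The maximum with 1 ensures a ≥ 0, hence L > 0.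
  set a := Real.log (max 1 (∑' x, ‖φ x‖ * Real.exp (ρ * ConvPow.oneNorm x))) with ha
  have ha0 : 0 ≤ a := Real.log_nonneg (le_max_left _ _)
  have hFa : ∀ ζ ∈ ConvPow.strip d ρ, ‖F ζ‖ ≤ Real.exp a := by
    intro ζ hζ
    rw [ha, Real.exp_log (by positivity)]
    exact (h.norm_le hζ).trans (le_max_right _ _)
  -- This is the threshold beyond which an - ρ|x| ≤ -(ρ/2)(n + |x|).
  set L := (2 * a + ρ) / ρ with hL
  have hL0 : 0 < L := by positivity
  have hpiece : ∀ ξ ∈ ConvPow.Omega φ, ∃ M C, 0 < M ∧ 0 < C ∧ ∀ n : ℕ, 1 ≤ n → ∀ ψ,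
      ConvPow.StripSeries ρ ψ (p ξ n * F ^ n) → ∀ x : Fin d → ℤ,
        ConvPow.latticeNorm x ≤ L * n →
        ‖ψ x‖ ≤ C / (n : ℝ) ^ ConvPow.homOrder (ConvPow.rePoly (P ξ)) * Real.exp (-(n * M *
          ConvPow.legendre (ConvPow.rePoly (P ξ)) (fun i => ((x i : ℝ) - n * α ξ i) / n))) := by
    intro ξ hξ
    obtain ⟨-, hg, hpg', hg0, hg1, hgΩ, hpb⟩ := hpg ξ (hmem.2 hξ)
    exact ConvPow.exists_legendre_bound h hρ h1 hξ (hP ξ hξ) hg hg0 hg1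
      (fun t ht => hgΩ t (hmem.2 ht)) hpg' hpb hL0
  choose! M C hM hC hMC using hpiece
  refine ⟨hfin, fun ξ hξ y => ?_, L, ρ / 2, M, C, hL0, by positivity,
    fun ξ hξ => ⟨hM ξ hξ, hC ξ hξ⟩, fun n hn x => ⟨fun hx => ?_, fun hx => ?_⟩⟩
  · obtain ⟨E, hR, -⟩ := (hP ξ hξ).1.posHomFun_homOrder
    exact hR.bddAbove_legendre y
  · refine (h.norm_convPow_le hρ hFa n x).trans (Real.exp_le_exp.2 ?_)
    have e : (2 * a + ρ) * n < ρ * ConvPow.latticeNorm x := by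
      calc (2 * a + ρ) * n = ρ * (L * n) := by rw [hL]; field_simp
        _ < _ := by gcongr
    linarith
  · have hstrip : ∀ ξ ∈ hfin.toFinset, ConvPow.IsStripFun ρ (p ξ n * F ^ n) := fun ξ hξ =>
      ((hpg ξ hξ).1 n).mul hρ.le ⟨_, h.pow_convPow hρ.le n⟩
    choose! ψ hψ using hstrip
    have hone : ∑ ξ ∈ hfin.toFinset, p ξ n * F ^ n = F ^ n := by
      ext ζ
      rw [Finset.sum_apply]
      simp only [Pi.mul_apply]
      rw [← Finset.sum_mul, hsum, one_mul]
    have hsumψ := ConvPow.StripSeries.sum hfin.toFinset hψ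
    rw [hone] at hsumψ
    -- Uniqueness of coefficients turns the splitting of F^n into a splitting of the convolution
    -- power.
    rw [(h.pow_convPow hρ.le n).unique hsumψ hρ.le, Finset.sum_apply]
    exact (norm_sum_le _ _).trans (Finset.sum_le_sum fun ξ hξ =>
      hMC ξ (hmem.1 hξ) n hn (ψ ξ) (hψ ξ hξ) x hx)
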